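/- Let $\gamma>0$, $\nu\in(0,1)$ and $c_\nu:=\nu^2-\frac14$. Let $\tilde H^2_0(-1,1):=\{u\in H^2(-1,1): u(0)=u'(0)=0\}$, and let $D(A)$ be the set of all $f\in L^2(-1,1)$ (real-valued) of the form $f=f_r+f_s$ with $f_r\in\tilde H^2_0(-1,1)$ and $$f_s(x)=c_1^+|x|^{\nu+\frac12}+c_2^+|x|^{-\nu+\frac12}\ \text{ on }(0,1),\qquad f_s(x)=c_1^-|x|^{\nu+\frac12}+c_2^-|x|^{-\nu+\frac12}\ \text{ on }(-1,0),$$ for some real $c_1^\pm,c_2^\pm$, such that $f(-1)=f(1)=0$, $c_1^-+c_2^-+c_1^++c_2^+=0$ and $$(\nu+\tfrac12)c_1^-+(-\nu+\tfrac12)c_2^-=(\nu+\tfrac12)c_1^++(-\nu+\tfrac12)c_2^+.$$ For $n\in\mathbb N^*=\{1,2,\dots\}$ let $A_n$ be the operator on $L^2(-1,1)$ with domain $D(A)$ given by $$A_nf(x)=-\partial^2_{xx}f(x)+\frac{c_\nu}{x^2}f(x)+(n\pi)^2|x|^{2\gamma}f(x),$$ where $\partial^2_{xx}$ is taken in the weak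 sense on $(-1,0)\cup(0,1)$; $D(A)$ carries the graph norm of $A_n$. Then for every $n\in\mathbb N^*$ and every $f^0\in L^2(-1,1)$ the problem $\partial_tf+A_nf=0$ for $t>0$, $f(0)=f^0$, has a unique solution $$f\in C^0([0,+\infty),L^2(-1,1))\cap C^0((0,+\infty),D(A))\cap C^1((0,+\infty),L^2(-1,1)).$$ This solution satisfies $\|f(t)\|_{L^2(-1,1)}\le\|f^0\|_{L^2(-1,1)}$ for all $t\ge0$. -/

import Mathlib

open MeasureTheory Set
open scoped ContDiff

namespace SingularHeat

/-- The Hilbert space `L²(-1,1)` of real-valued functions. -/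
abbrev L2 : Type := Lp ℝ 2 (volume.restrict (Ioo (-1 : ℝ) 1))

/-- `v` is the weak (distributional) derivative of `u` on the open set `Ω ⊆ ℝ`. -/
def HasWeakDerivOn (Ω : Set ℝ) (u v : ℝ → ℝ) : Prop :=
  LocallyIntegrableOn u Ω ∧ LocallyIntegrableOn v Ω ∧
    ∀ φ : ℝ → ℝ, ContDiff ℝ ∞ φ → HasCompactSupport φ → tsupport φ ⊆ Ω →
      ∫ x in Ω, u x * deriv φ x = -∫ x in Ω, v x * φ x

/-- `u ∈ H²(-1,1)`, with first and second weak derivatives `u'` and `u''`. -/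
structure IsH2 (u u' u'' : ℝ → ℝ) : Prop where
  memLp : MemLp u 2 (volume.restrict (Ioo (-1 : ℝ) 1))
  memLp' : MemLp u' 2 (volume.restrict (Ioo (-1 : ℝ) 1))
  memLp'' : MemLp u'' 2 (volume.restrict (Ioo (-1 : ℝ) 1))
  weakDeriv : HasWeakDerivOn (Ioo (-1 : ℝ) 1) u u'
  weakDeriv' : HasWeakDerivOn (Ioo (-1 : ℝ) 1) u' u''

/-- The space of `u ∈ H²(-1,1)` with `u(0) = u'(0) = 0`. Point values are those of the
representatives of `u` and `u'` that are continuous on `[-1,1]`; the function `u` itself is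
taken to be that representative. -/
def MemHTilde (u : ℝ → ℝ) : Prop :=
  ∃ u' u'' : ℝ → ℝ, IsH2 u u' u'' ∧
    ContinuousOn u (Icc (-1 : ℝ) 1) ∧ ContinuousOn u' (Icc (-1 : ℝ) 1) ∧ u 0 = 0 ∧ u' 0 = 0

/-- The singular function equal to `c₁⁺ |x|^(ν+1/2) + c₂⁺ |x|^(-ν+1/2)` for `x > 0` and to
`c₁⁻ |x|^(ν+1/2) + c₂⁻ |x|^(-ν+1/2)` for `x < 0`. -/
noncomputable def singularFun (ν c₁m c₂m c₁p c₂p : ℝ) (x : ℝ) : ℝ :=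
  if 0 < x then c₁p * |x| ^ (ν + 1 / 2) + c₂p * |x| ^ (-ν + 1 / 2)
  else c₁m * |x| ^ (ν + 1 / 2) + c₂m * |x| ^ (-ν + 1 / 2)

/-- The domain `D(A)`: sums of a regular part and a singular part which vanish at `±1` and
whose singular coefficients satisfy the two transmission conditions. -/
def MemDomain (ν : ℝ) (f : L2) : Prop :=
  ∃ (fr : ℝ → ℝ) (c₁m c₂m c₁p c₂p : ℝ),
    MemHTilde fr ∧
    (f : ℝ → ℝ) =ᵐ[volume.restrict (Ioo (-1 : ℝ) 1)]
      (fun x => fr x + singularFun ν c₁m c₂m c₁p c₂p x) ∧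
    fr (-1) + singularFun ν c₁m c₂m c₁p c₂p (-1) = 0 ∧
    fr 1 + singularFun ν c₁m c₂m c₁p c₂p 1 = 0 ∧
    c₁m + c₂m + c₁p + c₂p = 0 ∧
    (ν + 1 / 2) * c₁m + (-ν + 1 / 2) * c₂m = (ν + 1 / 2) * c₁p + (-ν + 1 / 2) * c₂p

/-- The graph of the unbounded operator `A_n` on `L²(-1,1)` with domain `D(A)`:
`f ∈ D(A)` and `g = -∂²f + (c/x²) f + (nπ)² |x|^(2γ) f`, where `c = ν² - 1/4` and the
derivatives are weak derivatives on `(-1,0) ∪ (0,1)`. -/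
def OpGraph (ν γ : ℝ) (n : ℕ) (f g : L2) : Prop :=
  MemDomain ν f ∧
    ∃ f' f'' : ℝ → ℝ,
      HasWeakDerivOn (Ioo (-1 : ℝ) 0 ∪ Ioo 0 1) f f' ∧
      HasWeakDerivOn (Ioo (-1 : ℝ) 0 ∪ Ioo 0 1) f' f'' ∧
      (g : ℝ → ℝ) =ᵐ[volume.restrict (Ioo (-1 : ℝ) 1)] fun x =>
        -f'' x + (ν ^ 2 - 1 / 4) / x ^ 2 * f x
          + ((n : ℝ) * Real.pi) ^ 2 * |x| ^ (2 * γ) * f x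

/-- Weak derivatives are unique. -/
theorem HasWeakDerivOn.ae_unique {Ω : Set ℝ} (hΩ : IsOpen Ω) {u₁ u₂ v₁ v₂ : ℝ → ℝ}
    (hu : u₁ =ᵐ[volume.restrict Ω] u₂)
    (h₁ : HasWeakDerivOn Ω u₁ v₁) (h₂ : HasWeakDerivOn Ω u₂ v₂) :
    v₁ =ᵐ[volume.restrict Ω] v₂ := by
  have hloc : LocallyIntegrableOn (fun x => v₁ x - v₂ x) Ω := h₁.2.1.sub h₂.2.1
  have key := hΩ.ae_eq_zero_of_integral_contDiff_smul_eq_zero hloc (fun φ hφ hc hs => by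
    have e₁ := h₁.2.2 φ hφ hc hs
    have e₂ := h₂.2.2 φ hφ hc hs
    have e₃ : ∫ x in Ω, u₁ x * deriv φ x = ∫ x in Ω, u₂ x * deriv φ x := by
      refine integral_congr_ae ?_
      filter_upwards [hu] with x hx
      rw [hx]
    have hint : ∀ v : ℝ → ℝ, LocallyIntegrableOn v Ω →
        Integrable (fun x => v x * φ x) (volume.restrict Ω) := by
      intro v hv
      have hK : IntegrableOn v (tsupport φ) := hv.integrableOn_compact_subset hs hc
      have h4 : IntegrableOn (fun x => v x * φ x) (tsupport φ) :=
        hK.mul_continuousOn hφ.continuous.continuousOn hc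
      have h5 : Integrable (fun x => v x * φ x) := by
        rw [← integrableOn_iff_integrable_of_support_subset (s := tsupport φ)]
        · exact h4
        · intro x hx
          apply subset_tsupport
          intro h0
          exact hx (by simp [h0])
      exact h5.restrict
    have e₄ : ∫ x, φ x • (v₁ x - v₂ x) = ∫ x in Ω, (v₁ x * φ x - v₂ x * φ x) := by
      rw [setIntegral_eq_integral_of_forall_compl_eq_zero]
      · exact integral_congr_ae (Filter.Eventually.of_forall fun x => by simp; ring)
      · intro x hx
        have : φ x = 0 := by
          by_contra h0
          exact hx (hs (subset_tsupport _ h0))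
        simp [this]
    rw [e₄, integral_sub (hint v₁ h₁.2.1) (hint v₂ h₂.2.1)]
    linarith)
  rw [Filter.EventuallyEq, ae_restrict_iff' hΩ.measurableSet]
  filter_upwards [key] with x hx hxΩ
  have := hx hxΩ
  linarith

/-- The graph is that of a (single-valued) operator. -/
theorem OpGraph.unique {ν γ : ℝ} {n : ℕ} {f g₁ g₂ : L2}
    (h₁ : OpGraph ν γ n f g₁) (h₂ : OpGraph ν γ n f g₂) : g₁ = g₂ := by
  obtain ⟨-, a', a'', ha', ha'', hg₁⟩ := h₁
  obtain ⟨-, b', b'', hb', hb'', hg₂⟩ := h₂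
  have hΩ : IsOpen (Ioo (-1 : ℝ) 0 ∪ Ioo 0 1) := isOpen_Ioo.union isOpen_Ioo
  have e' := ha'.ae_unique hΩ Filter.EventuallyEq.rfl hb'
  have e'' := ha''.ae_unique hΩ e' hb''
  have hsub : ∀ᵐ x ∂(volume.restrict (Ioo (-1 : ℝ) 1)), a'' x = b'' x := by
    rw [Filter.EventuallyEq, ae_restrict_iff' hΩ.measurableSet] at e''
    rw [ae_restrict_iff' measurableSet_Ioo]
    have h0 : ∀ᵐ x : ℝ, x ≠ 0 := by simp [ae_iff]
    filter_upwards [e'', h0] with x hx hx0 hxI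
    apply hx
    rcases lt_or_gt_of_ne hx0 with h | h
    · exact Or.inl ⟨hxI.1, h⟩
    · exact Or.inr ⟨h, hxI.2⟩
  apply Lp.ext
  filter_upwards [hg₁, hg₂, hsub] with x h1 h2 h3
  rw [h1, h2, h3]

/-- `f ∈ C⁰([0,∞), L²) ∩ C⁰((0,∞), D(A)) ∩ C¹((0,∞), L²)` solves `∂ₜf + A_n f = 0` for `t > 0`
with `f(0) = f⁰`. Here `D(A)` carries the graph norm of `A_n`, so that continuity into `D(A)`
is continuity of `t ↦ (f(t), A_n f(t))` into `L² × L²`. Values of `f` at `t < 0` play no role. -/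
structure IsSolution (ν γ : ℝ) (n : ℕ) (f₀ : L2) (f : ℝ → L2) : Prop where
  init : f 0 = f₀
  continuousOn : ContinuousOn f (Ici 0)
  continuousOn_domain : ∃ g : ℝ → L2, (∀ t, 0 < t → OpGraph ν γ n (f t) (g t)) ∧
    ContinuousOn (fun t => (f t, g t)) (Ioi 0)
  contDiffOn : ContDiffOn ℝ 1 f (Ioi 0)
  equation : ∀ t, 0 < t → ∃ g : L2, OpGraph ν γ n (f t) g ∧ deriv f t + g = 0

end SingularHeat

/-! The operator is nonnegative and self-adjoint, so the solution is `e^{-tA_n} f⁰`, and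
monotonicity of the operator gives uniqueness. Write `A_n = A + V`, with `A` the singular part `-∂²
+ c_ν/x²` (`SingGraph`) and `V` multiplication by the bounded function `(nπ)²|x|^{2γ}`.

Symmetry and positivity of `A` are boundary computations at `0`. After reflecting `(-1,0)`, each
half carries a function with leading behaviour `c₁ x^{ν+1/2} + c₂ x^{-ν+1/2}`. The Wronskian of two
such functions has a limit at `0` depending only on the coefficients
(`HasExpansion.tendsto_wronskian`); this gives Green's formula on each half
(`HalfSol.integral_symm`), and the transmission conditions cancel the two boundary terms. Positivity
comes from completing a square with the logarithmic derivative of a positive zero-energy solution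
(`HalfSol.le_integral`); the transmission conditions turn the two boundary terms into a single
square.

For the range, variation of constants solves `-f'' + c_ν f/x² = h` on each half (`exists_halfSol`),
and Hardy's inequality shows that what remains after removing the singular terms is `H²`. Matching
the halves is possible when `h` is orthogonal to the even zero mode `|x|^{ν+1/2} - |x|^{-ν+1/2}`, so
`A + P` is onto, with `P` a multiple of the projection onto that mode. A coercivity argument
(`exists_surjective_shift`) then makes `A + V + κ` onto for some `κ > 0`.

Hence `R = (A_n + κ)⁻¹` is bounded, symmetric and nonnegative with `‖R‖ ≤ κ⁻¹`. In its functional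
calculus `A_n` corresponds to `1/r - κ`, and `e^{-tA_n}` to `e^{-t(1/r-κ)}`, a function continuous
up to `r = 0`. Scalar estimates for this function give contractivity, differentiability and
membership in the domain for `t > 0` (`FunctionalCalculus.exists_heat_flow`). -/

namespace SingularHeat

/-! ### Functional calculus on real `L²` through complexification -/

/-- A continuous functional calculus for a bounded operator `R` on a real Hilbert space, on
functions on `[0, Λ]`. -/
structure FunctionalCalculus {H : Type*} [NormedAddCommGroup H] [InnerProductSpace ℝ H]
    (R : H →L[ℝ] H) (Λ : ℝ) (Φ : (ℝ → ℝ) → H →L[ℝ] H) : Prop where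
  map_sub : ∀ φ ψ : ℝ → ℝ, Continuous φ → Continuous ψ →
    Φ (fun r => φ r - ψ r) = Φ φ - Φ ψ
  map_smul : ∀ (c : ℝ) (φ : ℝ → ℝ), Continuous φ → Φ (fun r => c * φ r) = c • Φ φ
  map_id_mul : ∀ φ : ℝ → ℝ, Continuous φ → Φ (fun r => r * φ r) = R ∘L Φ φ
  map_mul_id : ∀ φ : ℝ → ℝ, Continuous φ → Φ (fun r => φ r * r) = Φ φ ∘L R
  map_one : Φ (fun _ => 1) = ContinuousLinearMap.id ℝ H
  norm_le : ∀ (φ : ℝ → ℝ) (C : ℝ), 0 ≤ C → (∀ r, 0 ≤ r → r ≤ Λ → |φ r| ≤ C) → ‖Φ φ‖ ≤ C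

section Complex

variable {E : Type*} [NormedAddCommGroup E] [InnerProductSpace ℂ E] [CompleteSpace E]

theorem spectrum_subset_Icc_of_isPositive {T : E →L[ℂ] E} {Λ : ℝ} (hT : T.IsPositive)
    (hΛ : ‖T‖ ≤ Λ) {r : ℝ} (hr : r ∈ spectrum ℝ T) : 0 ≤ r ∧ r ≤ Λ := by
  refine ⟨spectrum_nonneg_of_nonneg
    ((ContinuousLinearMap.nonneg_iff_isPositive T).2 hT) hr, ?_⟩
  rcases subsingleton_or_nontrivial E with h | h
  · have : Subsingleton (E →L[ℂ] E) := inferInstance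
    rw [spectrum.of_subsingleton] at hr
    exact hr.elim
  · have := spectrum.norm_le_norm_of_mem hr
    exact (le_abs_self r).trans (this.trans hΛ)

/-- The continuous functional calculus of a complex Hilbert space operator. -/
noncomputable def opFun (T : E →L[ℂ] E) (φ : ℝ → ℝ) : E →L[ℂ] E := cfc φ T

theorem opFun_sub (T : E →L[ℂ] E) {φ ψ : ℝ → ℝ} (hφ : Continuous φ) (hψ : Continuous ψ) :
    opFun T (fun r => φ r - ψ r) = opFun T φ - opFun T ψ :=
  cfc_sub φ ψ T hφ.continuousOn hψ.continuousOn

theorem opFun_smul (T : E →L[ℂ] E) (c : ℝ) {φ : ℝ → ℝ} (hφ : Continuous φ) :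
    opFun T (fun r => c * φ r) = (c : ℂ) • opFun T φ := by
  unfold opFun
  rw [cfc_const_mul c φ T hφ.continuousOn]
  ext x
  simp

theorem opFun_mul (T : E →L[ℂ] E) {φ ψ : ℝ → ℝ} (hφ : Continuous φ) (hψ : Continuous ψ) :
    opFun T (fun r => φ r * ψ r) = opFun T φ ∘L opFun T ψ :=
  cfc_mul φ ψ T hφ.continuousOn hψ.continuousOn

theorem opFun_id {T : E →L[ℂ] E} (hT : T.IsPositive) : opFun T (fun r => r) = T :=
  cfc_id' ℝ T hT.isSelfAdjoint

theorem opFun_one {T : E →L[ℂ] E} (hT : T.IsPositive) :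
    opFun T (fun _ => 1) = ContinuousLinearMap.id ℂ E :=
  cfc_const_one ℝ T hT.isSelfAdjoint

theorem norm_opFun_le {T : E →L[ℂ] E} {Λ : ℝ} (hT : T.IsPositive) (hΛ : ‖T‖ ≤ Λ)
    {φ : ℝ → ℝ} {C : ℝ} (hC : 0 ≤ C) (h : ∀ r, 0 ≤ r → r ≤ Λ → |φ r| ≤ C) :
    ‖opFun T φ‖ ≤ C :=
  norm_cfc_le hC fun r hr => by
    obtain ⟨h0, h1⟩ := spectrum_subset_Icc_of_isPositive hT hΛ hr
    exact h r h0 h1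

end Complex

/-- The Hilbert space of complex-valued square integrable functions. -/
abbrev L2C : Type := Lp ℂ 2 (volume.restrict (Ioo (-1 : ℝ) 1))

/-- The real part. -/
noncomputable def reL : L2C →L[ℝ] L2 := Complex.reCLM.compLpL 2 _

/-- The imaginary part. -/
noncomputable def imL : L2C →L[ℝ] L2 := Complex.imCLM.compLpL 2 _

/-- The embedding of real-valued into complex-valued functions. -/
noncomputable def ofL : L2 →L[ℝ] L2C := Complex.ofRealCLM.compLpL 2 _

theorem coeFn_reL (u : L2C) : (reL u : ℝ → ℝ) =ᵐ[volume.restrict (Ioo (-1 : ℝ) 1)]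
    fun x => (u x).re := ContinuousLinearMap.coeFn_compLpL _ _

theorem coeFn_imL (u : L2C) : (imL u : ℝ → ℝ) =ᵐ[volume.restrict (Ioo (-1 : ℝ) 1)]
    fun x => (u x).im := ContinuousLinearMap.coeFn_compLpL _ _

theorem coeFn_ofL (u : L2) : (ofL u : ℝ → ℂ) =ᵐ[volume.restrict (Ioo (-1 : ℝ) 1)]
    fun x => (u x : ℂ) := ContinuousLinearMap.coeFn_compLpL _ _

theorem reL_ofL (u : L2) : reL (ofL u) = u := by
  apply Lp.ext
  filter_upwards [coeFn_reL (ofL u), coeFn_ofL u] with x h1 h2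
  simp [h1, h2]

theorem imL_ofL (u : L2) : imL (ofL u) = 0 := by
  apply Lp.ext
  filter_upwards [coeFn_imL (ofL u), coeFn_ofL u, Lp.coeFn_zero ℝ 2 _] with x h1 h2 h3
  rw [h1, h2, h3]; simp

theorem reL_smul (c : ℂ) (u : L2C) : reL (c • u) = c.re • reL u - c.im • imL u := by
  apply Lp.ext
  filter_upwards [coeFn_reL (c • u), coeFn_reL u, coeFn_imL u, Lp.coeFn_smul c u,
    Lp.coeFn_sub (c.re • reL u) (c.im • imL u), Lp.coeFn_smul c.re (reL u),
    Lp.coeFn_smul c.im (imL u)] with x h1 h2 h3 h4 h5 h6 h7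
  rw [h1, h4, h5, Pi.sub_apply, h6, h7]
  simp [h2, h3]

theorem imL_smul (c : ℂ) (u : L2C) : imL (c • u) = c.re • imL u + c.im • reL u := by
  apply Lp.ext
  filter_upwards [coeFn_imL (c • u), coeFn_reL u, coeFn_imL u, Lp.coeFn_smul c u,
    Lp.coeFn_add (c.re • imL u) (c.im • reL u), Lp.coeFn_smul c.re (imL u),
    Lp.coeFn_smul c.im (reL u)] with x h1 h2 h3 h4 h5 h6 h7
  rw [h1, h4, h5, Pi.add_apply, h6, h7]
  simp [h2, h3]

theorem L2C_ext {u v : L2C} (h1 : reL u = reL v) (h2 : imL u = imL v) : u = v := by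
  apply Lp.ext
  filter_upwards [coeFn_reL u, coeFn_reL v, coeFn_imL u, coeFn_imL v] with x a b c d
  apply Complex.ext
  · rw [← a, ← b, h1]
  · rw [← c, ← d, h2]

theorem norm_reL_le (u : L2C) : ‖reL u‖ ≤ ‖u‖ := by
  refine Lp.norm_le_norm_of_ae_le ?_
  filter_upwards [coeFn_reL u] with x h
  rw [h]; exact Complex.abs_re_le_norm _

theorem norm_ofL (u : L2) : ‖ofL u‖ = ‖u‖ := by
  apply le_antisymm <;> refine Lp.norm_le_norm_of_ae_le ?_ <;>
  · filter_upwards [coeFn_ofL u] with x h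
    rw [h]; simp

theorem reL_ofL_add (u v : L2) : reL (ofL u + Complex.I • ofL v) = u := by
  rw [map_add, reL_smul, reL_ofL, imL_ofL]; simp

theorem imL_ofL_add (u v : L2) : imL (ofL u + Complex.I • ofL v) = v := by
  rw [map_add, imL_smul, reL_ofL, imL_ofL]; simp

/-- Reduces symmetry, positivity and norm bounds of a complexified operator to those of the real
operator acting on real and imaginary parts. -/
theorem inner_L2C (u v : L2C) : inner ℂ u v =
    ((inner ℝ (reL u) (reL v) + inner ℝ (imL u) (imL v) : ℝ) : ℂ) +
      Complex.I * ((inner ℝ (reL u) (imL v) - inner ℝ (imL u) (reL v) : ℝ) : ℂ) := by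
  have hi : Integrable (fun x => inner ℂ (u x) (v x)) (volume.restrict (Ioo (-1 : ℝ) 1)) :=
    L2.integrable_inner u v
  have key : ∀ {a b : L2}, Integrable (fun x => a x * b x) (volume.restrict (Ioo (-1 : ℝ) 1)) :=
    fun {a b} => by simpa [mul_comm] using L2.integrable_inner (𝕜 := ℝ) a b
  have kin : ∀ (a b : L2), inner ℝ a b = ∫ x in Ioo (-1 : ℝ) 1, a x * b x := fun a b => by
    rw [L2.inner_def]; simp [mul_comm]
  apply Complex.ext
  · have : (inner ℂ u v).re = ∫ x in Ioo (-1 : ℝ) 1, (inner ℂ (u x) (v x)).re := by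
      rw [L2.inner_def]; exact (integral_re hi).symm
    rw [this, kin, kin, kin, kin, ← integral_add key key]
    simp only [Complex.add_re, Complex.ofReal_re, Complex.mul_re, Complex.I_re, zero_mul,
      Complex.I_im, Complex.ofReal_im, mul_zero, sub_zero, add_zero]
    refine integral_congr_ae ?_
    filter_upwards [coeFn_reL u, coeFn_reL v, coeFn_imL u, coeFn_imL v] with x a b c d
    rw [a, b, c, d]; simp; ring
  · have : (inner ℂ u v).im = ∫ x in Ioo (-1 : ℝ) 1, (inner ℂ (u x) (v x)).im := by
      rw [L2.inner_def]; exact (integral_im hi).symm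
    rw [this, kin, kin, kin, kin, ← integral_sub key key]
    simp only [Complex.add_im, Complex.ofReal_re, Complex.mul_im, Complex.I_re, zero_mul,
      Complex.I_im, Complex.ofReal_im, one_mul, zero_add]
    refine integral_congr_ae ?_
    filter_upwards [coeFn_reL u, coeFn_reL v, coeFn_imL u, coeFn_imL v] with x a b c d
    rw [a, b, c, d]; simp; ring

/-- The complexification of a bounded operator. -/
noncomputable def complexify (R : L2 →L[ℝ] L2) : L2C →L[ℂ] L2C where
  toFun u := ofL (R (reL u)) + Complex.I • ofL (R (imL u))
  map_add' u v := by simp only [map_add, smul_add]; abel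
  map_smul' c u := by
    apply L2C_ext
    · rw [RingHom.id_apply, reL_ofL_add, reL_smul, reL_smul c (_ + _), reL_ofL_add, imL_ofL_add,
        map_sub, map_smul, map_smul]
    · rw [RingHom.id_apply, imL_ofL_add, imL_smul, imL_smul c (_ + _), reL_ofL_add, imL_ofL_add,
        map_add, map_smul, map_smul]
  cont := by fun_prop

theorem complexify_apply (R : L2 →L[ℝ] L2) (u : L2C) :
    complexify R u = ofL (R (reL u)) + Complex.I • ofL (R (imL u)) := rfl

theorem reL_complexify (R : L2 →L[ℝ] L2) (u : L2C) : reL (complexify R u) = R (reL u) := by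
  rw [complexify_apply, reL_ofL_add]

theorem imL_complexify (R : L2 →L[ℝ] L2) (u : L2C) : imL (complexify R u) = R (imL u) := by
  rw [complexify_apply, imL_ofL_add]

theorem complexify_ofL (R : L2 →L[ℝ] L2) (u : L2) : complexify R (ofL u) = ofL (R u) := by
  rw [complexify_apply, reL_ofL, imL_ofL]; simp

theorem norm_sq_L2C (u : L2C) : ‖u‖ ^ 2 = ‖reL u‖ ^ 2 + ‖imL u‖ ^ 2 := by
  have h := inner_L2C u u
  rw [inner_self_eq_norm_sq_to_K, real_inner_self_eq_norm_sq, real_inner_self_eq_norm_sq] at h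
  have := congrArg Complex.re h
  simpa [← Complex.ofReal_pow] using this

theorem norm_complexify_le (R : L2 →L[ℝ] L2) : ‖complexify R‖ ≤ ‖R‖ := by
  refine ContinuousLinearMap.opNorm_le_bound _ (norm_nonneg _) fun u => ?_
  refine le_of_sq_le_sq ?_ (by positivity)
  rw [norm_sq_L2C, reL_complexify, imL_complexify, mul_pow, norm_sq_L2C]
  have h1 := pow_le_pow_left₀ (norm_nonneg _) (R.le_opNorm (reL u)) 2
  have h2 := pow_le_pow_left₀ (norm_nonneg _) (R.le_opNorm (imL u)) 2
  rw [mul_pow] at h1 h2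
  linarith

theorem complexify_isPositive {R : L2 →L[ℝ] L2} (hs : ∀ u v, inner ℝ (R u) v = inner ℝ u (R v))
    (hp : ∀ u, 0 ≤ inner ℝ (R u) u) : (complexify R).IsPositive := by
  rw [ContinuousLinearMap.isPositive_def]
  constructor
  · intro u v
    change inner ℂ (complexify R u) v = inner ℂ u (complexify R v)
    rw [inner_L2C, inner_L2C]
    simp only [reL_complexify, imL_complexify, hs]
  · intro u
    rw [ContinuousLinearMap.reApplyInnerSelf_apply, inner_L2C]
    simp only [reL_complexify, imL_complexify]
    have := hp (reL u)
    have := hp (imL u)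
    simp
    linarith

/-- The calculus is `u ↦ Re (φ(R_ℂ) u)`. The rules involving `R` survive because `R_ℂ` commutes with
taking real parts and with the embedding of real functions; the norm bound survives because that
embedding is isometric and `Re` is a contraction. -/
theorem exists_functionalCalculus {R : L2 →L[ℝ] L2} {Λ : ℝ}
    (hs : ∀ u v, inner ℝ (R u) v = inner ℝ u (R v)) (hp : ∀ u, 0 ≤ inner ℝ (R u) u)
    (hR : ‖R‖ ≤ Λ) : ∃ Φ, FunctionalCalculus R Λ Φ := by
  have hpos := complexify_isPositive hs hp
  refine ⟨fun φ => reL ∘L ((opFun (complexify R) φ).restrictScalars ℝ) ∘L ofL, ?_⟩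
  constructor
  · intro φ ψ hφ hψ
    ext1 u
    simp only [ContinuousLinearMap.comp_apply, ContinuousLinearMap.coe_restrictScalars',
      _root_.sub_apply, opFun_sub _ hφ hψ, map_sub]
  · intro c φ hφ
    ext1 u
    simp only [ContinuousLinearMap.comp_apply, ContinuousLinearMap.coe_restrictScalars',
      _root_.smul_apply, opFun_smul _ c hφ, reL_smul]
    simp
  · intro φ hφ
    ext1 u
    simp only [ContinuousLinearMap.comp_apply, ContinuousLinearMap.coe_restrictScalars',
      opFun_mul _ continuous_id' hφ, opFun_id hpos, reL_complexify]
  · intro φ hφ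
    ext1 u
    simp only [ContinuousLinearMap.comp_apply, ContinuousLinearMap.coe_restrictScalars',
      opFun_mul _ hφ continuous_id', opFun_id hpos, complexify_ofL]
  · ext1 u
    simp only [ContinuousLinearMap.comp_apply, ContinuousLinearMap.coe_restrictScalars',
      opFun_one hpos, ContinuousLinearMap.id_apply, reL_ofL]
  · intro φ C hC h
    refine ContinuousLinearMap.opNorm_le_bound _ hC fun u => ?_
    refine (norm_reL_le _).trans ?_
    refine (ContinuousLinearMap.le_of_opNorm_le _
      (norm_opFun_le hpos ((norm_complexify_le R).trans hR) hC h) _).trans ?_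
    exact (congrArg (C * ·) (norm_ofL u)).le

/-! ### The heat semigroup as a function of the resolvent -/

/-- The function `r ↦ r⁻ᵐ e^{-t (1/r - κ)}`, extended by `0` to `r ≤ 0`. -/
noncomputable def heatFun (κ : ℝ) (m : ℕ) (t r : ℝ) : ℝ :=
  if r ≤ 0 then 0 else (r⁻¹) ^ m * Real.exp (-(t * (r⁻¹ - κ)))

/-- The exponential `e^{-t/r}` beats every power of `1/r` at `0⁺`. After the scaling `r ↦ r/t` the
function is a monomial in the inverse of the variable times the standard flat function
`expNegInvGlue`. -/
theorem continuous_heatFun (κ : ℝ) (m : ℕ) {t : ℝ} (ht : 0 < t) :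
    Continuous (heatFun κ m t) := by
  have h := (expNegInvGlue.continuous_polynomial_eval_inv_mul
    (Polynomial.C (Real.exp (t * κ) * (t⁻¹) ^ m) * Polynomial.X ^ m)).comp
      (continuous_id.div_const t)
  refine h.congr fun r => ?_
  by_cases hr : r ≤ 0
  · have : r / t ≤ 0 := div_nonpos_of_nonpos_of_nonneg hr ht.le
    simp [heatFun, hr, expNegInvGlue, this]
  · have h2 : ¬ r / t ≤ 0 := not_le.2 (div_pos (not_le.1 hr) ht)
    have h3 : -(t * (r⁻¹ - κ)) = t * κ + -(r / t)⁻¹ := by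
      rw [inv_div]; ring
    simp only [heatFun, hr, if_false, expNegInvGlue, Function.comp, id, h2, h3, Real.exp_add]
    simp only [Polynomial.eval_mul, Polynomial.eval_C, Polynomial.eval_pow, Polynomial.eval_X]
    rw [inv_div, div_pow, inv_pow, inv_pow]
    have : r ≠ 0 := by rintro rfl; exact hr le_rfl
    field_simp

/-- Follows from `e^y ≥ y²/2` at `y = ts/2`. -/
theorem sq_mul_exp_neg_le {s t : ℝ} (hs : 0 ≤ s) (ht : 0 < t) :
    s ^ 2 * Real.exp (-(t * s / 2)) ≤ 8 / t ^ 2 := by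
  have h1 := Real.quadratic_le_exp_of_nonneg (x := t * s / 2) (by positivity)
  rw [Real.exp_neg, ← div_eq_mul_inv, div_le_div_iff₀ (Real.exp_pos _) (by positivity)]
  nlinarith [mul_nonneg ht.le hs]

theorem abs_exp_sub_one_sub_le (y : ℝ) : |Real.exp y - 1 - y| ≤ y ^ 2 * Real.exp |y| := by
  have h := Complex.norm_exp_sub_sum_le_norm_mul_exp (y : ℂ) 2
  simp only [Finset.sum_range_succ, Finset.sum_range_zero, pow_zero, Nat.factorial, Nat.cast_one,
    div_one, zero_add, pow_one, Nat.mul_one, Complex.norm_real, Real.norm_eq_abs, sq_abs] at h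
  have e : Complex.exp y - (1 + y) = ((Real.exp y - 1 - y : ℝ) : ℂ) := by push_cast; ring
  rwa [e, Complex.norm_real, Real.norm_eq_abs] at h

theorem abs_exp_sub_one_le (y : ℝ) : |Real.exp y - 1| ≤ |y| * Real.exp |y| := by
  have h := Complex.norm_exp_sub_sum_le_norm_mul_exp (y : ℂ) 1
  simp only [Finset.sum_range_succ, Finset.sum_range_zero, pow_zero, Nat.factorial, Nat.cast_one,
    div_one, zero_add, pow_one, Complex.norm_real, Real.norm_eq_abs] at h
  have e : Complex.exp y - 1 = ((Real.exp y - 1 : ℝ) : ℂ) := by push_cast; ring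
  rwa [e, Complex.norm_real, Real.norm_eq_abs] at h

/-- Second-order Taylor bound, uniform in the spectral variable `s`: the restriction on `h` leaves
half of the decay, `e^{-ts/2}`, to absorb the factor `s²`. -/
theorem exp_increment_le {s t h : ℝ} (hs : 0 ≤ s) (ht : 0 < t) (hh : |h| ≤ t / 2) :
    |Real.exp (-((t + h) * s)) - Real.exp (-(t * s)) + h * (s * Real.exp (-(t * s)))|
      ≤ h ^ 2 * (8 / t ^ 2) := by
  have e1 : Real.exp (-((t + h) * s)) = Real.exp (-(t * s)) * Real.exp (-(h * s)) := by
    rw [← Real.exp_add]; ring_nf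
  have e2 : Real.exp (-(t * s)) * Real.exp (-(h * s)) - Real.exp (-(t * s))
      + h * (s * Real.exp (-(t * s)))
      = Real.exp (-(t * s)) * (Real.exp (-(h * s)) - 1 - -(h * s)) := by ring
  rw [e1, e2, abs_mul, abs_of_pos (Real.exp_pos _)]
  calc _ ≤ Real.exp (-(t * s)) * ((-(h * s)) ^ 2 * Real.exp |-(h * s)|) := by
        gcongr; exact abs_exp_sub_one_sub_le _
    _ = h ^ 2 * (s ^ 2 * (Real.exp (-(t * s) + |h| * s))) := by
        rw [Real.exp_add, abs_neg, abs_mul, abs_of_nonneg hs]; ring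
    _ ≤ h ^ 2 * (s ^ 2 * Real.exp (-(t * s / 2))) := by
        gcongr; nlinarith
    _ ≤ _ := by gcongr; exact sq_mul_exp_neg_le hs ht

theorem mul_exp_increment_le {s t h : ℝ} (hs : 0 ≤ s) (ht : 0 < t) (hh : |h| ≤ t / 2) :
    |s * Real.exp (-((t + h) * s)) - s * Real.exp (-(t * s))| ≤ |h| * (8 / t ^ 2) := by
  have e1 : Real.exp (-((t + h) * s)) = Real.exp (-(t * s)) * Real.exp (-(h * s)) := by
    rw [← Real.exp_add]; ring_nf
  have e2 : s * (Real.exp (-(t * s)) * Real.exp (-(h * s))) - s * Real.exp (-(t * s))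
      = s * Real.exp (-(t * s)) * (Real.exp (-(h * s)) - 1) := by ring
  rw [e1, e2, abs_mul, abs_of_nonneg (by positivity)]
  calc _ ≤ s * Real.exp (-(t * s)) * (|-(h * s)| * Real.exp |-(h * s)|) := by
        gcongr; exact abs_exp_sub_one_le _
    _ = |h| * (s ^ 2 * (Real.exp (-(t * s) + |h| * s))) := by
        rw [Real.exp_add, abs_neg, abs_mul, abs_of_nonneg hs]; ring
    _ ≤ |h| * (s ^ 2 * Real.exp (-(t * s / 2))) := by
        gcongr; nlinarith
    _ ≤ _ := by gcongr; exact sq_mul_exp_neg_le hs ht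

theorem mul_heatFun_succ (κ : ℝ) (m : ℕ) (t r : ℝ) :
    r * heatFun κ (m + 1) t r = heatFun κ m t r := by
  unfold heatFun
  split_ifs with h
  · simp
  · have : r ≠ 0 := by rintro rfl; exact h le_rfl
    rw [pow_succ]; field_simp

theorem inv_sub_nonneg {κ r : ℝ} (h : 0 < r) (hr : r ≤ κ⁻¹) : 0 ≤ r⁻¹ - κ := by
  have := inv_anti₀ h hr
  rw [inv_inv] at this
  linarith

section Semigroup

variable {H : Type*} [NormedAddCommGroup H] [InnerProductSpace ℝ H] {R : H →L[ℝ] H} {κ : ℝ}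
  {Φ : (ℝ → ℝ) → H →L[ℝ] H}

theorem FunctionalCalculus.norm_heat_le (hΦ : FunctionalCalculus R κ⁻¹ Φ) {t : ℝ} (ht : 0 < t) :
    ‖Φ (heatFun κ 0 t)‖ ≤ 1 := by
  refine hΦ.norm_le _ 1 zero_le_one fun r h0 h1 => ?_
  unfold heatFun
  split_ifs with h
  · simp
  · have := inv_sub_nonneg (not_le.1 h) h1
    rw [pow_zero, one_mul, abs_of_pos (Real.exp_pos _), Real.exp_le_one_iff]
    nlinarith

/-- With `s = 1/r - κ ≥ 0`, one has `r(1 - e^{-ts}) ≤ t r s = t(1 - κr) ≤ t`. This is strong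
continuity at time `0` on the range of `R`, with a rate. -/
theorem FunctionalCalculus.norm_heat_sub_one_comp_le (hΦ : FunctionalCalculus R κ⁻¹ Φ)
    (hκ : 0 < κ) {t : ℝ} (ht : 0 < t) (u : H) :
    ‖Φ (heatFun κ 0 t) (R u) - R u‖ ≤ t * ‖u‖ := by
  have hc := continuous_heatFun κ 0 ht
  have e : Φ (heatFun κ 0 t) (R u) - R u = Φ (fun r => heatFun κ 0 t r * r - r) u := by
    rw [hΦ.map_sub (fun r => heatFun κ 0 t r * r) (fun r => r) (hc.mul continuous_id')
      continuous_id', hΦ.map_mul_id _ hc]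
    have h1 : Φ (fun r => r) = R := by
      have := hΦ.map_id_mul (fun _ => 1) continuous_const
      rw [hΦ.map_one] at this
      simpa using this
    rw [h1]; rfl
  rw [e]
  refine ContinuousLinearMap.le_of_opNorm_le _ (hΦ.norm_le _ t ht.le fun r h0 h1 => ?_) u
  unfold heatFun
  split_ifs with h
  · have : r = 0 := le_antisymm h h0
    simp [this, ht.le]
  · have hr := not_le.1 h
    have hs := inv_sub_nonneg hr h1
    have h2 : Real.exp (-(t * (r⁻¹ - κ))) ≤ 1 := by
      rw [Real.exp_le_one_iff]; nlinarith
    have h3 := Real.add_one_le_exp (-(t * (r⁻¹ - κ)))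
    have h4 : r * r⁻¹ = 1 := mul_inv_cancel₀ hr.ne'
    rw [pow_zero, one_mul, abs_le]
    constructor
    · have : r * (-(t * (r⁻¹ - κ)) + 1) ≤ r * Real.exp (-(t * (r⁻¹ - κ))) :=
        mul_le_mul_of_nonneg_left h3 hr.le
      have h5 : r * (-(t * (r⁻¹ - κ)) + 1) = -t + t * r * κ + r := by
        linear_combination (-t) * h4
      have := mul_nonneg (mul_nonneg ht.le hr.le) hκ.le
      linarith
    · nlinarith

/-- The derivative of the heat semigroup associated with the resolvent `R`. -/
noncomputable def heatDeriv (Φ : (ℝ → ℝ) → H →L[ℝ] H) (κ t : ℝ) : H →L[ℝ] H :=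
  Φ (fun r => heatFun κ 1 t r - κ * heatFun κ 0 t r)

theorem heatFun_eqs {r t : ℝ} (h : 0 < r) : heatFun κ 0 t r = Real.exp (-(t * (r⁻¹ - κ))) ∧
    heatFun κ 1 t r - κ * heatFun κ 0 t r = (r⁻¹ - κ) * Real.exp (-(t * (r⁻¹ - κ))) := by
  simp only [heatFun, not_le.2 h, if_false]
  constructor <;> ring

theorem heatFun_eqs_zero {r t : ℝ} (h : r ≤ 0) : heatFun κ 0 t r = 0 ∧
    heatFun κ 1 t r - κ * heatFun κ 0 t r = 0 := by
  simp [heatFun, h]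

theorem FunctionalCalculus.norm_heat_increment_le (hΦ : FunctionalCalculus R κ⁻¹ Φ)
    {t h : ℝ} (ht : 0 < t) (hh : |h| ≤ t / 2) :
    ‖Φ (heatFun κ 0 (t + h)) - Φ (heatFun κ 0 t) + h • heatDeriv Φ κ t‖ ≤ h ^ 2 * (8 / t ^ 2) := by
  have hth : 0 < t + h := by have := (abs_le.1 hh).1; linarith
  have c0 := continuous_heatFun κ 0 ht
  have c0' := continuous_heatFun κ 0 hth
  have ck : Continuous fun r => heatFun κ 1 t r - κ * heatFun κ 0 t r :=
    (continuous_heatFun κ 1 ht).sub (c0.const_mul κ)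
  have e : Φ (heatFun κ 0 (t + h)) - Φ (heatFun κ 0 t) + h • heatDeriv Φ κ t =
      Φ (fun r => (heatFun κ 0 (t + h) r - heatFun κ 0 t r) -
        (-h) * (heatFun κ 1 t r - κ * heatFun κ 0 t r)) := by
    rw [hΦ.map_sub (fun r => heatFun κ 0 (t + h) r - heatFun κ 0 t r)
      (fun r => (-h) * (heatFun κ 1 t r - κ * heatFun κ 0 t r)) (c0'.sub c0) (ck.const_mul (-h)), hΦ.map_sub _ _ c0' c0,
      hΦ.map_smul _ _ ck, heatDeriv, neg_smul, sub_neg_eq_add]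
  rw [e]
  refine hΦ.norm_le _ _ (by positivity) fun r h0 h1 => ?_
  rcases h0.eq_or_lt with h | hr
  · rw [(heatFun_eqs_zero h.ge).2, (heatFun_eqs_zero h.ge).1, (heatFun_eqs_zero h.ge).1]
    simp; positivity
  · rw [(heatFun_eqs hr).2, (heatFun_eqs hr).1, (heatFun_eqs hr).1, neg_mul, sub_neg_eq_add]
    exact exp_increment_le (inv_sub_nonneg hr h1) ht hh

theorem FunctionalCalculus.norm_heatDeriv_increment_le (hΦ : FunctionalCalculus R κ⁻¹ Φ)
    {t h : ℝ} (ht : 0 < t) (hh : |h| ≤ t / 2) :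
    ‖heatDeriv Φ κ (t + h) - heatDeriv Φ κ t‖ ≤ |h| * (8 / t ^ 2) := by
  have hth : 0 < t + h := by have := (abs_le.1 hh).1; linarith
  have ck : ∀ t, 0 < t → Continuous fun r => heatFun κ 1 t r - κ * heatFun κ 0 t r := fun t ht =>
    (continuous_heatFun κ 1 ht).sub ((continuous_heatFun κ 0 ht).const_mul κ)
  rw [heatDeriv, heatDeriv, ← hΦ.map_sub _ _ (ck _ hth) (ck _ ht)]
  refine hΦ.norm_le _ _ (by positivity) fun r h0 h1 => ?_
  rcases h0.eq_or_lt with h | hr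
  · rw [(heatFun_eqs_zero h.ge).2, (heatFun_eqs_zero h.ge).2]
    simp; positivity
  · rw [(heatFun_eqs hr).2, (heatFun_eqs hr).2]
    exact mul_exp_increment_le (inv_sub_nonneg hr h1) ht hh

theorem FunctionalCalculus.hasDerivAt_heat (hΦ : FunctionalCalculus R κ⁻¹ Φ) {t : ℝ}
    (ht : 0 < t) : HasDerivAt (fun t => Φ (heatFun κ 0 t)) (-heatDeriv Φ κ t) t := by
  rw [hasDerivAt_iff_isLittleO_nhds_zero]
  have h1 : (fun h : ℝ => h ^ 2) =o[nhds 0] fun h : ℝ => h := by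
    simpa using Asymptotics.isLittleO_pow_id (𝕜 := ℝ) one_lt_two
  refine Asymptotics.IsBigO.trans_isLittleO ?_ h1
  refine Asymptotics.IsBigO.of_bound (8 / t ^ 2) ?_
  have : ∀ᶠ h : ℝ in nhds 0, |h| ≤ t / 2 := by
    have := Metric.closedBall_mem_nhds (0 : ℝ) (half_pos ht)
    filter_upwards [this] with h hh
    simpa using hh
  filter_upwards [this] with h hh
  rw [smul_neg, sub_neg_eq_add, norm_pow, Real.norm_eq_abs, sq_abs, mul_comm]
  exact hΦ.norm_heat_increment_le ht hh

theorem FunctionalCalculus.continuousAt_heatDeriv (hΦ : FunctionalCalculus R κ⁻¹ Φ) {t : ℝ}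
    (ht : 0 < t) : ContinuousAt (heatDeriv Φ κ) t := by
  rw [Metric.continuousAt_iff]
  intro ε hε
  have hK : 0 < 8 / t ^ 2 := by positivity
  refine ⟨min (t / 2) (ε / (8 / t ^ 2)), by positivity, fun {x} hx => ?_⟩
  rw [Real.dist_eq] at hx
  have := hΦ.norm_heatDeriv_increment_le ht (hx.le.trans (min_le_left _ _))
  rw [add_sub_cancel] at this
  rw [dist_eq_norm]
  refine this.trans_lt ?_
  rw [← lt_div_iff₀ hK]
  exact hx.trans_le (min_le_right _ _)

/-- Heat flow of a nonnegative self-adjoint operator, given as a relation `A` with resolvent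
`R = (A + κ)⁻¹`. -/
theorem FunctionalCalculus.exists_heat_flow (hΦ : FunctionalCalculus R κ⁻¹ Φ) (hκ : 0 < κ)
    {A : H → H → Prop} (hA : ∀ h, A (R h) (h - κ • R h)) (hd : DenseRange R) (f₀ : H) :
    ∃ f g : ℝ → H, f 0 = f₀ ∧ ContinuousOn f (Ici 0) ∧ (∀ t, 0 < t → A (f t) (g t)) ∧
      (∀ t, 0 < t → HasDerivAt f (-g t) t) ∧ ContinuousOn g (Ioi 0) ∧
      ∀ t, 0 ≤ t → ‖f t‖ ≤ ‖f₀‖ := by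
  let f : ℝ → H := fun t => if t ≤ 0 then f₀ else Φ (heatFun κ 0 t) f₀
  have hf : ∀ t, 0 < t → f t = Φ (heatFun κ 0 t) f₀ := fun t ht => if_neg (not_le.2 ht)
  have hf0 : f 0 = f₀ := if_pos le_rfl
  have hderiv : ∀ t, 0 < t → HasDerivAt f (-(heatDeriv Φ κ t f₀)) t := by
    intro t ht
    have h1 := (hΦ.hasDerivAt_heat ht).clm_apply (hasDerivAt_const t f₀)
    simp only [map_zero, add_zero] at h1
    refine h1.congr_of_eventuallyEq ?_
    filter_upwards [Ioi_mem_nhds ht] with s hs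
    exact hf s hs
  have hle : ∀ t, 0 ≤ t → ‖f t‖ ≤ ‖f₀‖ := by
    intro t ht
    rcases ht.eq_or_lt with h | h
    · rw [← h, hf0]
    · rw [hf t h]
      simpa using ContinuousLinearMap.le_of_opNorm_le _ (hΦ.norm_heat_le h) f₀
  refine ⟨f, fun t => heatDeriv Φ κ t f₀, hf0, ?_, ?_, hderiv, ?_, hle⟩
  · intro t ht
    rcases (mem_Ici.1 ht).eq_or_lt with h | h
    · subst h
      rw [Metric.continuousWithinAt_iff]
      intro ε hε
      -- Strong continuity at `0` passes from the dense range of `R` to all data because the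
      -- semigroup is a contraction.
      obtain ⟨u, hu⟩ := hd.exists_dist_lt f₀ (ε := ε / 3) (by positivity)
      refine ⟨ε / 3 / (‖u‖ + 1), by positivity, fun {t} ht htd => ?_⟩
      rw [hf0]
      rcases (mem_Ici.1 ht).eq_or_lt with h | h
      · rw [← h, hf0, dist_self]; exact hε
      · rw [hf t h]
        rw [dist_zero_right, Real.norm_eq_abs, abs_of_pos h] at htd
        rw [dist_eq_norm] at hu ⊢
        have e : Φ (heatFun κ 0 t) f₀ - f₀ = Φ (heatFun κ 0 t) (f₀ - R u)
            + (Φ (heatFun κ 0 t) (R u) - R u) - (f₀ - R u) := by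
          rw [_root_.map_sub]; abel
        have h1 : ‖Φ (heatFun κ 0 t) (f₀ - R u)‖ ≤ ‖f₀ - R u‖ := by
          simpa using ContinuousLinearMap.le_of_opNorm_le _ (hΦ.norm_heat_le h) (f₀ - R u)
        have h2 := hΦ.norm_heat_sub_one_comp_le hκ h u
        have h3 : t * ‖u‖ < ε / 3 := by
          rw [lt_div_iff₀ (by positivity)] at htd
          nlinarith [norm_nonneg u]
        rw [e]
        refine (norm_sub_le _ _).trans_lt ?_
        have := norm_add_le (Φ (heatFun κ 0 t) (f₀ - R u)) (Φ (heatFun κ 0 t) (R u) - R u)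
        linarith
    · exact (hderiv t h).continuousAt.continuousWithinAt
  · intro t ht
    have c0 := continuous_heatFun κ 0 ht
    have c1 := continuous_heatFun κ 1 ht
    -- The identity `r · (r⁻¹ e^{-ts}) = e^{-ts}` exhibits `f t` as a value of the resolvent, hence
    -- as an element of the domain: this is the smoothing effect.
    have e1 : f t = R (Φ (heatFun κ 1 t) f₀) := by
      rw [hf t ht, ← ContinuousLinearMap.comp_apply, ← hΦ.map_id_mul _ c1]
      congr 2
      ext r
      rw [mul_heatFun_succ]
    have e2 : heatDeriv Φ κ t f₀ = Φ (heatFun κ 1 t) f₀ - κ • f t := by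
      rw [heatDeriv, hΦ.map_sub (heatFun κ 1 t) (fun r => κ * heatFun κ 0 t r) c1 (c0.const_mul κ), hΦ.map_smul _ _ c0, hf t ht]
      rfl
    show A (f t) (heatDeriv Φ κ t f₀)
    rw [e2, e1]
    exact hA _
  · intro t ht
    exact ((hΦ.continuousAt_heatDeriv ht).clm_apply continuousAt_const).continuousWithinAt

end Semigroup

/-! ### Symmetric relations, surjectivity and resolvents -/

section Resolvent

variable {H : Type*} [NormedAddCommGroup H] [InnerProductSpace ℝ H] [CompleteSpace H]

/-- A symmetric relation which is onto is the graph of the inverse of a bounded symmetric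
operator. -/
theorem exists_inverse_of_symmetric {B : H → H → Prop}
    (hs : ∀ f g k l, B f g → B k l → inner ℝ g k = inner ℝ f l) (hr : ∀ h, ∃ f, B f h) :
    ∃ G : H →L[ℝ] H, (∀ h, B (G h) h) ∧ (∀ h k, inner ℝ (G h) k = inner ℝ h (G k)) ∧
      ∀ f g, B f g → G g = f := by
  choose G hG using hr
  have hsym : ∀ h k, inner ℝ (G h) k = inner ℝ h (G k) := fun h k =>
    (hs _ _ _ _ (hG h) (hG k)).symm
  -- No linearity of the relation `B` is assumed. Testing against arbitrary vectors shows that a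
  -- choice of preimages is linear, and its boundedness is the Hellinger–Toeplitz theorem.
  let L : H →ₗ[ℝ] H :=
    { toFun := G
      map_add' := fun x y => ext_inner_right ℝ fun v => by
        simp only [inner_add_left, hsym]
      map_smul' := fun c x => ext_inner_right ℝ fun v => by
        simp only [inner_smul_left, hsym, RingHom.id_apply] }
  have hL : L.IsSymmetric := hsym
  refine ⟨⟨L, hL.continuous⟩, hG, hsym, fun f g hfg => ext_inner_right ℝ fun v => ?_⟩
  change inner ℝ (G g) v = _
  rw [hsym]
  exact hs _ _ _ _ hfg (hG v)

/-- The Lax–Milgram argument. -/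
theorem surjective_of_coercive {T : H →L[ℝ] H} {c : ℝ} (hc : 0 < c)
    (h : ∀ x, c * ‖x‖ ^ 2 ≤ inner ℝ (T x) x) : Function.Surjective T := by
  have hu : IsUnit T := T.isUnit_of_forall_le_norm_inner_map (c := ⟨c, hc.le⟩) hc fun x => by
    rw [mul_comm]
    exact (h x).trans (le_abs_self _)
  exact (ContinuousLinearMap.isUnit_iff_bijective.1 hu).2

/-- Perturbation: if `A + P` is onto, then so is `A + V + κ` for some `κ > 0`. -/
theorem exists_surjective_shift {A : H → H → Prop} {P V : H →L[ℝ] H}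
    (hs : ∀ f g k l, A f g → A k l → inner ℝ g k = inner ℝ f l)
    (hn : ∀ f g, A f g → 0 ≤ inner ℝ g f)
    (hP : ∀ u v, inner ℝ (P u) v = inner ℝ u (P v)) (hP0 : ∀ u, 0 ≤ inner ℝ (P u) u)
    (hV0 : ∀ u, 0 ≤ inner ℝ (V u) u) (hr : ∀ h, ∃ f, A f (h - P f)) :
    ∃ κ : ℝ, 0 < κ ∧ ∀ h, ∃ f, A f (h - κ • f - V f) := by
  obtain ⟨G, hG, -, -⟩ := exists_inverse_of_symmetric (B := fun f h => A f (h - P f))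
    (fun f g k l h1 h2 => by
      have := hs _ _ _ _ h1 h2
      rw [inner_sub_left, inner_sub_right, hP] at this
      linarith) hr
  have hG0 : ∀ h, 0 ≤ inner ℝ (G h) h := fun h => by
    have h1 := hn _ _ (hG h)
    have h2 := hP0 (G h)
    rw [inner_sub_left] at h1
    rw [real_inner_comm]
    linarith
  -- Chosen so that `W = V + κ - P` satisfies `⟨Wx, x⟩ ≥ ‖x‖²`; the goal becomes solving `(A + P)f +
  -- W f = h`.
  let κ : ℝ := 1 + ‖P‖
  have hκ : 0 < κ := by positivity
  let W : H →L[ℝ] H := V + κ • ContinuousLinearMap.id ℝ H - P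
  have hWx : ∀ x, W x = V x + κ • x - P x := fun x => rfl
  have hW : ∀ x, 1 * ‖x‖ ^ 2 ≤ inner ℝ (W x) x := by
    intro x
    rw [hWx, inner_sub_left, inner_add_left, inner_smul_left, real_inner_self_eq_norm_sq]
    have h1 := hV0 x
    have h2 : inner ℝ (P x) x ≤ ‖P‖ * ‖x‖ ^ 2 := by
      refine (real_inner_le_norm _ _).trans ?_
      rw [pow_two, ← mul_assoc]
      gcongr
      exact P.le_opNorm x
    simp only [conj_trivial]
    have h3 : κ * ‖x‖ ^ 2 = ‖x‖ ^ 2 + ‖P‖ * ‖x‖ ^ 2 := by ring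
    linarith
  have hu : IsUnit W := W.isUnit_of_forall_le_norm_inner_map (c := 1) one_pos fun x => by
    have := (hW x).trans (le_abs_self _)
    simpa using this
  obtain ⟨w, hw⟩ := hu
  let Z : H →L[ℝ] H := ((w⁻¹ : (H →L[ℝ] H)ˣ) : H →L[ℝ] H)
  have hWZ : ∀ y, W (Z y) = y := fun y => by
    have : (w : H →L[ℝ] H) * Z = 1 := w.mul_inv
    rw [hw] at this
    exact DFunLike.congr_fun this y
  let N : ℝ := ‖W‖ + 1
  have hN : 0 < N := by positivity
  -- With the unknown `y = W f`, `G = (A + P)⁻¹` and `Z = W⁻¹`, the equation reads `Z y = G(h - y)`,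
  -- that is `(Z + G) y = G h`, a problem for bounded operators. Coercivity comes from `⟨Zy, y⟩ =
  -- ⟨Zy, W Zy⟩ ≥ ‖Zy‖²` and `⟨Gy, y⟩ ≥ 0`.
  have hZ : ∀ y, (N ^ 2)⁻¹ * ‖y‖ ^ 2 ≤ inner ℝ ((Z + G) y) y := by
    intro y
    have h1 := hW (Z y)
    rw [hWZ, real_inner_comm, one_mul] at h1
    have h2 : ‖y‖ ≤ N * ‖Z y‖ := by
      have := W.le_opNorm (Z y)
      rw [hWZ] at this
      nlinarith [norm_nonneg (Z y)]
    have h3 : (N ^ 2)⁻¹ * ‖y‖ ^ 2 ≤ ‖Z y‖ ^ 2 := by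
      rw [inv_mul_le_iff₀ (by positivity), ← mul_pow]
      exact pow_le_pow_left₀ (norm_nonneg _) h2 2
    have : inner ℝ ((Z + G) y) y = inner ℝ (Z y) y + inner ℝ (G y) y := by
      rw [← inner_add_left]; rfl
    have := hG0 y
    linarith
  refine ⟨κ, hκ, fun h => ?_⟩
  obtain ⟨y, hy⟩ := surjective_of_coercive (by positivity) hZ (G h)
  have hf : G (h - y) = Z y := by
    rw [map_sub, ← hy, _root_.add_apply, add_sub_cancel_right]
  refine ⟨Z y, ?_⟩
  have h1 := hG (h - y)
  rw [hf] at h1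
  have e : h - y - P (Z y) = h - κ • Z y - V (Z y) := by
    have h2 := hWZ y
    rw [hWx] at h2
    nth_rw 1 [← h2]
    abel
  rwa [e] at h1

/-- The resolvent of a nonnegative symmetric relation `A` for which `A + κ` is onto. -/
theorem exists_resolvent {A : H → H → Prop} {κ : ℝ} (hκ : 0 < κ)
    (hs : ∀ f g k l, A f g → A k l → inner ℝ g k = inner ℝ f l)
    (hn : ∀ f g, A f g → 0 ≤ inner ℝ g f) (hr : ∀ h, ∃ f, A f (h - κ • f)) :
    ∃ R : H →L[ℝ] H, (∀ h, A (R h) (h - κ • R h)) ∧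
      (∀ h k, inner ℝ (R h) k = inner ℝ h (R k)) ∧ (∀ h, 0 ≤ inner ℝ (R h) h) ∧
      ‖R‖ ≤ κ⁻¹ ∧ ∀ f g, A f g → R (g + κ • f) = f := by
  obtain ⟨R, hR, hsym, hinv⟩ := exists_inverse_of_symmetric (B := fun f h => A f (h - κ • f))
    (fun f g k l h1 h2 => by
      have := hs _ _ _ _ h1 h2
      rw [inner_sub_left, inner_sub_right, inner_smul_left, inner_smul_right] at this
      simpa using this) hr
  have hc : ∀ h, κ * ‖R h‖ ^ 2 ≤ inner ℝ (R h) h := fun h => by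
    have := hn _ _ (hR h)
    rw [inner_sub_left, inner_smul_left, real_inner_self_eq_norm_sq, real_inner_comm] at this
    simpa using this
  refine ⟨R, hR, hsym, fun h => (by positivity : 0 ≤ κ * ‖R h‖ ^ 2).trans (hc h), ?_,
    fun f g hfg => hinv _ _ (by simpa using hfg)⟩
  refine R.opNorm_le_bound (by positivity) fun h => ?_
  rcases (norm_nonneg (R h)).eq_or_lt with h0 | h0
  · rw [← h0]; positivity
  · rw [← div_eq_inv_mul, le_div_iff₀ hκ]
    have h1 := (hc h).trans (real_inner_le_norm _ _)
    nlinarith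

/-- The orthogonal complement of the range of a symmetric operator is its kernel. -/
theorem denseRange_of_symmetric_injective {R : H →L[ℝ] H}
    (hs : ∀ h k, inner ℝ (R h) k = inner ℝ h (R k)) (hi : ∀ h, R h = 0 → h = 0) :
    DenseRange R := by
  have h1 : (LinearMap.range (R : H →ₗ[ℝ] H))ᗮ = ⊥ := by
    rw [Submodule.eq_bot_iff]
    intro x hx
    apply hi
    refine ext_inner_left ℝ fun v => ?_
    rw [← hs, inner_zero_right]
    exact (Submodule.mem_orthogonal _ _).1 hx _ ⟨v, rfl⟩
  rw [← Submodule.topologicalClosure_eq_top_iff] at h1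
  intro x
  have : x ∈ (LinearMap.range (R : H →ₗ[ℝ] H)).topologicalClosure := by rw [h1]; trivial
  rw [← SetLike.mem_coe, Submodule.topologicalClosure_coe] at this
  exact this

end Resolvent

/-! ### Calculus of absolutely continuous functions -/

/-- `F` is absolutely continuous on `[a, b]` with almost everywhere derivative `f`. -/
structure IsPrim (a b : ℝ) (F f : ℝ → ℝ) : Prop where
  int : IntervalIntegrable f volume a b
  eq : ∀ x ∈ Icc a b, F x = F a + ∫ t in a..x, f t

namespace IsPrim

variable {a b : ℝ} {F f G g : ℝ → ℝ}

theorem int_sub (h : IsPrim a b F f) {x y : ℝ} (hx : x ∈ Icc a b) (hy : y ∈ Icc a b) :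
    IntervalIntegrable f volume x y :=
  h.int.mono_set (uIcc_subset_uIcc (Icc_subset_uIcc hx) (Icc_subset_uIcc hy))

theorem integral_eq (h : IsPrim a b F f) {x y : ℝ} (hx : x ∈ Icc a b) (hy : y ∈ Icc a b) :
    ∫ t in x..y, f t = F y - F x := by
  have hab : a ≤ b := hx.1.trans hx.2
  have ha : a ∈ Icc a b := left_mem_Icc.2 hab
  rw [h.eq x hx, h.eq y hy,
    ← intervalIntegral.integral_add_adjacent_intervals (h.int_sub ha hx) (h.int_sub hx hy)]
  ring

theorem mono (h : IsPrim a b F f) {a' b' : ℝ} (ha : a ≤ a') (hab : a' ≤ b') (hb : b' ≤ b) :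
    IsPrim a' b' F f where
  int := h.int_sub ⟨ha, hab.trans hb⟩ ⟨ha.trans hab, hb⟩
  eq x hx := by
    rw [h.integral_eq ⟨ha, hab.trans hb⟩ ⟨ha.trans hx.1, hx.2.trans hb⟩]; ring

theorem congr (h : IsPrim a b F f) (hF : ∀ x ∈ Icc a b, G x = F x)
    (hf : ∀ᵐ x, x ∈ Ioc a b → f x = g x) (hab : a ≤ b) : IsPrim a b G g where
  int := by
    refine h.int.congr_ae ?_
    rw [uIoc_of_le hab]
    exact (ae_restrict_iff' measurableSet_Ioc).2 hf
  eq x hx := by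
    rw [hF x hx, hF a (left_mem_Icc.2 hab), h.eq x hx]
    congr 1
    refine intervalIntegral.integral_congr_ae ?_
    filter_upwards [hf] with t ht htm
    rw [uIoc_of_le hx.1] at htm
    exact ht ⟨htm.1, htm.2.trans hx.2⟩

theorem continuousOn (h : IsPrim a b F f) : ContinuousOn F (Icc a b) := by
  rcases le_or_gt a b with hab | hab
  · have h1 : ContinuousOn (fun x => F a + ∫ t in a..x, f t) (Icc a b) := by
      have h2 := intervalIntegral.continuousOn_primitive_interval (μ := volume) (f := f)
        (a := a) (b := b) ((intervalIntegrable_iff' (by finiteness)).1 h.int)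
      rw [uIcc_of_le hab] at h2
      exact continuousOn_const.add h2
    exact h1.congr h.eq
  · rw [Icc_eq_empty (not_le.2 hab)]; exact continuousOn_empty _

theorem of_hasDerivAt (hd : ∀ x ∈ Icc a b, HasDerivAt F (f x) x) (hc : ContinuousOn f (Icc a b))
    (hab : a ≤ b) : IsPrim a b F f where
  int := (by rwa [uIcc_of_le hab] : ContinuousOn f (uIcc a b)).intervalIntegrable
  eq x hx := by
    rw [intervalIntegral.integral_eq_sub_of_hasDerivAt (f := F)]
    · ring
    · intro t ht
      rw [uIcc_of_le hx.1] at ht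
      exact hd t ⟨ht.1, ht.2.trans hx.2⟩
    · refine ContinuousOn.intervalIntegrable (hc.mono ?_)
      rw [uIcc_of_le hx.1]
      exact Icc_subset_Icc_right hx.2

theorem add (h : IsPrim a b F f) (k : IsPrim a b G g) :
    IsPrim a b (fun x => F x + G x) (fun x => f x + g x) where
  int := h.int.add k.int
  eq x hx := by
    have ha : a ∈ Icc a b := left_mem_Icc.2 (hx.1.trans hx.2)
    rw [intervalIntegral.integral_add (h.int_sub ha hx) (k.int_sub ha hx), h.eq x hx, k.eq x hx]
    ring

theorem const_mul (c : ℝ) (h : IsPrim a b F f) :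
    IsPrim a b (fun x => c * F x) (fun x => c * f x) where
  int := h.int.const_mul c
  eq x hx := by rw [intervalIntegral.integral_const_mul, h.eq x hx]; ring

theorem neg (h : IsPrim a b F f) : IsPrim a b (fun x => -F x) (fun x => -f x) where
  int := h.int.neg
  eq x hx := by rw [intervalIntegral.integral_neg, h.eq x hx]; ring

theorem sub (h : IsPrim a b F f) (k : IsPrim a b G g) :
    IsPrim a b (fun x => F x - G x) (fun x => f x - g x) := by
  simpa only [sub_eq_add_neg] using h.add k.neg

/-- Phrased for the primitive rather than for `F`: `IsPrim` says nothing about `F` outside `[a, b]`,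
so two-sided derivatives at the endpoints make sense only for the primitive. -/
theorem absolutelyContinuousOnInterval (h : IsPrim a b F f) :
    AbsolutelyContinuousOnInterval (fun x => F a + ∫ t in a..x, f t) a b := by
  have h1 := h.int.absolutelyContinuousOnInterval_intervalIntegral left_mem_uIcc
  have h2 : AbsolutelyContinuousOnInterval (fun _ : ℝ => F a) a b :=
    (LipschitzWith.const (F a)).lipschitzOnWith.absolutelyContinuousOnInterval
  exact h2.fun_add h1

theorem ae_hasDerivAt (h : IsPrim a b F f) :
    ∀ᵐ x, x ∈ Icc a b → HasDerivAt (fun x => F a + ∫ t in a..x, f t) (f x) x := by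
  filter_upwards [h.int.ae_hasDerivAt_integral] with x hx hxm
  exact (hx (Icc_subset_uIcc hxm) a left_mem_uIcc).const_add _

/-- The product rule carries all later integrations by parts: identities are obtained by evaluating
`IsPrim.integral_eq` on a suitable product. -/
theorem mul (h : IsPrim a b F f) (k : IsPrim a b G g) (hab : a ≤ b) :
    IsPrim a b (fun x => F x * G x) (fun x => f x * G x + F x * g x) where
  int := by
    have hF := h.continuousOn
    have hG := k.continuousOn
    rw [← uIcc_of_le hab] at hF hG
    exact (h.int.mul_continuousOn hG).add (k.int.continuousOn_mul hF)
  eq x hx := by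
    have h' := h.mono le_rfl hx.1 hx.2
    have k' := k.mono le_rfl hx.1 hx.2
    have e := (h'.absolutelyContinuousOnInterval).integral_deriv_mul_eq_sub
      (k'.absolutelyContinuousOnInterval)
    rw [← h.eq x hx, ← k.eq x hx, intervalIntegral.integral_same,
      intervalIntegral.integral_same, add_zero, add_zero] at e
    rw [eq_comm, ← eq_sub_iff_add_eq', ← e]
    refine intervalIntegral.integral_congr_ae ?_
    filter_upwards [h'.ae_hasDerivAt, k'.ae_hasDerivAt] with t h1 h2 ht
    rw [uIoc_of_le hx.1] at ht
    have ht' := Ioc_subset_Icc_self ht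
    rw [(h1 ht').deriv, (h2 ht').deriv, ← h'.eq t ht', ← k'.eq t ht']

theorem comp_neg (h : IsPrim a b F f) (hab : a ≤ b) :
    IsPrim (-b) (-a) (fun x => F (-x)) (fun x => -f (-x)) where
  int := by
    have := (h.int.comp_sub_left 0)
    simp only [zero_sub] at this
    exact this.symm.neg
  eq x hx := by
    have hx' : -x ∈ Icc a b := ⟨by linarith [hx.2], by linarith [hx.1]⟩
    rw [intervalIntegral.integral_neg, intervalIntegral.integral_comp_neg f, neg_neg,
      h.integral_eq hx' (right_mem_Icc.2 hab)]
    ring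

end IsPrim

/-! ### Weak derivatives versus absolute continuity -/

/-- The open set `(-1, 0) ∪ (0, 1)`. -/
abbrev punctured : Set ℝ := Ioo (-1 : ℝ) 0 ∪ Ioo 0 1

theorem eq_zero_of_notMem_tsupport {φ : ℝ → ℝ} {x : ℝ} (h : x ∉ tsupport φ) : φ x = 0 := by
  by_contra h0
  exact h (subset_tsupport _ h0)

theorem deriv_eq_zero_of_notMem_tsupport {φ : ℝ → ℝ} {x : ℝ} (h : x ∉ tsupport φ) :
    deriv φ x = 0 := by
  by_contra h0
  exact h (support_deriv_subset h0)

theorem IsPrim.mul_test {a b : ℝ} {F f φ : ℝ → ℝ} (h : IsPrim a b F f) (hab : a ≤ b)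
    (hφ : ContDiff ℝ ∞ φ) (ha : φ a = 0) (hb : φ b = 0) :
    IntervalIntegrable (fun x => F x * deriv φ x) volume a b ∧
    IntervalIntegrable (fun x => f x * φ x) volume a b ∧
    ∫ x in a..b, F x * deriv φ x = -∫ x in a..b, f x * φ x := by
  have hd : Continuous (deriv φ) := hφ.continuous_deriv (by simp)
  have hφp : IsPrim a b φ (deriv φ) := IsPrim.of_hasDerivAt
    (fun x _ => (hφ.differentiable (by simp) x).hasDerivAt) hd.continuousOn hab
  have hF := h.continuousOn
  rw [← uIcc_of_le hab] at hF
  have i1 : IntervalIntegrable (fun x => F x * deriv φ x) volume a b :=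
    (hF.mul hd.continuousOn).intervalIntegrable
  have i2 : IntervalIntegrable (fun x => f x * φ x) volume a b :=
    h.int.mul_continuousOn hφ.continuous.continuousOn
  refine ⟨i1, i2, ?_⟩
  have e := (h.mul hφp hab).integral_eq (left_mem_Icc.2 hab) (right_mem_Icc.2 hab)
  rw [intervalIntegral.integral_add i2 i1, ha, hb] at e
  linarith

theorem IsPrim.hasWeakDerivOn {F f : ℝ → ℝ} (h : IsPrim (-1) 1 F f) :
    HasWeakDerivOn (Ioo (-1 : ℝ) 1) F f := by
  have h11 : (-1 : ℝ) ≤ 1 := by norm_num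
  have hF : IntegrableOn F (Ioo (-1 : ℝ) 1) :=
    (h.continuousOn.integrableOn_compact isCompact_Icc).mono_set Ioo_subset_Icc_self
  have hf : IntegrableOn f (Ioo (-1 : ℝ) 1) :=
    ((intervalIntegrable_iff_integrableOn_Ioo_of_le h11).1 h.int)
  refine ⟨hF.locallyIntegrableOn, hf.locallyIntegrableOn, fun φ hφ hc hs => ?_⟩
  have e := (h.mul_test h11 hφ (eq_zero_of_notMem_tsupport fun hx => (hs hx).1.false)
    (eq_zero_of_notMem_tsupport fun hx => (hs hx).2.false)).2.2
  rwa [intervalIntegral.integral_of_le h11, intervalIntegral.integral_of_le h11,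
    integral_Ioc_eq_integral_Ioo, integral_Ioc_eq_integral_Ioo] at e

theorem locallyIntegrableOn_punctured {F : ℝ → ℝ}
    (hp : ∀ ε, 0 < ε → ε < 1 → IntegrableOn F (Ioo ε 1))
    (hm : ∀ ε, 0 < ε → ε < 1 → IntegrableOn F (Ioo (-1) (-ε))) :
    LocallyIntegrableOn F punctured := by
  rintro x (hx | hx)
  · refine ⟨Ioo (-1) (-(-x / 2)), ?_, hm _ (by linarith [hx.2]) (by linarith [hx.1])⟩
    refine mem_nhdsWithin.2 ⟨Iio (x / 2), isOpen_Iio, ?_, ?_⟩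
    · simp only [mem_Iio]; linarith [hx.2]
    · rintro y ⟨hy, hy' | hy'⟩
      · exact ⟨hy'.1, by simp only [mem_Iio] at hy; linarith⟩
      · simp only [mem_Iio] at hy
        linarith [hx.2, hy'.1]
  · refine ⟨Ioo (x / 2) 1, ?_, hp _ (by linarith [hx.1]) (by linarith [hx.2])⟩
    refine mem_nhdsWithin.2 ⟨Ioi (x / 2), isOpen_Ioi, ?_, ?_⟩
    · simp only [mem_Ioi]; linarith [hx.1]
    · rintro y ⟨hy, hy' | hy'⟩
      · simp only [mem_Ioi] at hy
        linarith [hx.1, hy'.2]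
      · exact ⟨hy, hy'.2⟩

/-- A test function supported in the punctured interval vanishes near `0`, so only the pieces at
distance `ε` from `0` matter. No behaviour of `F` at the singularity is needed. -/
theorem hasWeakDerivOn_punctured {F f : ℝ → ℝ}
    (hp : ∀ ε, 0 < ε → ε < 1 → IsPrim ε 1 F f)
    (hm : ∀ ε, 0 < ε → ε < 1 → IsPrim (-1) (-ε) F f) : HasWeakDerivOn punctured F f := by
  refine ⟨locallyIntegrableOn_punctured (fun ε h0 h1 => ?_) (fun ε h0 h1 => ?_),
    locallyIntegrableOn_punctured (fun ε h0 h1 => ?_) (fun ε h0 h1 => ?_), fun φ hφ hc hs => ?_⟩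
  · exact ((hp ε h0 h1).continuousOn.integrableOn_compact isCompact_Icc).mono_set
      Ioo_subset_Icc_self
  · exact ((hm ε h0 h1).continuousOn.integrableOn_compact isCompact_Icc).mono_set
      Ioo_subset_Icc_self
  · exact (intervalIntegrable_iff_integrableOn_Ioo_of_le h1.le).1 (hp ε h0 h1).int
  · exact (intervalIntegrable_iff_integrableOn_Ioo_of_le (by linarith)).1 (hm ε h0 h1).int
  · have h0 : (0 : ℝ) ∈ (tsupport φ)ᶜ := fun h => by
      rcases hs h with h | h
      · exact h.2.false
      · exact h.1.false
    obtain ⟨δ, hδ, hball⟩ := Metric.isOpen_iff.1 (isClosed_tsupport φ).isOpen_compl 0 h0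
    let ε := min (δ / 2) (1 / 2)
    have hε : 0 < ε := by positivity
    have hε1 : ε < 1 := (min_le_right _ _).trans_lt (by norm_num)
    have hεδ : ε < δ := (min_le_left _ _).trans_lt (by linarith)
    have hz : ∀ x, |x| ≤ ε → x ∉ tsupport φ := fun x hx =>
      hball (by rw [mem_ball_zero_iff, Real.norm_eq_abs]; exact hx.trans_lt hεδ)
    have h1 := (hp ε hε hε1).mul_test hε1.le hφ
      (eq_zero_of_notMem_tsupport (hz _ (abs_of_pos hε).le))
      (eq_zero_of_notMem_tsupport fun hx => by
        rcases hs hx with h | h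
        · linarith [h.2]
        · exact h.2.false)
    have h2 := (hm ε hε hε1).mul_test (by linarith) hφ
      (eq_zero_of_notMem_tsupport fun hx => by
        rcases hs hx with h | h
        · exact h.1.false
        · linarith [h.1])
      (eq_zero_of_notMem_tsupport (hz _ (by rw [abs_neg, abs_of_pos hε])))
    have split : ∀ G : ℝ → ℝ, (∀ x, x ∉ tsupport φ → G x = 0) →
        IntervalIntegrable G volume ε 1 → IntervalIntegrable G volume (-1) (-ε) →
        ∫ x in punctured, G x = (∫ x in (-1)..(-ε), G x) + ∫ x in ε..1, G x := by
      intro G hG i1 i2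
      have hsub : Ioo (-1) (-ε) ∪ Ioo ε 1 ⊆ punctured :=
        union_subset_union (Ioo_subset_Ioo_right (by linarith)) (Ioo_subset_Ioo_left hε.le)
      rw [setIntegral_eq_of_subset_of_forall_sdiff_eq_zero
        (measurableSet_Ioo.union measurableSet_Ioo) hsub, setIntegral_union,
        intervalIntegral.integral_of_le (by linarith), intervalIntegral.integral_of_le hε1.le,
        integral_Ioc_eq_integral_Ioo, integral_Ioc_eq_integral_Ioo]
      · rw [Set.disjoint_left]
        rintro x hx hx'
        linarith [hx.2, hx'.1]
      · exact measurableSet_Ioo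
      · exact (intervalIntegrable_iff_integrableOn_Ioo_of_le (by linarith)).1 i2
      · exact (intervalIntegrable_iff_integrableOn_Ioo_of_le hε1.le).1 i1
      · rintro x ⟨hx, hx'⟩
        by_cases hxε : |x| ≤ ε
        · exact hG x (hz x hxε)
        · exfalso
          apply hx'
          rw [abs_le, not_and_or, not_le, not_le] at hxε
          rcases hx with hx | hx <;> rcases hxε with h | h
          · exact Or.inl ⟨hx.1, h⟩
          · linarith [hx.2]
          · linarith [hx.1]
          · exact Or.inr ⟨h, hx.2⟩
    rw [split _ (fun x hx => by rw [deriv_eq_zero_of_notMem_tsupport hx, mul_zero]) h1.1 h2.1,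
      split _ (fun x hx => by rw [eq_zero_of_notMem_tsupport hx, mul_zero]) h1.2.1 h2.2.1,
      h1.2.2, h2.2.2]
    ring

/-- The du Bois-Reymond lemma: `u` minus a primitive of `v` has zero weak derivative, hence is
constant almost everywhere, and by continuity on all of `[-1, 1]`. -/
theorem HasWeakDerivOn.isPrim {u v : ℝ → ℝ} (h : HasWeakDerivOn (Ioo (-1 : ℝ) 1) u v)
    (hu : ContinuousOn u (Icc (-1 : ℝ) 1)) (hv : IntegrableOn v (Ioo (-1 : ℝ) 1)) :
    IsPrim (-1) 1 u v := by
  have h11 : (-1 : ℝ) ≤ 1 := by norm_num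
  have hvi : IntervalIntegrable v volume (-1) 1 :=
    (intervalIntegrable_iff_integrableOn_Ioo_of_le h11).2 hv
  let U : ℝ → ℝ := fun x => ∫ t in (-1)..x, v t
  have hU : IsPrim (-1) 1 U v := ⟨hvi, fun x hx => by simp [U]⟩
  have hUw := hU.hasWeakDerivOn
  let d : ℝ → ℝ := fun x => u x - U x
  have hdc : ContinuousOn d (Icc (-1) 1) := hu.sub hU.continuousOn
  have hdi : IntegrableOn d (Ioo (-1 : ℝ) 1) :=
    (hdc.integrableOn_compact isCompact_Icc).mono_set Ioo_subset_Icc_self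
  have imul : ∀ w φ : ℝ → ℝ, ContinuousOn w (Icc (-1) 1) → Continuous φ →
      IntegrableOn (fun x => w x * φ x) (Ioo (-1 : ℝ) 1) := fun w φ hw hφ =>
    ((hw.mul hφ.continuousOn).integrableOn_compact isCompact_Icc).mono_set Ioo_subset_Icc_self
  have hd0 : ∀ φ : ℝ → ℝ, ContDiff ℝ ∞ φ → HasCompactSupport φ → tsupport φ ⊆ Ioo (-1) 1 →
      ∫ x in Ioo (-1 : ℝ) 1, d x * deriv φ x = 0 := by
    intro φ hφ hc hs
    have hdφ : Continuous (deriv φ) := hφ.continuous_deriv (by simp)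
    have e1 := h.2.2 φ hφ hc hs
    have e2 := hUw.2.2 φ hφ hc hs
    simp only [d, sub_mul]
    rw [integral_sub (imul _ _ hu hdφ) (imul _ _ hU.continuousOn hdφ), e1, e2, sub_self]
  let ρb : ContDiffBump (0 : ℝ) := ⟨1 / 4, 1 / 2, by norm_num, by norm_num⟩
  let ρ : ℝ → ℝ := ρb.normed volume
  have hρ : ContDiff ℝ ∞ ρ := ρb.contDiff_normed
  have hρ1 : ∫ x, ρ x = 1 := ρb.integral_normed
  have hρs : ∀ x, 1 / 2 ≤ |x| → ρ x = 0 := by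
    intro x hx
    have : x ∉ Function.support ρ := by
      rw [ρb.support_normed_eq, mem_ball_zero_iff, Real.norm_eq_abs, not_lt]
      exact hx
    simpa using this
  -- Subtracting `(∫ φ) ρ` makes the integral vanish, so the result is the derivative of a test
  -- function `ψ`, to which `hd0` applies.
  have hker : ∀ φ : ℝ → ℝ, ContDiff ℝ ∞ φ → HasCompactSupport φ → tsupport φ ⊆ Ioo (-1) 1 →
      ∫ x in Ioo (-1 : ℝ) 1, d x * (φ x - (∫ y, φ y) * ρ x) = 0 := by
    intro φ hφ hc hs
    -- The bound `1/2 ≤ r` puts the support of the bump `ρ` inside `[-r, r]` as well.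
    obtain ⟨r, hr1, hr2, hr⟩ : ∃ r : ℝ, 1 / 2 ≤ r ∧ r < 1 ∧ ∀ x, r < |x| → φ x = 0 := by
      rcases (tsupport φ).eq_empty_or_nonempty with he | hne
      · refine ⟨1 / 2, le_rfl, by norm_num, fun x _ => eq_zero_of_notMem_tsupport ?_⟩
        rw [he]; exact notMem_empty x
      · obtain ⟨m, hm, hmax⟩ := hc.isCompact.exists_isMaxOn hne continuous_abs.continuousOn
        refine ⟨max (1 / 2) |m|, le_max_left _ _, max_lt (by norm_num) (abs_lt.2 (hs hm)),
          fun x hx => eq_zero_of_notMem_tsupport fun hx' => ?_⟩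
        exact absurd (hmax hx') (not_le.2 ((le_max_right _ _).trans_lt hx))
    let θ : ℝ → ℝ := fun x => φ x - (∫ y, φ y) * ρ x
    have hθ : ContDiff ℝ ∞ θ := hφ.sub (contDiff_const.mul hρ)
    have hθ0 : ∀ x, r < |x| → θ x = 0 := fun x hx => by
      simp [θ, hr x hx, hρs x (hr1.trans hx.le)]
    have hθ1 : ∫ x in (-1)..1, θ x = 0 := by
      rw [intervalIntegral.integral_eq_integral_of_support_subset]
      · rw [integral_sub (hφ.continuous.integrable_of_hasCompactSupport hc)
          (ρb.integrable_normed.const_mul _), integral_const_mul, hρ1, mul_one, sub_self]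
      · intro x hx
        have : |x| ≤ r := by
          by_contra hlt
          exact hx (hθ0 x (not_le.1 hlt))
        rw [abs_le] at this
        exact ⟨by linarith, by linarith⟩
    let ψ : ℝ → ℝ := fun x => ∫ t in (-1)..x, θ t
    have hψd : ∀ x, HasDerivAt ψ (θ x) x := fun x =>
      intervalIntegral.integral_hasDerivAt_right (hθ.continuous.intervalIntegrable _ _)
        hθ.continuous.stronglyMeasurable.stronglyMeasurableAtFilter hθ.continuous.continuousAt
    have hψ : ContDiff ℝ ∞ ψ := by
      rw [contDiff_infty_iff_deriv]
      refine ⟨fun x => (hψd x).differentiableAt, ?_⟩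
      rwa [funext fun x => (hψd x).deriv]
    have hψ0 : ∀ x, r < |x| → ψ x = 0 := by
      intro x hx
      rcases lt_abs.1 hx with h | h
      · have h2 : ψ x = ψ 1 + ∫ t in (1 : ℝ)..x, θ t :=
          (intervalIntegral.integral_add_adjacent_intervals
            (hθ.continuous.intervalIntegrable _ _) (hθ.continuous.intervalIntegrable _ _)).symm
        rw [h2, show ψ 1 = 0 from hθ1, zero_add]
        refine intervalIntegral.integral_zero_ae (Filter.Eventually.of_forall fun t ht => hθ0 t ?_)
        exact (lt_min hr2 h).trans (ht.1.trans_le (le_abs_self t))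
      · refine intervalIntegral.integral_zero_ae (Filter.Eventually.of_forall fun t ht => hθ0 t ?_)
        have : t < -r := ht.2.trans_lt (max_lt (by linarith) (by linarith))
        exact lt_abs.2 (Or.inr (by linarith))
    have hts : tsupport ψ ⊆ Icc (-r) r := by
      refine closure_minimal (fun x hx => ?_) isClosed_Icc
      rw [mem_Icc, ← abs_le]
      by_contra hlt
      exact hx (hψ0 x (not_le.1 hlt))
    have := hd0 ψ hψ (isCompact_Icc.of_isClosed_subset (isClosed_tsupport ψ) hts)
      (hts.trans fun x hx => ⟨by linarith [hx.1], by linarith [hx.2]⟩)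
    rwa [funext fun x => (hψd x).deriv] at this
  let C : ℝ := ∫ x in Ioo (-1 : ℝ) 1, d x * ρ x
  have hloc : LocallyIntegrableOn (fun x => d x - C) (Ioo (-1 : ℝ) 1) :=
    (hdi.sub (integrableOn_const (by simp))).locallyIntegrableOn
  have hae := isOpen_Ioo.ae_eq_zero_of_integral_contDiff_smul_eq_zero hloc fun φ hφ hc hs => by
    have hk := hker φ hφ hc hs
    have hφi : ∫ y, φ y = ∫ y in Ioo (-1 : ℝ) 1, φ y :=
      (setIntegral_eq_integral_of_forall_compl_eq_zero fun x hx =>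
        eq_zero_of_notMem_tsupport fun h => hx (hs h)).symm
    have e1 : ∫ x, φ x • (d x - C) = ∫ x in Ioo (-1 : ℝ) 1, (d x * φ x - C * φ x) := by
      rw [← setIntegral_eq_integral_of_forall_compl_eq_zero (s := Ioo (-1 : ℝ) 1)]
      · exact integral_congr_ae (Filter.Eventually.of_forall fun x => by simp; ring)
      · intro x hx
        rw [eq_zero_of_notMem_tsupport fun h => hx (hs h), zero_smul]
    have e2 : ∫ x in Ioo (-1 : ℝ) 1, d x * (φ x - (∫ y, φ y) * ρ x) =
        (∫ x in Ioo (-1 : ℝ) 1, d x * φ x) - (∫ y, φ y) * C := by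
      rw [← integral_const_mul, ← integral_sub (imul _ _ hdc hφ.continuous)
        ((imul _ _ hdc hρ.continuous).const_mul _)]
      exact integral_congr_ae (Filter.Eventually.of_forall fun x => by simp only; ring)
    rw [e1, integral_sub (imul _ _ hdc hφ.continuous)
      ((imul _ _ continuousOn_const hφ.continuous)), integral_const_mul, ← hφi]
    linarith
  have hEq : EqOn d (fun _ => C) (Icc (-1) 1) := by
    refine Measure.eqOn_Icc_of_ae_eq volume (by norm_num) ?_ hdc continuousOn_const
    rw [restrict_Ioo_eq_restrict_Icc.symm]
    refine (ae_restrict_iff' measurableSet_Ioo).2 ?_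
    filter_upwards [hae] with x hx hxm
    linarith [hx hxm]
  have hUm : U (-1) = 0 := intervalIntegral.integral_same
  have hC : C = u (-1) := by
    have := hEq (left_mem_Icc.2 h11)
    simp only [d, hUm] at this
    linarith
  refine ⟨hvi, fun x hx => ?_⟩
  have := hEq hx
  simp only [d] at this
  change u x = u (-1) + U x
  linarith

/-! ### Zero-energy solutions and expansions at the singular point -/

open Filter Topology Asymptotics

/-- The singular function `c₁ x^(ν+1/2) + c₂ x^(-ν+1/2)`. -/
noncomputable def sing (ν c₁ c₂ x : ℝ) : ℝ := c₁ * x ^ (ν + 1 / 2) + c₂ * x ^ (-ν + 1 / 2)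

/-- The derivative of `sing`. -/
noncomputable def sing' (ν c₁ c₂ x : ℝ) : ℝ :=
  c₁ * ((ν + 1 / 2) * x ^ (ν - 1 / 2)) + c₂ * ((-ν + 1 / 2) * x ^ (-ν - 1 / 2))

theorem hasDerivAt_sing (ν c₁ c₂ : ℝ) {x : ℝ} (hx : 0 < x) :
    HasDerivAt (sing ν c₁ c₂) (sing' ν c₁ c₂ x) x := by
  have h1 := (Real.hasDerivAt_rpow_const (p := ν + 1 / 2) (Or.inl hx.ne')).const_mul c₁
  have h2 := (Real.hasDerivAt_rpow_const (p := -ν + 1 / 2) (Or.inl hx.ne')).const_mul c₂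
  have h := h1.add h2
  have e1 : ν + 1 / 2 - 1 = ν - 1 / 2 := by ring
  have e2 : -ν + 1 / 2 - 1 = -ν - 1 / 2 := by ring
  rw [e1, e2] at h
  exact h

theorem hasDerivAt_sing' (ν c₁ c₂ : ℝ) {x : ℝ} (hx : 0 < x) :
    HasDerivAt (sing' ν c₁ c₂) ((ν ^ 2 - 1 / 4) / x ^ 2 * sing ν c₁ c₂ x) x := by
  have h1 := ((Real.hasDerivAt_rpow_const (p := ν - 1 / 2) (Or.inl hx.ne')).const_mul
    (ν + 1 / 2)).const_mul c₁
  have h2 := ((Real.hasDerivAt_rpow_const (p := -ν - 1 / 2) (Or.inl hx.ne')).const_mul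
    (-ν + 1 / 2)).const_mul c₂
  have h := h1.add h2
  have e1 : x ^ (ν - 1 / 2 - 1) = x ^ (ν + 1 / 2) / x ^ 2 := by
    rw [← Real.rpow_natCast x 2, ← Real.rpow_sub hx]; norm_num; ring_nf
  have e2 : x ^ (-ν - 1 / 2 - 1) = x ^ (-ν + 1 / 2) / x ^ 2 := by
    rw [← Real.rpow_natCast x 2, ← Real.rpow_sub hx]; norm_num; ring_nf
  rw [e1, e2] at h
  have e3 : (ν ^ 2 - 1 / 4) / x ^ 2 * sing ν c₁ c₂ x =
      c₁ * ((ν + 1 / 2) * ((ν - 1 / 2) * (x ^ (ν + 1 / 2) / x ^ 2))) +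
        c₂ * ((-ν + 1 / 2) * ((-ν - 1 / 2) * (x ^ (-ν + 1 / 2) / x ^ 2))) := by
    unfold sing
    field_simp
    ring
  rw [e3]
  exact h

theorem continuousOn_sing (ν c₁ c₂ : ℝ) : ContinuousOn (sing ν c₁ c₂) (Ioi 0) := fun _ hx =>
  (hasDerivAt_sing ν c₁ c₂ hx).continuousAt.continuousWithinAt

theorem continuousOn_sing' (ν c₁ c₂ : ℝ) : ContinuousOn (sing' ν c₁ c₂) (Ioi 0) := fun _ hx =>
  (hasDerivAt_sing' ν c₁ c₂ hx).continuousAt.continuousWithinAt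

theorem continuousOn_div_sq (c : ℝ) : ContinuousOn (fun x : ℝ => c / x ^ 2) (Ioi 0) :=
  continuousOn_const.div (continuousOn_id.pow 2) fun _ hx => pow_ne_zero 2 (ne_of_gt hx)

theorem Icc_subset_Ioi_zero {ε b : ℝ} (hε : 0 < ε) : Icc ε b ⊆ Ioi 0 := fun _ hx =>
  hε.trans_le hx.1

theorem isPrim_sing (ν c₁ c₂ : ℝ) {ε : ℝ} (hε : 0 < ε) (hε1 : ε < 1) :
    IsPrim ε 1 (sing ν c₁ c₂) (sing' ν c₁ c₂) :=
  IsPrim.of_hasDerivAt (fun _ hx => hasDerivAt_sing ν c₁ c₂ (hε.trans_le hx.1))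
    ((continuousOn_sing' ν c₁ c₂).mono (Icc_subset_Ioi_zero hε)) hε1.le

theorem isPrim_sing' (ν c₁ c₂ : ℝ) {ε : ℝ} (hε : 0 < ε) (hε1 : ε < 1) :
    IsPrim ε 1 (sing' ν c₁ c₂) (fun x => (ν ^ 2 - 1 / 4) / x ^ 2 * sing ν c₁ c₂ x) :=
  IsPrim.of_hasDerivAt (fun _ hx => hasDerivAt_sing' ν c₁ c₂ (hε.trans_le hx.1))
    (((continuousOn_div_sq _).mul (continuousOn_sing ν c₁ c₂)).mono (Icc_subset_Ioi_zero hε))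
    hε1.le

theorem eventually_mem_Ioo : ∀ᶠ x : ℝ in 𝓝[>] 0, x ∈ Ioo (0 : ℝ) 1 :=
  Ioo_mem_nhdsGT one_pos

theorem rpow_isBigO {a b : ℝ} (h : b ≤ a) :
    (fun x : ℝ => x ^ a) =O[𝓝[>] 0] fun x => x ^ b := by
  refine IsBigO.of_bound 1 ?_
  filter_upwards [eventually_mem_Ioo] with x hx
  rw [one_mul, Real.norm_of_nonneg (Real.rpow_nonneg hx.1.le _),
    Real.norm_of_nonneg (Real.rpow_nonneg hx.1.le _)]
  exact Real.rpow_le_rpow_of_exponent_ge hx.1 hx.2.le h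

theorem rpow_mul_isBigO {u v : ℝ → ℝ} {a b c : ℝ} (hu : u =O[𝓝[>] 0] fun x => x ^ a)
    (hv : v =O[𝓝[>] 0] fun x => x ^ b) (h : c ≤ a + b) :
    (fun x => u x * v x) =O[𝓝[>] 0] fun x => x ^ c := by
  refine (hu.mul hv).trans ((rpow_isBigO h).congr' ?_ EventuallyEq.rfl)
  filter_upwards [eventually_mem_Ioo] with x hx
  exact Real.rpow_add hx.1 _ _

theorem rpow_tendsto_zero {a : ℝ} (ha : 0 < a) :
    Tendsto (fun x : ℝ => x ^ a) (𝓝[>] 0) (𝓝 0) := by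
  have := (Real.continuousAt_rpow_const 0 a (Or.inr ha.le)).tendsto
  rw [Real.zero_rpow ha.ne'] at this
  exact this.mono_left nhdsWithin_le_nhds

/-- The singular expansion `f ≈ c₁ x^(ν+1/2) + c₂ x^(-ν+1/2)` at `0`, together with the
corresponding expansion of `f'`. -/
structure HasExpansion (ν : ℝ) (f f' : ℝ → ℝ) (c₁ c₂ : ℝ) : Prop where
  isBigO : (fun x => f x - sing ν c₁ c₂ x) =O[𝓝[>] 0] fun x => x ^ (3 / 2 : ℝ)
  isBigO' : (fun x => f' x - sing' ν c₁ c₂ x) =O[𝓝[>] 0] fun x => x ^ (1 / 2 : ℝ)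

theorem sing_isBigO {ν : ℝ} (hν : 0 < ν) (c₁ c₂ : ℝ) :
    sing ν c₁ c₂ =O[𝓝[>] 0] fun x => x ^ (-ν + 1 / 2) :=
  ((rpow_isBigO (by linarith)).const_mul_left c₁).add ((isBigO_refl _ _).const_mul_left c₂)

theorem sing'_isBigO {ν : ℝ} (hν : 0 < ν) (c₁ c₂ : ℝ) :
    sing' ν c₁ c₂ =O[𝓝[>] 0] fun x => x ^ (-ν - 1 / 2) :=
  (((rpow_isBigO (by linarith)).const_mul_left _).const_mul_left c₁).add
    (((isBigO_refl _ _).const_mul_left _).const_mul_left c₂)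

/-- Both functions solve `y'' = (ν² - 1/4) y / x²`, so their Wronskian is constant. -/
theorem sing_wronskian (ν c₁ c₂ d₁ d₂ : ℝ) {x : ℝ} (hx : 0 < x) :
    sing ν c₁ c₂ x * sing' ν d₁ d₂ x - sing' ν c₁ c₂ x * sing ν d₁ d₂ x
      = -(2 * ν * (c₁ * d₂ - c₂ * d₁)) := by
  have h1 : x ^ (ν + 1 / 2) * x ^ (-ν - 1 / 2) = 1 := by
    rw [← Real.rpow_add hx]; ring_nf; exact Real.rpow_zero x
  have h2 : x ^ (-ν + 1 / 2) * x ^ (ν - 1 / 2) = 1 := by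
    rw [← Real.rpow_add hx]; ring_nf; exact Real.rpow_zero x
  unfold sing sing'
  linear_combination (c₁ * d₂ * (-ν + 1 / 2) - c₂ * d₁ * (-ν + 1 / 2)) * h1 +
    (c₂ * d₁ * (ν + 1 / 2) - c₁ * d₂ * (ν + 1 / 2)) * h2

namespace HasExpansion

variable {ν c₁ c₂ d₁ d₂ : ℝ} {f f' k k' : ℝ → ℝ}

theorem sing (ν c₁ c₂ : ℝ) : HasExpansion ν (sing ν c₁ c₂) (sing' ν c₁ c₂) c₁ c₂ where
  isBigO := by simpa using isBigO_zero _ _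
  isBigO' := by simpa using isBigO_zero _ _

theorem isBigO_self (h : HasExpansion ν f f' c₁ c₂) (hν : 0 < ν) :
    f =O[𝓝[>] 0] fun x => x ^ (-ν + 1 / 2) := by
  have := (h.isBigO.trans (rpow_isBigO (by linarith : -ν + 1 / 2 ≤ 3 / 2))).add
    (sing_isBigO hν c₁ c₂)
  simpa using this

theorem isBigO_deriv (h : HasExpansion ν f f' c₁ c₂) (hν : 0 < ν) :
    f' =O[𝓝[>] 0] fun x => x ^ (-ν - 1 / 2) := by
  have := (h.isBigO'.trans (rpow_isBigO (by linarith : -ν - 1 / 2 ≤ 1 / 2))).add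
    (sing'_isBigO hν c₁ c₂)
  simpa using this

/-- Each error term pairs a remainder with a function no larger than the most singular one, so it is
`O(x^{1-ν})`. This is where `ν < 1` makes the remainders negligible. -/
theorem tendsto_wronskian (h : HasExpansion ν f f' c₁ c₂) (l : HasExpansion ν k k' d₁ d₂)
    (hν : 0 < ν) (hν1 : ν < 1) :
    Tendsto (fun x => f x * k' x - f' x * k x) (𝓝[>] 0)
      (𝓝 (-(2 * ν * (c₁ * d₂ - c₂ * d₁)))) := by
  have e1 := rpow_mul_isBigO h.isBigO (l.isBigO_deriv hν) (by linarith : 1 - ν ≤ _)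
  have e2 := rpow_mul_isBigO h.isBigO' (l.isBigO_self hν) (by linarith : 1 - ν ≤ _)
  have e3 := rpow_mul_isBigO (sing_isBigO hν c₁ c₂) l.isBigO' (by linarith : 1 - ν ≤ _)
  have e4 := rpow_mul_isBigO (sing'_isBigO hν c₁ c₂) l.isBigO (by linarith : 1 - ν ≤ _)
  have e := (((e1.sub e2).add e3).sub e4).trans_tendsto (rpow_tendsto_zero (by linarith))
  have e' := e.add_const (-(2 * ν * (c₁ * d₂ - c₂ * d₁)))
  rw [zero_add] at e'
  refine e'.congr' ?_
  filter_upwards [eventually_mem_Ioo] with x hx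
  rw [← sing_wronskian ν c₁ c₂ d₁ d₂ hx.1]
  ring

theorem tendsto_div_rpow (h : HasExpansion ν f f' c₁ c₂) (hν : 0 < ν) :
    Tendsto (fun x => f x / x ^ (-ν + 1 / 2)) (𝓝[>] 0) (𝓝 c₂) := by
  have h0 := h.isBigO
  have e1 : (fun x => f x * x ^ (ν - 1 / 2) - (c₁ * x ^ (2 * ν) + c₂))
      =O[𝓝[>] 0] fun x => x ^ (1 + ν) := by
    refine (rpow_mul_isBigO (c := 1 + ν) h0 (isBigO_refl (fun x : ℝ => x ^ (ν - 1 / 2)) _)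
      (by linarith)).congr' ?_ EventuallyEq.rfl
    filter_upwards [eventually_mem_Ioo] with x hx
    have h2 : x ^ (-ν + 1 / 2) * x ^ (ν - 1 / 2) = 1 := by
      rw [← Real.rpow_add hx.1]; ring_nf; exact Real.rpow_zero x
    have h3 : x ^ (ν + 1 / 2) * x ^ (ν - 1 / 2) = x ^ (2 * ν) := by
      rw [← Real.rpow_add hx.1]; ring_nf
    unfold SingularHeat.sing
    linear_combination (-c₁) * h3 - c₂ * h2
  have e2 := e1.trans_tendsto (rpow_tendsto_zero (by linarith))
  have e3 := ((rpow_tendsto_zero (by linarith : 0 < 2 * ν)).const_mul c₁).add_const c₂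
  have e4 := e2.add e3
  rw [mul_zero, zero_add, zero_add] at e4
  refine e4.congr' ?_
  filter_upwards [eventually_mem_Ioo] with x hx
  rw [sub_add_cancel, show ν - 1 / 2 = -(-ν + 1 / 2) by ring, Real.rpow_neg hx.1.le]
  exact (div_eq_mul_inv _ _).symm

end HasExpansion

/-! ### The half interval: Green's formula and the lower bound -/

/-- `f` solves `-f'' + (ν² - 1/4) / x² f = g` on `(0, 1)` with `f 1 = 0` and singular
coefficients `c₁`, `c₂` at `0`. -/
structure HalfSol (ν : ℝ) (f f' g : ℝ → ℝ) (c₁ c₂ : ℝ) : Prop where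
  prim : ∀ ε, 0 < ε → ε < 1 → IsPrim ε 1 f f'
  prim' : ∀ ε, 0 < ε → ε < 1 → IsPrim ε 1 f' (fun x => (ν ^ 2 - 1 / 4) / x ^ 2 * f x - g x)
  one : f 1 = 0
  expansion : HasExpansion ν f f' c₁ c₂
  memLp : MemLp f 2 (volume.restrict (Ioo (0 : ℝ) 1))
  memLp_rhs : MemLp g 2 (volume.restrict (Ioo (0 : ℝ) 1))
  memLp_regular : MemLp (fun x => (ν ^ 2 - 1 / 4) / x ^ 2 * (f x - sing ν c₁ c₂ x)) 2
    (volume.restrict (Ioo (0 : ℝ) 1))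

theorem tendsto_integral_left {h : ℝ → ℝ} (hi : IntegrableOn h (Ioo (0 : ℝ) 1)) :
    Tendsto (fun ε => ∫ x in ε..1, h x) (𝓝[>] 0) (𝓝 (∫ x in Ioo (0 : ℝ) 1, h x)) := by
  have hi' : IntegrableOn h (uIcc 1 0) := by
    rw [uIcc_of_ge zero_le_one]; exact (integrableOn_Icc_iff_integrableOn_Ioo (by simp) (by simp)).2 hi
  have h1 := intervalIntegral.continuousOn_primitive_interval_left (μ := volume) (f := h)
    (a := 0) (b := 1) (by rwa [uIcc_comm])
  have h2 := h1 0 left_mem_uIcc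
  rw [uIcc_of_le zero_le_one] at h2
  have h3 := h2.tendsto
  rw [intervalIntegral.integral_of_le zero_le_one, integral_Ioc_eq_integral_Ioo] at h3
  exact h3.mono_left (nhdsWithin_le_of_mem (mem_of_superset (Ioo_mem_nhdsGT one_pos)
    Ioo_subset_Icc_self))

namespace HalfSol

variable {ν c₁ c₂ d₁ d₂ : ℝ} {f f' g k k' l : ℝ → ℝ}

/-- Green's formula on `(ε, 1)` as `ε → 0`: the boundary term at `1` vanishes by the Dirichlet
condition, and the one at `ε` is a Wronskian. -/
theorem integral_symm (hf : HalfSol ν f f' g c₁ c₂) (hk : HalfSol ν k k' l d₁ d₂)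
    (hν : 0 < ν) (hν1 : ν < 1) :
    (∫ x in Ioo (0 : ℝ) 1, g x * k x) - ∫ x in Ioo (0 : ℝ) 1, l x * f x
      = 2 * ν * (c₁ * d₂ - c₂ * d₁) := by
  have i1 : IntegrableOn (fun x => g x * k x) (Ioo (0 : ℝ) 1) := hf.memLp_rhs.integrable_mul hk.memLp
  have i2 : IntegrableOn (fun x => l x * f x) (Ioo (0 : ℝ) 1) := hk.memLp_rhs.integrable_mul hf.memLp
  rw [← integral_sub i1 i2]
  refine tendsto_nhds_unique (tendsto_integral_left (i1.sub i2)) ?_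
  have hw := (hf.expansion.tendsto_wronskian hk.expansion hν hν1).neg
  rw [neg_neg] at hw
  refine hw.congr' ?_
  filter_upwards [eventually_mem_Ioo] with ε hε
  have hp := ((hf.prim ε hε.1 hε.2).mul (hk.prim' ε hε.1 hε.2) hε.2.le).sub
    ((hf.prim' ε hε.1 hε.2).mul (hk.prim ε hε.1 hε.2) hε.2.le)
  have e := hp.integral_eq (left_mem_Icc.2 hε.2.le) (right_mem_Icc.2 hε.2.le)
  rw [hf.one, hk.one] at e
  rw [← zero_sub, ← sub_self (0 : ℝ)]
  have e' : ∫ x in ε..1, (g x * k x - l x * f x) =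
      0 * k' 1 - f' 1 * 0 - (f ε * k' ε - f' ε * k ε) := by
    rw [← e]
    refine intervalIntegral.integral_congr fun x _ => ?_
    ring
  refine Eq.trans ?_ e'.symm
  ring

/-- For a positive zero-energy solution `φ`, the function `m = φ'/φ` satisfies the Riccati equation
`m' = c_ν/x² - m²`. Hence `(m f² - f'f)' = g f - (f' - m f)² ≤ g f`, and the boundary term at `ε` is
`(f/φ)(φf' - φ'f)`, which has a limit. -/
theorem le_integral_aux (hf : HalfSol ν f f' g c₁ c₂) (hν : 0 < ν) (hν1 : ν < 1) {β : ℝ}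
    (hβ : β < 1) :
    c₂ * (2 * ν * (c₁ + β * c₂)) ≤ ∫ x in Ioo (0 : ℝ) 1, g x * f x := by
  have i1 : IntegrableOn (fun x => g x * f x) (Ioo (0 : ℝ) 1) := hf.memLp_rhs.integrable_mul hf.memLp
  -- Here `φ = x^{-ν+1/2} - β x^{ν+1/2}`; the condition `β < 1` keeps it positive up to and
  -- including `x = 1`.
  let φ := sing ν (-β) 1
  let φ' := sing' ν (-β) 1
  have hpow : ∀ x : ℝ, 0 < x → x ≤ 1 → x ^ (ν + 1 / 2) ≤ x ^ (-ν + 1 / 2) := fun x h0 h1 =>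
    Real.rpow_le_rpow_of_exponent_ge h0 h1 (by linarith)
  have hφ : ∀ x : ℝ, 0 < x → x ≤ 1 → 0 < φ x := fun x h0 h1 => by
    have h2 := hpow x h0 h1
    have h3 : 0 < x ^ (ν + 1 / 2) := Real.rpow_pos_of_pos h0 _
    simp only [φ, sing]
    nlinarith
  have hlim : Tendsto (fun x => f x / φ x) (𝓝[>] 0) (𝓝 c₂) := by
    have h1 := hf.expansion.tendsto_div_rpow hν
    have h2 := (HasExpansion.sing ν (-β) 1).tendsto_div_rpow hν
    have h3 := h1.div h2 one_ne_zero
    rw [div_one] at h3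
    refine h3.congr' ?_
    filter_upwards [eventually_mem_Ioo] with x hx
    have : x ^ (-ν + 1 / 2) ≠ 0 := (Real.rpow_pos_of_pos hx.1 _).ne'
    simp only [Pi.div_apply]
    rw [div_div_div_cancel_right₀ this]
  have hw := (HasExpansion.sing ν (-β) 1).tendsto_wronskian hf.expansion hν hν1
  have hlw := hlim.mul hw
  have elim : c₂ * -(2 * ν * (-β * c₂ - 1 * c₁)) = c₂ * (2 * ν * (c₁ + β * c₂)) := by ring
  rw [elim] at hlw
  refine le_of_tendsto_of_tendsto hlw (tendsto_integral_left i1) ?_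
  filter_upwards [eventually_mem_Ioo] with ε hε
  obtain ⟨h0, h1⟩ := hε
  let m : ℝ → ℝ := fun x => φ' x / φ x
  have hmem : ∀ x ∈ Icc ε 1, 0 < x ∧ 0 < φ x := fun x hx =>
    ⟨h0.trans_le hx.1, hφ x (h0.trans_le hx.1) hx.2⟩
  have hcφ : ContinuousOn φ (Icc ε 1) := (continuousOn_sing _ _ _).mono (Icc_subset_Ioi_zero h0)
  have hcφ' : ContinuousOn φ' (Icc ε 1) :=
    (continuousOn_sing' _ _ _).mono (Icc_subset_Ioi_zero h0)
  have hcm : ContinuousOn m (Icc ε 1) := hcφ'.div hcφ fun x hx => (hmem x hx).2.ne'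
  have hm : IsPrim ε 1 m (fun x => (ν ^ 2 - 1 / 4) / x ^ 2 - m x ^ 2) := by
    refine IsPrim.of_hasDerivAt (fun x hx => ?_)
      (((continuousOn_div_sq _).mono (Icc_subset_Ioi_zero h0)).sub (hcm.pow 2)) h1.le
    have hd := (hasDerivAt_sing' ν (-β) 1 (hmem x hx).1).div
      (hasDerivAt_sing ν (-β) 1 (hmem x hx).1) (hmem x hx).2.ne'
    have hne : φ x ≠ 0 := (hmem x hx).2.ne'
    have e : (ν ^ 2 - 1 / 4) / x ^ 2 - m x ^ 2 =
        ((ν ^ 2 - 1 / 4) / x ^ 2 * φ x * φ x - φ' x * φ' x) / φ x ^ 2 := by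
      simp only [m]; field_simp
    rw [e]
    exact hd
  have hp := hf.prim ε h0 h1
  have hM := (hm.mul (hp.mul hp h1.le) h1.le).sub ((hf.prim' ε h0 h1).mul hp h1.le)
  have e := hM.integral_eq (left_mem_Icc.2 h1.le) (right_mem_Icc.2 h1.le)
  rw [hf.one] at e
  have hne : φ ε ≠ 0 := (hφ ε h0 h1.le).ne'
  have e2 : f ε / φ ε * (φ ε * f' ε - φ' ε * f ε) = m 1 * (0 * 0) - f' 1 * 0 -
      (m ε * (f ε * f ε) - f' ε * f ε) := by
    simp only [m]; field_simp; ring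
  rw [e2, ← e]
  refine intervalIntegral.integral_mono_on h1.le hM.int ?_ fun x hx => ?_
  · exact (intervalIntegrable_iff_integrableOn_Ioo_of_le h1.le).2
      (i1.mono_set (Ioo_subset_Ioo_left h0.le))
  · nlinarith [sq_nonneg (f' x - m x * f x)]

/-- The sharp comparison function, with `β = 1`, vanishes at `x = 1` and cannot be divided by, so
the bound is reached as `β → 1⁻`. -/
theorem le_integral (hf : HalfSol ν f f' g c₁ c₂) (hν : 0 < ν) (hν1 : ν < 1) :
    2 * ν * c₂ * (c₁ + c₂) ≤ ∫ x in Ioo (0 : ℝ) 1, g x * f x := by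
  have h1 : Tendsto (fun β : ℝ => c₂ * (2 * ν * (c₁ + β * c₂))) (𝓝[<] 1)
      (𝓝 (c₂ * (2 * ν * (c₁ + 1 * c₂)))) :=
    (Continuous.tendsto (by fun_prop) 1).mono_left nhdsWithin_le_nhds
  have h2 : c₂ * (2 * ν * (c₁ + 1 * c₂)) ≤ ∫ x in Ioo (0 : ℝ) 1, g x * f x := by
    refine le_of_tendsto h1 ?_
    filter_upwards [Ioo_mem_nhdsLT (zero_lt_one' ℝ)] with β hβ
    exact hf.le_integral_aux hν hν1 hβ.2
  linarith

end HalfSol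

/-! ### Weighted moments, Hardy's inequality, variation of constants -/

theorem memLp_rpow {s : ℝ} (hs : -(1 / 2) < s) :
    MemLp (fun x : ℝ => x ^ s) 2 (volume.restrict (Ioo (0 : ℝ) 1)) := by
  have hc : ContinuousOn (fun x : ℝ => x ^ s) (Ioo 0 1) := fun x hx =>
    (Real.continuousAt_rpow_const x s (Or.inl hx.1.ne')).continuousWithinAt
  rw [memLp_two_iff_integrable_sq (hc.aestronglyMeasurable measurableSet_Ioo)]
  have h1 : IntegrableOn (fun x : ℝ => x ^ (2 * s)) (Ioo 0 1) :=
    (intervalIntegrable_iff_integrableOn_Ioo_of_le zero_le_one).1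
      (intervalIntegral.intervalIntegrable_rpow' (by linarith))
  refine h1.congr_fun (fun x hx => ?_) measurableSet_Ioo
  rw [← Real.rpow_natCast, ← Real.rpow_mul hx.1.le]
  push_cast
  rw [mul_comm]

theorem integrableOn_rpow_mul {s : ℝ} (hs : -(1 / 2) < s) {h : ℝ → ℝ}
    (hh : MemLp h 2 (volume.restrict (Ioo (0 : ℝ) 1))) :
    IntegrableOn (fun x => x ^ s * h x) (Ioo 0 1) := (memLp_rpow hs).integrable_mul hh

theorem isPrim_moment {s : ℝ} (hs : -(1 / 2) < s) {h : ℝ → ℝ}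
    (hh : MemLp h 2 (volume.restrict (Ioo (0 : ℝ) 1))) :
    IsPrim 0 1 (fun x => ∫ y in (0 : ℝ)..x, y ^ s * h y) (fun x => x ^ s * h x) where
  int := (intervalIntegrable_iff_integrableOn_Ioo_of_le zero_le_one).2 (integrableOn_rpow_mul hs hh)
  eq x hx := by simp

/-- A Cauchy–Schwarz bound based on `∫₀ˣ y^{2s} dy = x^{2s+1}/(2s+1)`, obtained from a weighted
Young inequality. -/
theorem abs_moment_le {s : ℝ} (hs : -(1 / 2) < s) {h : ℝ → ℝ}
    (hh : MemLp h 2 (volume.restrict (Ioo (0 : ℝ) 1))) :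
    ∃ C, 0 ≤ C ∧ ∀ x, 0 < x → x ≤ 1 →
      |∫ y in (0 : ℝ)..x, y ^ s * h y| ≤ C * x ^ (s + 1 / 2) := by
  let N : ℝ := ∫ x in Ioo (0 : ℝ) 1, h x ^ 2
  have hN : 0 ≤ N := integral_nonneg fun x => sq_nonneg _
  have hsq : IntegrableOn (fun x => h x ^ 2) (Ioo (0 : ℝ) 1) := hh.integrable_sq
  have h2s : 0 < 2 * s + 1 := by linarith
  refine ⟨(2 * s + 1)⁻¹ / 2 + N / 2, by positivity, fun x hx hx1 => ?_⟩
  have hsq' : IntervalIntegrable (fun y => h y ^ 2) volume 0 x :=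
    (intervalIntegrable_iff_integrableOn_Ioo_of_le hx.le).2
      (hsq.mono_set (Ioo_subset_Ioo_right hx1))
  have hr : IntervalIntegrable (fun y : ℝ => y ^ (2 * s)) volume 0 x :=
    intervalIntegral.intervalIntegrable_rpow' (by linarith)
  have hi := (isPrim_moment hs hh).int_sub (left_mem_Icc.2 zero_le_one) ⟨hx.le, hx1⟩
  -- This Young weight makes both terms scale like `x^{s+1/2}`.
  let t : ℝ := x ^ (-(s + 1 / 2))
  have ht : 0 < t := Real.rpow_pos_of_pos hx _
  have htinv : t⁻¹ = x ^ (s + 1 / 2) := by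
    simp only [t]; rw [Real.rpow_neg hx.le, inv_inv]
  have hNx : ∫ y in (0 : ℝ)..x, h y ^ 2 ≤ N := by
    rw [intervalIntegral.integral_of_le hx.le, integral_Ioc_eq_integral_Ioo]
    exact setIntegral_mono_set hsq (Eventually.of_forall fun y => sq_nonneg _)
      (LE.le.eventuallyLE (Ioo_subset_Ioo_right hx1))
  have hrx : ∫ y in (0 : ℝ)..x, y ^ (2 * s) = x ^ (2 * s + 1) / (2 * s + 1) := by
    rw [integral_rpow (Or.inl (by linarith)), Real.zero_rpow h2s.ne', sub_zero]
  calc |∫ y in (0 : ℝ)..x, y ^ s * h y| ≤ ∫ y in (0 : ℝ)..x, |y ^ s * h y| :=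
        intervalIntegral.abs_integral_le_integral_abs hx.le
    _ ≤ ∫ y in (0 : ℝ)..x, (t / 2 * y ^ (2 * s) + t⁻¹ / 2 * h y ^ 2) := by
        refine intervalIntegral.integral_mono_on hx.le hi.abs
          ((hr.const_mul _).add (hsq'.const_mul _)) fun y hy => ?_
        rcases hy.1.eq_or_lt with h0 | h0
        · subst h0
          by_cases hs0 : s = 0
          · subst hs0
            have h3 : t * t⁻¹ = 1 := mul_inv_cancel₀ ht.ne'
            have h4 := inv_pos.2 ht
            simp only [mul_zero, Real.rpow_zero]
            rw [one_mul, abs_le]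
            constructor <;> nlinarith [sq_nonneg (t + h 0), sq_nonneg (t - h 0)]
          · rw [Real.zero_rpow hs0]
            have h4 := inv_pos.2 ht
            have : (0 : ℝ) ≤ 0 ^ (2 * s) := Real.rpow_nonneg le_rfl _
            rw [zero_mul, abs_zero]
            positivity
        · have e : y ^ (2 * s) = y ^ s * y ^ s := by
            rw [← Real.rpow_add h0]; ring_nf
          have h3 : t * t⁻¹ = 1 := mul_inv_cancel₀ ht.ne'
          have h4 := inv_pos.2 ht
          have key : ∀ a b : ℝ, a * b ≤ t / 2 * (a * a) + t⁻¹ / 2 * b ^ 2 := by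
            intro a b
            have : 0 ≤ t⁻¹ / 2 * (t * a - b) ^ 2 := by positivity
            have e2 : t⁻¹ / 2 * (t * a - b) ^ 2 =
                (t * t⁻¹) * (t / 2 * (a * a)) - (t * t⁻¹) * (a * b) + t⁻¹ / 2 * b ^ 2 := by ring
            rw [e2, h3] at this
            linarith
          rw [e, abs_le]
          have k1 := key (y ^ s) (h y)
          have k2 := key (y ^ s) (-h y)
          constructor
          · rw [neg_sq] at k2; linarith
          · exact k1
    _ = t / 2 * (x ^ (2 * s + 1) / (2 * s + 1)) + t⁻¹ / 2 * ∫ y in (0 : ℝ)..x, h y ^ 2 := by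
        rw [intervalIntegral.integral_add (hr.const_mul _) (hsq'.const_mul _),
          intervalIntegral.integral_const_mul, intervalIntegral.integral_const_mul, hrx]
    _ ≤ t / 2 * (x ^ (2 * s + 1) / (2 * s + 1)) + t⁻¹ / 2 * N := by gcongr
    _ = _ := by
        have e : t * x ^ (2 * s + 1) = x ^ (s + 1 / 2) := by
          simp only [t]; rw [← Real.rpow_add hx]; ring_nf
        rw [← htinv] at e ⊢
        rw [show t / 2 * (x ^ (2 * s + 1) / (2 * s + 1)) =
          (t * x ^ (2 * s + 1)) * (2 * s + 1)⁻¹ / 2 by ring, e]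
        ring

/-- Hardy's inequality for weighted averages. -/
theorem memLp_hardy {s : ℝ} (hs : -(1 / 2) < s) {h : ℝ → ℝ}
    (hh : MemLp h 2 (volume.restrict (Ioo (0 : ℝ) 1))) :
    MemLp (fun x => x ^ (-s - 1) * ∫ y in (0 : ℝ)..x, y ^ s * h y) 2
      (volume.restrict (Ioo (0 : ℝ) 1)) := by
  let M : ℝ → ℝ := fun x => ∫ y in (0 : ℝ)..x, y ^ s * h y
  let K : ℝ → ℝ := fun x => x ^ (-s - 1) * M x
  have hM := isPrim_moment hs hh
  have hcr : ∀ a : ℝ, ContinuousOn (fun x : ℝ => x ^ a) (Ioi 0) := fun a x hx =>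
    (Real.continuousAt_rpow_const x a (Or.inl (ne_of_gt hx))).continuousWithinAt
  have hK : ContinuousOn K (Ioc 0 1) := ((hcr _).mono Ioc_subset_Ioi_self).mul
    (hM.continuousOn.mono Ioc_subset_Icc_self)
  obtain ⟨C, hC0, hC⟩ := abs_moment_le hs hh
  have hsq : IntegrableOn (fun x => h x ^ 2) (Ioo (0 : ℝ) 1) := hh.integrable_sq
  let N : ℝ := ∫ x in Ioo (0 : ℝ) 1, h x ^ 2
  let a : ℝ := (2 * s + 1) / 2
  have ha : 0 < a := by simp only [a]; linarith
  rw [memLp_two_iff_integrable_sq ((hK.mono Ioo_subset_Ioc_self).aestronglyMeasurable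
    measurableSet_Ioo)]
  have hbound : ∀ ε, 0 < ε → ε < 1 → ∫ x in ε..1, K x ^ 2 ≤ (a⁻¹ * N + C ^ 2) / a := by
    intro ε h0 h1
    have hMε := hM.mono h0.le h1.le le_rfl
    have hp : IsPrim ε 1 (fun x : ℝ => x ^ (-2 * s - 1))
        (fun x => (-2 * s - 1) * x ^ (-2 * s - 2)) := by
      refine IsPrim.of_hasDerivAt (fun x hx => ?_)
        (((hcr _).mono (Icc_subset_Ioi_zero h0)).const_mul _) h1.le
      have := Real.hasDerivAt_rpow_const (x := x) (p := -2 * s - 1)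
        (Or.inl (h0.trans_le hx.1).ne')
      rwa [show -2 * s - 1 - 1 = -2 * s - 2 by ring] at this
    -- The derivative of `x^{-2s-1} M²` is `-2aK² + 2Kh ≤ -aK² + a⁻¹h²`. Its boundary value at `ε`
    -- is at most `C²` by the moment bound, which bounds `∫ K²` uniformly in `ε`.
    have hQ := hp.mul (hMε.mul hMε h1.le) h1.le
    have e := hQ.integral_eq (left_mem_Icc.2 h1.le) (right_mem_Icc.2 h1.le)
    have hKi : IntervalIntegrable (fun x => K x ^ 2) volume ε 1 := by
      refine ContinuousOn.intervalIntegrable ?_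
      rw [uIcc_of_le h1.le]
      exact (hK.mono fun x hx => ⟨h0.trans_le hx.1, hx.2⟩).pow 2
    have hhi : IntervalIntegrable (fun x => h x ^ 2) volume ε 1 :=
      (intervalIntegrable_iff_integrableOn_Ioo_of_le h1.le).2
        (hsq.mono_set (Ioo_subset_Ioo_left h0.le))
    have hle : -(C ^ 2) ≤ ∫ x in ε..1, (a⁻¹ * h x ^ 2 - a * K x ^ 2) := by
      have h2 : -(C ^ 2) ≤ 1 ^ (-2 * s - 1) * (M 1 * M 1) - ε ^ (-2 * s - 1) * (M ε * M ε) := by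
        have h3 := hC ε h0 h1.le
        have h4 : (M ε) ^ 2 ≤ (C * ε ^ (s + 1 / 2)) ^ 2 := sq_le_sq' (abs_le.1 h3).1 (abs_le.1 h3).2
        have h5 : ε ^ (-2 * s - 1) * (ε ^ (s + 1 / 2) * ε ^ (s + 1 / 2)) = 1 := by
          rw [← Real.rpow_add h0, ← Real.rpow_add h0]; ring_nf; exact Real.rpow_zero ε
        have h6 : 0 < ε ^ (-2 * s - 1) := Real.rpow_pos_of_pos h0 _
        have h7 := mul_le_mul_of_nonneg_left h4 h6.le
        have h8 : ε ^ (-2 * s - 1) * (C * ε ^ (s + 1 / 2)) ^ 2 = C ^ 2 := by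
          linear_combination C ^ 2 * h5
        rw [Real.one_rpow]
        nlinarith [mul_self_nonneg (M 1)]
      refine h2.trans (e.symm.le.trans ?_)
      refine intervalIntegral.integral_mono_on h1.le hQ.int
        ((hhi.const_mul _).sub (hKi.const_mul _)) fun x hx => ?_
      have hx0 := h0.trans_le hx.1
      have e1 : x ^ (-2 * s - 2) = x ^ (-s - 1) * x ^ (-s - 1) := by
        rw [← Real.rpow_add hx0]; ring_nf
      have e2 : x ^ (-2 * s - 1) * x ^ s = x ^ (-s - 1) := by
        rw [← Real.rpow_add hx0]; ring_nf
      have e3 : (-2 * s - 1) * x ^ (-2 * s - 2) * (M x * M x) +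
          x ^ (-2 * s - 1) * (x ^ s * h x * M x + M x * (x ^ s * h x)) =
          -(2 * a) * K x ^ 2 + 2 * (K x * h x) := by
        simp only [K, a]
        linear_combination (-2 * s - 1) * (M x * M x) * e1 + 2 * (h x * M x) * e2
      refine e3.le.trans ?_
      have h9 : 0 ≤ a⁻¹ * (a * K x - h x) ^ 2 := by positivity
      have h10 : a * a⁻¹ = 1 := mul_inv_cancel₀ ha.ne'
      have h11 : a⁻¹ * (a * K x - h x) ^ 2 =
        (a * a⁻¹) * (a * K x ^ 2) - (a * a⁻¹) * (2 * (K x * h x)) + a⁻¹ * h x ^ 2 := by ring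
      rw [h11, h10] at h9
      linarith
    rw [intervalIntegral.integral_sub (hhi.const_mul _) (hKi.const_mul _),
      intervalIntegral.integral_const_mul, intervalIntegral.integral_const_mul] at hle
    have hNx : ∫ y in ε..1, h y ^ 2 ≤ N := by
      rw [intervalIntegral.integral_of_le h1.le, integral_Ioc_eq_integral_Ioo]
      exact setIntegral_mono_set hsq (Eventually.of_forall fun y => sq_nonneg _)
        (LE.le.eventuallyLE (Ioo_subset_Ioo_left h0.le))
    rw [le_div_iff₀ ha]
    have := mul_le_mul_of_nonneg_left hNx (inv_pos.2 ha).le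
    linarith
  have hlim : Tendsto (fun n : ℕ => ((n : ℝ) + 2)⁻¹) atTop (𝓝 0) :=
    tendsto_inv_atTop_zero.comp (tendsto_atTop_add_const_right _ _ tendsto_natCast_atTop_atTop)
  have hε : ∀ n : ℕ, 0 < ((n : ℝ) + 2)⁻¹ ∧ ((n : ℝ) + 2)⁻¹ < 1 := fun n =>
    ⟨by positivity, inv_lt_one_of_one_lt₀ (by have : (0 : ℝ) ≤ n := n.cast_nonneg; linarith)⟩
  have hInt : IntegrableOn (fun x => K x ^ 2) (Ioc 0 1) := by
    refine integrableOn_Ioc_of_intervalIntegral_norm_bounded_left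
      (a := fun n : ℕ => ((n : ℝ) + 2)⁻¹) (I := (a⁻¹ * N + C ^ 2) / a) (l := atTop)
      (fun n => ?_) hlim (Eventually.of_forall fun n => ?_)
    · exact (((hK.mono fun x hx => ⟨(hε n).1.trans_le hx.1, hx.2⟩).pow 2).integrableOn_compact
        isCompact_Icc).mono_set Ioc_subset_Icc_self
    · have := hbound _ (hε n).1 (hε n).2
      rw [intervalIntegral.integral_of_le (hε n).2.le] at this
      simpa using this
  exact hInt.mono_set Ioo_subset_Ioc_self

theorem isBigO_moment {s : ℝ} (hs : -(1 / 2) < s) {h : ℝ → ℝ}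
    (hh : MemLp h 2 (volume.restrict (Ioo (0 : ℝ) 1))) :
    (fun x => ∫ y in (0 : ℝ)..x, y ^ s * h y) =O[𝓝[>] 0] fun x => x ^ (s + 1 / 2) := by
  obtain ⟨C, hC0, hC⟩ := abs_moment_le hs hh
  refine IsBigO.of_bound C ?_
  filter_upwards [eventually_mem_Ioo] with x hx
  rw [Real.norm_of_nonneg (Real.rpow_nonneg hx.1.le _)]
  exact hC x hx.1 hx.2.le

theorem isPrim_rpow (a : ℝ) {ε : ℝ} (h0 : 0 < ε) (h1 : ε < 1) :
    IsPrim ε 1 (fun x : ℝ => x ^ a) (fun x => a * x ^ (a - 1)) := by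
  refine IsPrim.of_hasDerivAt (fun x hx =>
    Real.hasDerivAt_rpow_const (Or.inl (h0.trans_le hx.1).ne')) (fun x hx => ?_) h1.le
  exact ((Real.continuousAt_rpow_const x _
    (Or.inl (h0.trans_le hx.1).ne')).const_mul a).continuousWithinAt

theorem memLp_sing {ν : ℝ} (hν : 0 < ν) (hν1 : ν < 1) (c₁ c₂ : ℝ) :
    MemLp (sing ν c₁ c₂) 2 (volume.restrict (Ioo (0 : ℝ) 1)) :=
  ((memLp_rpow (by linarith)).const_mul c₁).add ((memLp_rpow (by linarith)).const_mul c₂)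

/-- Variation of constants: solutions with prescribed right-hand side. -/
theorem exists_halfSol {ν : ℝ} (hν : 0 < ν) (hν1 : ν < 1) {h : ℝ → ℝ}
    (hh : MemLp h 2 (volume.restrict (Ioo (0 : ℝ) 1))) {c₁ c₂ : ℝ}
    (hc : 2 * ν * (c₁ + c₂) =
      -∫ x in Ioo (0 : ℝ) 1, (x ^ (ν + 1 / 2) - x ^ (-ν + 1 / 2)) * h x) :
    ∃ f f', HalfSol ν f f' h c₁ c₂ := by
  have hp : -(1 / 2) < ν + 1 / 2 := by linarith
  have hq : -(1 / 2) < -ν + 1 / 2 := by linarith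
  have h2ν : 2 * ν ≠ 0 := by positivity
  let I : ℝ → ℝ := fun x => ∫ y in (0 : ℝ)..x, y ^ (ν + 1 / 2) * h y
  let J : ℝ → ℝ := fun x => ∫ y in (0 : ℝ)..x, y ^ (-ν + 1 / 2) * h y
  -- The particular solution with both moments taken from `0`: it is `O(x^{3/2})`, so it contributes
  -- nothing to the singular coefficients.
  let u : ℝ → ℝ := fun x =>
    (2 * ν)⁻¹ * (x ^ (-ν + 1 / 2) * I x - x ^ (ν + 1 / 2) * J x)
  let u' : ℝ → ℝ := fun x => (2 * ν)⁻¹ * ((-ν + 1 / 2) * x ^ (-ν + 1 / 2 - 1) * I x -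
    (ν + 1 / 2) * x ^ (ν + 1 / 2 - 1) * J x)
  have hI : ∀ ε, 0 < ε → ε < 1 → IsPrim ε 1 I (fun x => x ^ (ν + 1 / 2) * h x) :=
    fun ε h0 h1 => (isPrim_moment hp hh).mono h0.le h1.le le_rfl
  have hJ : ∀ ε, 0 < ε → ε < 1 → IsPrim ε 1 J (fun x => x ^ (-ν + 1 / 2) * h x) :=
    fun ε h0 h1 => (isPrim_moment hq hh).mono h0.le h1.le le_rfl
  have hu : ∀ ε, 0 < ε → ε < 1 → IsPrim ε 1 u u' := fun ε h0 h1 => by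
    refine ((((isPrim_rpow (-ν + 1 / 2) h0 h1).mul (hI ε h0 h1) h1.le).sub
      ((isPrim_rpow (ν + 1 / 2) h0 h1).mul (hJ ε h0 h1) h1.le)).const_mul (2 * ν)⁻¹).congr
      (fun x _ => rfl) (Eventually.of_forall fun x _ => ?_) h1.le
    simp only [u']
    ring
  have hu' : ∀ ε, 0 < ε → ε < 1 →
      IsPrim ε 1 u' (fun x => (ν ^ 2 - 1 / 4) / x ^ 2 * u x - h x) := fun ε h0 h1 => by
    refine (((((isPrim_rpow (-ν + 1 / 2 - 1) h0 h1).const_mul (-ν + 1 / 2)).mul (hI ε h0 h1)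
      h1.le).sub ((((isPrim_rpow (ν + 1 / 2 - 1) h0 h1).const_mul (ν + 1 / 2)).mul
      (hJ ε h0 h1) h1.le))).const_mul (2 * ν)⁻¹).congr
      (fun x _ => rfl) (Eventually.of_forall fun x hx => ?_) h1.le
    have hx0 : 0 < x := h0.trans hx.1
    have e1 : ∀ a : ℝ, x ^ (a - 1 - 1) = x ^ a / x ^ 2 := fun a => by
      rw [← Real.rpow_natCast x 2, ← Real.rpow_sub hx0]; norm_num; ring_nf
    have e2 : x ^ (-ν + 1 / 2 - 1) * x ^ (ν + 1 / 2) = 1 := by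
      rw [← Real.rpow_add hx0]; ring_nf; exact Real.rpow_zero x
    have e3 : x ^ (ν + 1 / 2 - 1) * x ^ (-ν + 1 / 2) = 1 := by
      rw [← Real.rpow_add hx0]; ring_nf; exact Real.rpow_zero x
    have e4 : (2 * ν)⁻¹ * (2 * ν) = 1 := inv_mul_cancel₀ h2ν
    simp only [u, e1]
    linear_combination ((2 * ν)⁻¹ * (-ν + 1 / 2) * h x) * e2 -
      ((2 * ν)⁻¹ * (ν + 1 / 2) * h x) * e3 - h x * e4
  have oI := isBigO_moment hp hh
  have oJ := isBigO_moment hq hh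
  have oU : u =O[𝓝[>] 0] fun x => x ^ (3 / 2 : ℝ) :=
    ((rpow_mul_isBigO (isBigO_refl (fun x : ℝ => x ^ (-ν + 1 / 2)) _) oI (by linarith)).sub
      (rpow_mul_isBigO (isBigO_refl (fun x : ℝ => x ^ (ν + 1 / 2)) _) oJ
        (by linarith))).const_mul_left _
  have oU' : u' =O[𝓝[>] 0] fun x => x ^ (1 / 2 : ℝ) :=
    ((rpow_mul_isBigO ((isBigO_refl (fun x : ℝ => x ^ (-ν + 1 / 2 - 1)) _).const_mul_left
      (-ν + 1 / 2)) oI (by linarith)).sub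
      (rpow_mul_isBigO ((isBigO_refl (fun x : ℝ => x ^ (ν + 1 / 2 - 1)) _).const_mul_left
        (ν + 1 / 2)) oJ (by linarith))).const_mul_left _
  have hreg : MemLp (fun x => (ν ^ 2 - 1 / 4) / x ^ 2 * u x) 2
      (volume.restrict (Ioo (0 : ℝ) 1)) := by
    -- Dividing `u` by `x²` turns its two terms into Hardy averages with exponents `ν + 1/2` and `-ν
    -- + 1/2`; the second is admissible because `ν < 1`.
    refine (((((memLp_hardy hp hh).sub (memLp_hardy hq hh)).const_mul
      ((ν ^ 2 - 1 / 4) * (2 * ν)⁻¹)))).ae_eq ?_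
    refine (ae_restrict_iff' measurableSet_Ioo).2 (Eventually.of_forall fun x hx => ?_)
    have e1 : x ^ (-(ν + 1 / 2) - 1) = x ^ (-ν + 1 / 2) / x ^ 2 := by
      rw [← Real.rpow_natCast x 2, ← Real.rpow_sub hx.1]; norm_num; ring_nf
    have e2 : x ^ (-(-ν + 1 / 2) - 1) = x ^ (ν + 1 / 2) / x ^ 2 := by
      rw [← Real.rpow_natCast x 2, ← Real.rpow_sub hx.1]; norm_num; ring_nf
    simp only [u, Pi.sub_apply, e1, e2, I, J]
    ring
  have huL : MemLp u 2 (volume.restrict (Ioo (0 : ℝ) 1)) := by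
    have hIc := (isPrim_moment hp hh).continuousOn
    have hJc := (isPrim_moment hq hh).continuousOn
    obtain ⟨A, hA⟩ := isCompact_Icc.exists_bound_of_continuousOn hIc
    obtain ⟨B, hB⟩ := isCompact_Icc.exists_bound_of_continuousOn hJc
    have mI : MemLp (fun x => x ^ (-ν + 1 / 2) * I x) 2 (volume.restrict (Ioo (0 : ℝ) 1)) := by
      refine ((memLp_rpow hq).const_mul A).mono' ?_ ?_
      · exact (memLp_rpow hq).1.mul
          ((hIc.mono Ioo_subset_Icc_self).aestronglyMeasurable measurableSet_Ioo)
      · refine (ae_restrict_iff' measurableSet_Ioo).2 (Eventually.of_forall fun x hx => ?_)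
        rw [norm_mul, Real.norm_of_nonneg (Real.rpow_nonneg hx.1.le _), mul_comm]
        exact mul_le_mul_of_nonneg_right (hA x (Ioo_subset_Icc_self hx))
          (Real.rpow_nonneg hx.1.le _)
    have mJ : MemLp (fun x => x ^ (ν + 1 / 2) * J x) 2 (volume.restrict (Ioo (0 : ℝ) 1)) := by
      refine ((memLp_rpow hp).const_mul B).mono' ?_ ?_
      · exact (memLp_rpow hp).1.mul
          ((hJc.mono Ioo_subset_Icc_self).aestronglyMeasurable measurableSet_Ioo)
      · refine (ae_restrict_iff' measurableSet_Ioo).2 (Eventually.of_forall fun x hx => ?_)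
        rw [norm_mul, Real.norm_of_nonneg (Real.rpow_nonneg hx.1.le _), mul_comm]
        exact mul_le_mul_of_nonneg_right (hB x (Ioo_subset_Icc_self hx))
          (Real.rpow_nonneg hx.1.le _)
    exact (mI.sub mJ).const_mul _
  refine ⟨fun x => u x + sing ν c₁ c₂ x, fun x => u' x + sing' ν c₁ c₂ x, ?_⟩
  constructor
  · exact fun ε h0 h1 => (hu ε h0 h1).add (isPrim_sing ν c₁ c₂ h0 h1)
  · intro ε h0 h1
    refine ((hu' ε h0 h1).add (isPrim_sing' ν c₁ c₂ h0 h1)).congr (fun x _ => rfl)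
      (Eventually.of_forall fun x _ => ?_) h1.le
    ring
  · have e1 : (∫ x in Ioo (0 : ℝ) 1, (x ^ (ν + 1 / 2) - x ^ (-ν + 1 / 2)) * h x) = I 1 - J 1 := by
      simp only [sub_mul]
      rw [integral_sub (integrableOn_rpow_mul hp hh) (integrableOn_rpow_mul hq hh)]
      simp only [I, J]
      rw [intervalIntegral.integral_of_le zero_le_one, intervalIntegral.integral_of_le zero_le_one,
        integral_Ioc_eq_integral_Ioo, integral_Ioc_eq_integral_Ioo]
    -- The hypothesis on `c₁ + c₂` is exactly the Dirichlet condition at `1`.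
    rw [e1] at hc
    simp only [u, sing, Real.one_rpow, mul_one, one_mul]
    have e4 : (2 * ν)⁻¹ * (2 * ν) = 1 := inv_mul_cancel₀ h2ν
    linear_combination (2 * ν)⁻¹ * hc - (c₁ + c₂) * e4
  · exact ⟨by simpa using oU, by simpa using oU'⟩
  · exact huL.add (memLp_sing hν hν1 c₁ c₂)
  · exact hh
  · simpa using hreg

/-! ### Regular parts up to the singular point -/

theorem IsPrim.of_tendsto {U w : ℝ → ℝ} (h : ∀ ε, 0 < ε → ε < 1 → IsPrim ε 1 U w)
    (h0 : Tendsto U (𝓝[>] 0) (𝓝 (U 0))) (hw : IntegrableOn w (Ioo (0 : ℝ) 1)) :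
    IsPrim 0 1 U w := by
  have hwi : IntervalIntegrable w volume 0 1 :=
    (intervalIntegrable_iff_integrableOn_Ioo_of_le zero_le_one).2 hw
  have e1 : ∫ x in (0 : ℝ)..1, w x = U 1 - U 0 := by
    rw [intervalIntegral.integral_of_le zero_le_one, integral_Ioc_eq_integral_Ioo]
    refine tendsto_nhds_unique (tendsto_integral_left hw) ((tendsto_const_nhds.sub h0).congr' ?_)
    filter_upwards [eventually_mem_Ioo] with ε hε
    exact ((h ε hε.1 hε.2).integral_eq (left_mem_Icc.2 hε.2.le) (right_mem_Icc.2 hε.2.le)).symm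
  refine ⟨hwi, fun x hx => ?_⟩
  have hx' : x ∈ uIcc (0 : ℝ) 1 := Icc_subset_uIcc hx
  rcases hx.1.eq_or_lt with h2 | h2
  · rw [← h2]; simp
  · rcases hx.2.eq_or_lt with h3 | h3
    · rw [h3, e1]; ring
    · have e2 := (h x h2 h3).integral_eq (left_mem_Icc.2 h3.le) (right_mem_Icc.2 h3.le)
      have e3 := intervalIntegral.integral_add_adjacent_intervals
        (hwi.mono_set (uIcc_subset_uIcc left_mem_uIcc hx'))
        (hwi.mono_set (uIcc_subset_uIcc hx' right_mem_uIcc))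
      linarith

theorem IsPrim.trans {a b c : ℝ} {F f : ℝ → ℝ} (hab : a ≤ b) (hbc : b ≤ c)
    (h : IsPrim a b F f) (k : IsPrim b c F f) : IsPrim a c F f where
  int := h.int.trans k.int
  eq x hx := by
    rcases le_total x b with hxb | hxb
    · exact h.eq x ⟨hx.1, hxb⟩
    · rw [← intervalIntegral.integral_add_adjacent_intervals h.int
        (k.int_sub (left_mem_Icc.2 hbc) ⟨hxb, hx.2⟩), k.eq x ⟨hxb, hx.2⟩,
        h.eq b (right_mem_Icc.2 hab)]
      ring

section Half

variable {ν c₁ c₂ d₁ d₂ : ℝ} {f f' g k k' l : ℝ → ℝ}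

theorem HalfSol.congr (h : HalfSol ν f f' g c₁ c₂) (e : ∀ x, 0 < x → k x = f x)
    (e' : ∀ x, 0 < x → k' x = f' x) : HalfSol ν k k' g c₁ c₂ := by
  have hae : ∀ᵐ x ∂(volume.restrict (Ioo (0 : ℝ) 1)), k x = f x :=
    (ae_restrict_iff' measurableSet_Ioo).2 (Eventually.of_forall fun x hx => e x hx.1)
  constructor
  · exact fun ε h0 h1 => (h.prim ε h0 h1).congr (fun x hx => e x (h0.trans_le hx.1))
      (Eventually.of_forall fun x hx => (e' x (h0.trans hx.1)).symm) h1.le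
  · exact fun ε h0 h1 => (h.prim' ε h0 h1).congr (fun x hx => e' x (h0.trans_le hx.1))
      (Eventually.of_forall fun x hx => by rw [e x (h0.trans hx.1)]) h1.le
  · rw [e 1 one_pos, h.one]
  · refine ⟨h.expansion.isBigO.congr' ?_ EventuallyEq.rfl,
      h.expansion.isBigO'.congr' ?_ EventuallyEq.rfl⟩
    · filter_upwards [eventually_mem_Ioo] with x hx
      rw [e x hx.1]
    · filter_upwards [eventually_mem_Ioo] with x hx
      rw [e' x hx.1]
  · refine h.memLp.ae_eq ?_
    filter_upwards [hae] with x hx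
    exact hx.symm
  · exact h.memLp_rhs
  · refine h.memLp_regular.ae_eq ?_
    filter_upwards [hae] with x hx
    rw [hx]

theorem HalfSol.congr_rhs (h : HalfSol ν f f' g c₁ c₂)
    (e : ∀ᵐ x ∂(volume.restrict (Ioo (0 : ℝ) 1)), g x = l x) : HalfSol ν f f' l c₁ c₂ where
  prim := h.prim
  prim' ε h0 h1 := by
    refine (h.prim' ε h0 h1).congr (fun _ _ => rfl) ?_ h1.le
    have h2 := (ae_restrict_iff' measurableSet_Ioo).1 e
    have h3 : ∀ᵐ x : ℝ, x ≠ 1 := by simp [ae_iff]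
    filter_upwards [h2, h3] with x hx hx1 hxm
    rw [hx ⟨h0.trans hxm.1, lt_of_le_of_ne hxm.2 hx1⟩]
  one := h.one
  expansion := h.expansion
  memLp := h.memLp
  memLp_rhs := h.memLp_rhs.ae_eq e
  memLp_regular := h.memLp_regular

theorem HalfSol.add (h : HalfSol ν f f' g c₁ c₂) (m : HalfSol ν k k' l d₁ d₂) :
    HalfSol ν (fun x => f x + k x) (fun x => f' x + k' x) (fun x => g x + l x)
      (c₁ + d₁) (c₂ + d₂) := by
  have es : ∀ x, sing ν (c₁ + d₁) (c₂ + d₂) x = sing ν c₁ c₂ x + sing ν d₁ d₂ x := fun x => by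
    unfold sing; ring
  have es' : ∀ x, sing' ν (c₁ + d₁) (c₂ + d₂) x = sing' ν c₁ c₂ x + sing' ν d₁ d₂ x :=
    fun x => by unfold sing'; ring
  constructor
  · exact fun ε h0 h1 => (h.prim ε h0 h1).add (m.prim ε h0 h1)
  · intro ε h0 h1
    refine ((h.prim' ε h0 h1).add (m.prim' ε h0 h1)).congr (fun _ _ => rfl)
      (Eventually.of_forall fun x _ => ?_) h1.le
    ring
  · rw [h.one, m.one, add_zero]
  · refine ⟨(h.expansion.isBigO.add m.expansion.isBigO).congr_left fun x => ?_,
      (h.expansion.isBigO'.add m.expansion.isBigO').congr_left fun x => ?_⟩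
    · rw [es]; ring
    · rw [es']; ring
  · exact h.memLp.add m.memLp
  · exact h.memLp_rhs.add m.memLp_rhs
  · refine (h.memLp_regular.add m.memLp_regular).ae_eq (Eventually.of_forall fun x => ?_)
    simp only [Pi.add_apply]
    rw [es]; ring

theorem halfSol_sing (hν : 0 < ν) (hν1 : ν < 1) (β : ℝ) :
    HalfSol ν (sing ν β (-β)) (sing' ν β (-β)) (fun _ => 0) β (-β) where
  prim ε h0 h1 := isPrim_sing ν β (-β) h0 h1
  prim' ε h0 h1 := by simpa using isPrim_sing' ν β (-β) h0 h1
  one := by simp [sing]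
  expansion := HasExpansion.sing ν β (-β)
  memLp := memLp_sing hν hν1 β (-β)
  memLp_rhs := MemLp.zero'
  memLp_regular := by simp

theorem memLp_of_continuousOn_Icc {u : ℝ → ℝ} {a b : ℝ} (hu : ContinuousOn u (Icc a b)) :
    MemLp u 2 (volume.restrict (Ioo a b)) := by
  obtain ⟨C, hC⟩ := isCompact_Icc.exists_bound_of_continuousOn hu
  refine MemLp.of_bound ((hu.mono Ioo_subset_Icc_self).aestronglyMeasurable measurableSet_Ioo) C ?_
  exact (ae_restrict_iff' measurableSet_Ioo).2
    (Eventually.of_forall fun x hx => hC x (Ioo_subset_Icc_self hx))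

/-- A function with square integrable second derivative which vanishes to first order at `0`. -/
theorem isBigO_of_isPrim {u u' u'' : ℝ → ℝ} (h1 : IsPrim 0 1 u u') (h2 : IsPrim 0 1 u' u'')
    (h0 : u 0 = 0) (h0' : u' 0 = 0) (hw : MemLp u'' 2 (volume.restrict (Ioo (0 : ℝ) 1))) :
    (u =O[𝓝[>] 0] fun x => x ^ (3 / 2 : ℝ)) ∧ u' =O[𝓝[>] 0] fun x => x ^ (1 / 2 : ℝ) := by
  obtain ⟨C, hC0, hC⟩ := abs_moment_le (s := 0) (by norm_num) hw
  have hb : ∀ x, 0 < x → x ≤ 1 → |u' x| ≤ C * x ^ (1 / 2 : ℝ) := fun x hx hx1 => by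
    have := hC x hx hx1
    simp only [Real.rpow_zero, one_mul, zero_add] at this
    rw [h2.eq x ⟨hx.le, hx1⟩, h0', zero_add]
    exact this
  refine ⟨IsBigO.of_bound C ?_, IsBigO.of_bound C ?_⟩
  · filter_upwards [eventually_mem_Ioo] with x hx
    rw [Real.norm_of_nonneg (Real.rpow_nonneg hx.1.le _), h1.eq x ⟨hx.1.le, hx.2.le⟩, h0, zero_add]
    have := intervalIntegral.norm_integral_le_of_norm_le_const (a := 0) (b := x) (f := u')
      (C := C * x ^ (1 / 2 : ℝ)) fun t ht => by
        rw [uIoc_of_le hx.1.le] at ht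
        refine (hb t ht.1 (ht.2.trans hx.2.le)).trans ?_
        exact mul_le_mul_of_nonneg_left (Real.rpow_le_rpow ht.1.le ht.2 (by norm_num)) hC0
    refine this.trans (le_of_eq ?_)
    rw [sub_zero, abs_of_pos hx.1, mul_assoc]
    congr 1
    nth_rw 2 [← Real.rpow_one x]
    rw [← Real.rpow_add hx.1]
    norm_num
  · filter_upwards [eventually_mem_Ioo] with x hx
    rw [Real.norm_of_nonneg (Real.rpow_nonneg hx.1.le _)]
    exact hb x hx.1 hx.2.le

/-- The singular terms solve the homogeneous equation, so the equation only sees `u`. Square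
integrability of `c_ν u/x²` needs no Hardy inequality here: it equals `g + u''`. -/
theorem halfSol_of_regular {u u' u'' : ℝ → ℝ} (hν : 0 < ν) (hν1 : ν < 1)
    (h1 : IsPrim 0 1 u u') (h2 : IsPrim 0 1 u' u'') (h0 : u 0 = 0) (h0' : u' 0 = 0)
    (hw : MemLp u'' 2 (volume.restrict (Ioo (0 : ℝ) 1)))
    (hg : MemLp g 2 (volume.restrict (Ioo (0 : ℝ) 1)))
    (hae : ∀ᵐ x ∂(volume.restrict (Ioo (0 : ℝ) 1)), g x = -u'' x + (ν ^ 2 - 1 / 4) / x ^ 2 * u x)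
    (hone : u 1 + sing ν c₁ c₂ 1 = 0) :
    HalfSol ν (fun x => u x + sing ν c₁ c₂ x) (fun x => u' x + sing' ν c₁ c₂ x) g c₁ c₂ := by
  obtain ⟨o, o'⟩ := isBigO_of_isPrim h1 h2 h0 h0' hw
  have hreg : MemLp (fun x => (ν ^ 2 - 1 / 4) / x ^ 2 * u x) 2
      (volume.restrict (Ioo (0 : ℝ) 1)) := by
    refine (hg.add hw).ae_eq ?_
    filter_upwards [hae] with x hx
    rw [Pi.add_apply, hx]; ring
  have key : HalfSol ν (fun x => u x + sing ν c₁ c₂ x) (fun x => u' x + sing' ν c₁ c₂ x)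
      (fun x => -u'' x + (ν ^ 2 - 1 / 4) / x ^ 2 * u x) c₁ c₂ := by
    constructor
    · exact fun ε e0 e1 => (h1.mono e0.le e1.le le_rfl).add (isPrim_sing ν c₁ c₂ e0 e1)
    · intro ε e0 e1
      refine ((h2.mono e0.le e1.le le_rfl).add (isPrim_sing' ν c₁ c₂ e0 e1)).congr
        (fun _ _ => rfl) (Eventually.of_forall fun x _ => ?_) e1.le
      ring
    · exact hone
    · exact ⟨by simpa using o, by simpa using o'⟩
    · exact (memLp_of_continuousOn_Icc h1.continuousOn).add (memLp_sing hν hν1 c₁ c₂)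
    · exact hw.neg.add hreg
    · simpa using hreg
  exact key.congr_rhs (by filter_upwards [hae] with x hx using hx.symm)

/-- Away from `0` the remainder and its derivative are absolutely continuous, and the expansion
makes both tend to `0`; hence the remainder extends across the endpoint as an `H²` function
vanishing to first order. -/
theorem HalfSol.isPrim_regular (h : HalfSol ν f f' g c₁ c₂) {u u' u'' : ℝ → ℝ}
    (h0 : u 0 = 0) (h0' : u' 0 = 0) (hu : ∀ x, 0 < x → u x = f x - sing ν c₁ c₂ x)
    (hu' : ∀ x, 0 < x → u' x = f' x - sing' ν c₁ c₂ x)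
    (hu'' : ∀ x, 0 < x → u'' x = (ν ^ 2 - 1 / 4) / x ^ 2 * (f x - sing ν c₁ c₂ x) - g x) :
    IsPrim 0 1 u u' ∧ IsPrim 0 1 u' u'' ∧ MemLp u'' 2 (volume.restrict (Ioo (0 : ℝ) 1)) := by
  have m : MemLp u'' 2 (volume.restrict (Ioo (0 : ℝ) 1)) := by
    refine (h.memLp_regular.sub h.memLp_rhs).ae_eq ?_
    exact (ae_restrict_iff' measurableSet_Ioo).2
      (Eventually.of_forall fun x hx => (hu'' x hx.1).symm)
  have t : ∀ {v w : ℝ → ℝ} {a : ℝ}, 0 < a → w =O[𝓝[>] 0] (fun x : ℝ => x ^ a) → v 0 = 0 →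
      (∀ x, 0 < x → v x = w x) → Tendsto v (𝓝[>] 0) (𝓝 (v 0)) := by
    intro v w a ha hw hv e
    rw [hv]
    refine (hw.trans_tendsto (rpow_tendsto_zero ha)).congr' ?_
    filter_upwards [eventually_mem_Ioo] with x hx
    exact (e x hx.1).symm
  have p' : IsPrim 0 1 u' u'' := by
    refine IsPrim.of_tendsto (fun ε e0 e1 => ?_)
      (t (by norm_num) h.expansion.isBigO' h0' hu') (m.integrable one_le_two)
    refine ((h.prim' ε e0 e1).sub (isPrim_sing' ν c₁ c₂ e0 e1)).congr
      (fun x hx => hu' x (e0.trans_le hx.1)) (Eventually.of_forall fun x hx => ?_) e1.le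
    rw [hu'' x (e0.trans hx.1)]; ring
  refine ⟨?_, p', m⟩
  refine IsPrim.of_tendsto (fun ε e0 e1 => ?_)
    (t (by norm_num) h.expansion.isBigO h0 hu)
    ((p'.continuousOn.integrableOn_compact isCompact_Icc).mono_set Ioo_subset_Icc_self)
  exact ((h.prim ε e0 e1).sub (isPrim_sing ν c₁ c₂ e0 e1)).congr
    (fun x hx => hu x (e0.trans_le hx.1))
    (Eventually.of_forall fun x hx => (hu' x (e0.trans hx.1)).symm) e1.le

end Half

/-! ### Reduction to `(0, 1)` by reflection -/

section Reflection

theorem measurePreserving_neg_restrict :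
    MeasurePreserving (fun x : ℝ => -x) (volume.restrict (Ioo (0 : ℝ) 1))
      (volume.restrict (Ioo (-1 : ℝ) 0)) := by
  have h := (Measure.measurePreserving_neg (volume : Measure ℝ)).restrict_preimage
    (measurableSet_Ioo (a := (-1 : ℝ)) (b := 0))
  simpa using h

theorem restrict_Ioo_eq : volume.restrict (Ioo (-1 : ℝ) 1) =
    volume.restrict (Ioo (-1 : ℝ) 0) + volume.restrict (Ioo (0 : ℝ) 1) := by
  rw [← Measure.restrict_union (by
    rw [Set.disjoint_left]; rintro x hx hx'; exact lt_asymm hx.2 hx'.1) measurableSet_Ioo]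
  refine Measure.restrict_congr_set ?_
  have h0 : ∀ᵐ x : ℝ, x ≠ 0 := by simp [ae_iff]
  filter_upwards [h0] with x hx
  refine propext ⟨fun h => ?_, fun h => ?_⟩
  · rcases lt_or_gt_of_ne hx with h' | h'
    · exact Or.inl ⟨h.1, h'⟩
    · exact Or.inr ⟨h', h.2⟩
  · rcases h with h | h
    · exact ⟨h.1, h.2.trans one_pos⟩
    · exact ⟨by linarith [h.1], h.2⟩

theorem ae_Ioo_iff {p : ℝ → Prop} : (∀ᵐ x ∂(volume.restrict (Ioo (-1 : ℝ) 1)), p x) ↔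
    (∀ᵐ x ∂(volume.restrict (Ioo (0 : ℝ) 1)), p x) ∧
      ∀ᵐ x ∂(volume.restrict (Ioo (0 : ℝ) 1)), p (-x) := by
  rw [restrict_Ioo_eq, ae_add_measure_iff, and_comm]
  refine and_congr_right fun _ => ?_
  rw [← measurePreserving_neg_restrict.map_eq]
  exact (MeasurableEquiv.neg ℝ).measurableEmbedding.ae_map_iff

theorem integral_Ioo_eq {G : ℝ → ℝ} (hG : IntegrableOn G (Ioo (-1 : ℝ) 1)) :
    ∫ x in Ioo (-1 : ℝ) 1, G x =
      (∫ x in Ioo (0 : ℝ) 1, G x) + ∫ x in Ioo (0 : ℝ) 1, G (-x) := by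
  rw [IntegrableOn, restrict_Ioo_eq, integrable_add_measure] at hG
  rw [restrict_Ioo_eq, integral_add_measure hG.1 hG.2, add_comm]
  congr 1
  exact (measurePreserving_neg_restrict.integral_comp
    (MeasurableEquiv.neg ℝ).measurableEmbedding G).symm

theorem memLp_Ioo_iff {G : ℝ → ℝ} : MemLp G 2 (volume.restrict (Ioo (-1 : ℝ) 1)) ↔
    MemLp G 2 (volume.restrict (Ioo (0 : ℝ) 1)) ∧
      MemLp (fun x => G (-x)) 2 (volume.restrict (Ioo (0 : ℝ) 1)) := by
  have e : MemLp (fun x => G (-x)) 2 (volume.restrict (Ioo (0 : ℝ) 1)) ↔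
      MemLp G 2 (volume.restrict (Ioo (-1 : ℝ) 0)) := by
    rw [← measurePreserving_neg_restrict.map_eq]
    exact ((MeasurableEquiv.neg ℝ).measurableEmbedding.memLp_map_measure_iff).symm
  rw [e, restrict_Ioo_eq]
  refine ⟨fun h => ⟨h.mono_measure (Measure.le_add_left le_rfl),
    h.mono_measure (Measure.le_add_right le_rfl)⟩, fun h => ?_⟩
  have hm : AEStronglyMeasurable G
      (volume.restrict (Ioo (-1 : ℝ) 0) + volume.restrict (Ioo (0 : ℝ) 1)) :=
    aestronglyMeasurable_add_measure_iff.2 ⟨h.2.1, h.1.1⟩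
  rw [memLp_two_iff_integrable_sq hm, integrable_add_measure]
  exact ⟨h.2.integrable_sq, h.1.integrable_sq⟩

end Reflection

/-! ### The transmission problem for the singular operator -/

/-- Solutions of `-f'' + (ν² - 1/4) / x² f = g` on `(-1, 0) ∪ (0, 1)` with Dirichlet conditions at
`±1` and the transmission conditions at `0`. -/
structure TransmissionSol (ν : ℝ) (f f' g : ℝ → ℝ) (c₁m c₂m c₁p c₂p : ℝ) : Prop where
  right : HalfSol ν f f' g c₁p c₂p
  left : HalfSol ν (fun x => f (-x)) (fun x => -f' (-x)) (fun x => g (-x)) c₁m c₂m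
  sum_eq : c₁m + c₂m + c₁p + c₂p = 0
  flux_eq : (ν + 1 / 2) * c₁m + (-ν + 1 / 2) * c₂m = (ν + 1 / 2) * c₁p + (-ν + 1 / 2) * c₂p

/-- The graph of the operator without the regular part of the potential. -/
def SingGraph (ν : ℝ) (f g : L2) : Prop :=
  ∃ (F F' : ℝ → ℝ) (c₁m c₂m c₁p c₂p : ℝ), TransmissionSol ν F F' g c₁m c₂m c₁p c₂p ∧
    (f : ℝ → ℝ) =ᵐ[volume.restrict (Ioo (-1 : ℝ) 1)] F

theorem inner_L2 (f g : L2) : inner ℝ f g = ∫ x in Ioo (-1 : ℝ) 1, f x * g x := by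
  rw [L2.inner_def]; simp [mul_comm]

theorem integrable_mul_L2 (f g : L2) : IntegrableOn (fun x => f x * g x) (Ioo (-1 : ℝ) 1) :=
  (Lp.memLp f).integrable_mul (Lp.memLp g)

theorem inner_L2_eq {f g : L2} {F G : ℝ → ℝ}
    (hf : (f : ℝ → ℝ) =ᵐ[volume.restrict (Ioo (-1 : ℝ) 1)] F)
    (hg : (g : ℝ → ℝ) =ᵐ[volume.restrict (Ioo (-1 : ℝ) 1)] G) : inner ℝ f g =
    (∫ x in Ioo (0 : ℝ) 1, F x * G x) + ∫ x in Ioo (0 : ℝ) 1, F (-x) * G (-x) := by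
  have e : (fun x => f x * g x) =ᵐ[volume.restrict (Ioo (-1 : ℝ) 1)] fun x => F x * G x := by
    filter_upwards [hf, hg] with x h1 h2
    rw [h1, h2]
  rw [inner_L2, integral_congr_ae e]
  exact integral_Ioo_eq ((integrable_mul_L2 f g).congr e)

section SingGraph

variable {ν : ℝ}

/-- On each half the boundary term is the Wronskian of the singular parts evaluated at `x = 1`, in
terms of the sums `c₁ + c₂` and the fluxes. The transmission conditions reverse the sums and
preserve the fluxes across `0`, so the two terms cancel. -/
theorem SingGraph.symm (hν : 0 < ν) (hν1 : ν < 1) (f g k l : L2) (h : SingGraph ν f g)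
    (m : SingGraph ν k l) : inner ℝ g k = inner ℝ f l := by
  obtain ⟨F, F', a1, a2, b1, b2, hF, hf⟩ := h
  obtain ⟨K, K', c1, c2, d1, d2, hK, hk⟩ := m
  rw [real_inner_comm l f, inner_L2_eq EventuallyEq.rfl hk, inner_L2_eq EventuallyEq.rfl hf]
  have e1 := hF.right.integral_symm hK.right hν hν1
  have e2 := hF.left.integral_symm hK.left hν hν1
  have s1 := hF.sum_eq
  have s2 := hF.flux_eq
  have t1 := hK.sum_eq
  have t2 := hK.flux_eq
  have key : 2 * ν * (b1 * d2 - b2 * d1) + 2 * ν * (a1 * c2 - a2 * c1) = 0 := by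
    have u1 : a1 + a2 = -(b1 + b2) := by linarith
    have v1 : c1 + c2 = -(d1 + d2) := by linarith
    have w1 : 2 * ν * (a1 * c2 - a2 * c1) =
        ((ν + 1 / 2) * a1 + (-ν + 1 / 2) * a2) * (c1 + c2) -
          (a1 + a2) * ((ν + 1 / 2) * c1 + (-ν + 1 / 2) * c2) := by ring
    have w2 : 2 * ν * (b1 * d2 - b2 * d1) =
        ((ν + 1 / 2) * b1 + (-ν + 1 / 2) * b2) * (d1 + d2) -
          (b1 + b2) * ((ν + 1 / 2) * d1 + (-ν + 1 / 2) * d2) := by ring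
    rw [w1, w2, u1, v1, s2, t2]; ring
  linarith

/-- The two half-interval lower bounds add up to `2(ν + 1/2)(c₁⁺ + c₂⁺)²` once the transmission
conditions are inserted. -/
theorem SingGraph.nonneg (hν : 0 < ν) (hν1 : ν < 1) (f g : L2) (h : SingGraph ν f g) :
    0 ≤ inner ℝ g f := by
  obtain ⟨F, F', a1, a2, b1, b2, hF, hf⟩ := h
  rw [inner_L2_eq EventuallyEq.rfl hf]
  have e1 := hF.right.le_integral hν hν1
  have e2 := hF.left.le_integral hν hν1
  have s1 := hF.sum_eq
  have s2 := hF.flux_eq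
  have key : 2 * ν * b2 * (b1 + b2) + 2 * ν * a2 * (a1 + a2) =
      2 * (ν + 1 / 2) * (b1 + b2) ^ 2 := by
    have u1 : a1 = -(b1 + b2) - a2 := by linarith
    have u2 : 2 * ν * (b2 - a2) = 2 * (ν + 1 / 2) * (b1 + b2) := by
      rw [u1] at s2; linarith
    rw [u1]
    linear_combination (b1 + b2) * u2
  have : 0 ≤ 2 * (ν + 1 / 2) * (b1 + b2) ^ 2 := by positivity
  linarith

theorem SingGraph.add {f g k l : L2} (h : SingGraph ν f g) (m : SingGraph ν k l) :
    SingGraph ν (f + k) (g + l) := by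
  obtain ⟨F, F', a1, a2, b1, b2, hF, hf⟩ := h
  obtain ⟨K, K', c1, c2, d1, d2, hK, hk⟩ := m
  have hae : ∀ᵐ x ∂(volume.restrict (Ioo (-1 : ℝ) 1)), g x + l x = (g + l : L2) x := by
    filter_upwards [Lp.coeFn_add g l] with x hx
    rw [hx, Pi.add_apply]
  refine ⟨fun x => F x + K x, fun x => F' x + K' x, a1 + c1, a2 + c2, b1 + d1, b2 + d2,
    ⟨?_, ?_, ?_, ?_⟩, ?_⟩
  · exact (hF.right.add hK.right).congr_rhs (ae_Ioo_iff.1 hae).1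
  · exact ((hF.left.add hK.left).congr_rhs (ae_Ioo_iff.1 hae).2).congr (fun _ _ => rfl)
      fun x _ => by ring
  · linarith [hF.sum_eq, hK.sum_eq]
  · linarith [hF.flux_eq, hK.flux_eq]
  · filter_upwards [Lp.coeFn_add f k, hf, hk] with x h1 h2 h3
    rw [h1, Pi.add_apply, h2, h3]

theorem coeFn_zero_L2 : ∀ᵐ x ∂(volume.restrict (Ioo (-1 : ℝ) 1)), (0 : ℝ) = (0 : L2) x := by
  filter_upwards [Lp.coeFn_zero ℝ 2 (volume.restrict (Ioo (-1 : ℝ) 1))] with x hx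
  rw [hx]; rfl

theorem memLp_groundState (hν : 0 < ν) (hν1 : ν < 1) (β : ℝ) :
    MemLp (fun x => sing ν β (-β) |x|) 2 (volume.restrict (Ioo (-1 : ℝ) 1)) := by
  have h : MemLp (fun x => sing ν β (-β) |x|) 2 (volume.restrict (Ioo (0 : ℝ) 1)) := by
    refine (memLp_sing hν hν1 β (-β)).ae_eq ?_
    refine (ae_restrict_iff' measurableSet_Ioo).2 (Eventually.of_forall fun x hx => ?_)
    simp only [abs_of_pos hx.1]
  exact memLp_Ioo_iff.2 ⟨h, by simpa only [abs_neg] using h⟩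

/-- The kernel of the singular operator is spanned by `|x|^(ν+1/2) - |x|^(-ν+1/2)`. -/
noncomputable def groundState (hν : 0 < ν) (hν1 : ν < 1) : L2 := (memLp_groundState hν hν1 1).toLp _

theorem coeFn_groundState (hν : 0 < ν) (hν1 : ν < 1) :
    (groundState hν hν1 : ℝ → ℝ) =ᵐ[volume.restrict (Ioo (-1 : ℝ) 1)]
      fun x => sing ν 1 (-1) |x| := MemLp.coeFn_toLp _

theorem singGraph_groundState (hν : 0 < ν) (hν1 : ν < 1) (β : ℝ) :
    SingGraph ν (β • groundState hν hν1) 0 := by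
  have hs := halfSol_sing hν hν1 β
  refine ⟨fun x => sing ν β (-β) |x|,
    fun x => if 0 < x then sing' ν β (-β) x else -sing' ν β (-β) (-x),
    β, -β, β, -β, ⟨?_, ?_, ?_, ?_⟩, ?_⟩
  · exact (hs.congr_rhs (ae_Ioo_iff.1 coeFn_zero_L2).1).congr
      (fun x hx => by rw [abs_of_pos hx]) fun x hx => if_pos hx
  · refine (hs.congr_rhs (ae_Ioo_iff.1 coeFn_zero_L2).2).congr
      (fun x hx => by rw [abs_neg, abs_of_pos hx]) fun x hx => ?_
    rw [if_neg (by linarith), neg_neg, neg_neg]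
  · ring
  · ring
  · filter_upwards [Lp.coeFn_smul β (groundState hν hν1), coeFn_groundState hν hν1] with x h1 h2
    rw [h1, Pi.smul_apply, h2, smul_eq_mul]
    unfold sing; ring

/-- Solvability on each half prescribes `c₁ + c₂` as a moment of `h`. Orthogonality says that the
two moments are opposite, which is the first transmission condition; the remaining freedom is spent
on the flux condition. -/
theorem exists_singGraph_of_orthogonal (hν : 0 < ν) (hν1 : ν < 1) {h : L2}
    (ho : inner ℝ (groundState hν hν1) h = 0) : ∃ f, SingGraph ν f h := by
  obtain ⟨m1, m2⟩ := memLp_Ioo_iff.1 (Lp.memLp h)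
  rw [inner_L2_eq (coeFn_groundState hν hν1) EventuallyEq.rfl] at ho
  have e1 : ∫ x in Ioo (0 : ℝ) 1, sing ν 1 (-1) |x| * h x =
      ∫ x in Ioo (0 : ℝ) 1, (x ^ (ν + 1 / 2) - x ^ (-ν + 1 / 2)) * h x := by
    refine setIntegral_congr_fun measurableSet_Ioo fun x hx => ?_
    simp only [sing, abs_of_pos hx.1]; ring
  have e2 : ∫ x in Ioo (0 : ℝ) 1, sing ν 1 (-1) |-x| * h (-x) =
      ∫ x in Ioo (0 : ℝ) 1, (x ^ (ν + 1 / 2) - x ^ (-ν + 1 / 2)) * h (-x) := by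
    refine setIntegral_congr_fun measurableSet_Ioo fun x hx => ?_
    simp only [sing, abs_neg, abs_of_pos hx.1]; ring
  rw [e1, e2] at ho
  let a : ℝ := ∫ x in Ioo (0 : ℝ) 1, (x ^ (ν + 1 / 2) - x ^ (-ν + 1 / 2)) * h x
  let S : ℝ := -a / (2 * ν)
  -- The unique pair with sum `S` and zero flux; its negative on the left then has zero flux too.
  let c₁ : ℝ := -(-ν + 1 / 2) * S / (2 * ν)
  let c₂ : ℝ := (ν + 1 / 2) * S / (2 * ν)
  have hS : 2 * ν * (c₁ + c₂) = -a := by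
    simp only [c₁, c₂, S]; field_simp; ring
  have hT : (ν + 1 / 2) * c₁ + (-ν + 1 / 2) * c₂ = 0 := by
    simp only [c₁, c₂]; ring
  obtain ⟨fp, fp', hp⟩ := exists_halfSol hν hν1 m1 (c₁ := c₁) (c₂ := c₂) hS
  obtain ⟨fm, fm', hm⟩ := exists_halfSol hν hν1 m2 (c₁ := -c₁) (c₂ := -c₂) (by linarith)
  let F : ℝ → ℝ := fun x => if 0 < x then fp x else fm (-x)
  let F' : ℝ → ℝ := fun x => if 0 < x then fp' x else -fm' (-x)
  have hR : HalfSol ν F F' h c₁ c₂ := hp.congr (fun x hx => if_pos hx) fun x hx => if_pos hx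
  have hL : HalfSol ν (fun x => F (-x)) (fun x => -F' (-x)) (fun x => h (-x)) (-c₁) (-c₂) := by
    refine hm.congr (fun x hx => ?_) fun x hx => ?_
    · simp only [F]; rw [if_neg (by linarith), neg_neg]
    · simp only [F']; rw [if_neg (by linarith), neg_neg, neg_neg]
  refine ⟨(memLp_Ioo_iff.2 ⟨hR.memLp, hL.memLp⟩).toLp F, F, F', -c₁, -c₂, c₁, c₂,
    ⟨hR, hL, by ring, by linarith⟩, MemLp.coeFn_toLp _⟩

/-- The projection onto the kernel, up to normalisation. -/
noncomputable def kernelProj (hν : 0 < ν) (hν1 : ν < 1) : L2 →L[ℝ] L2 :=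
  (innerSL ℝ (groundState hν hν1)).smulRight (groundState hν hν1)

theorem kernelProj_apply (hν : 0 < ν) (hν1 : ν < 1) (u : L2) :
    kernelProj hν hν1 u = (inner ℝ (groundState hν hν1) u : ℝ) • groundState hν hν1 := rfl

theorem exists_singGraph_add_kernelProj (hν : 0 < ν) (hν1 : ν < 1) (h : L2) :
    ∃ f, SingGraph ν f (h - kernelProj hν hν1 f) := by
  let e := groundState hν hν1
  by_cases he : e = 0
  · obtain ⟨f, hf⟩ := exists_singGraph_of_orthogonal hν hν1 (h := h)
      (by change inner ℝ e h = 0; rw [he, inner_zero_left])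
    refine ⟨f, ?_⟩
    rw [kernelProj_apply]
    change SingGraph ν f (h - (inner ℝ e f : ℝ) • e)
    rwa [he, smul_zero, sub_zero]
  · have hN : (inner ℝ e e : ℝ) ≠ 0 := inner_self_ne_zero.2 he
    -- First remove the component `α e` of `h` to make the equation solvable; then use the freedom
    -- of adding `β e` to the solution so that the rank-one term reproduces `α e`.
    let α : ℝ := inner ℝ e h / inner ℝ e e
    obtain ⟨f, hf⟩ := exists_singGraph_of_orthogonal hν hν1 (h := h - α • e) (by
      change inner ℝ e (h - α • e) = 0
      rw [inner_sub_right, inner_smul_right]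
      simp only [α]
      field_simp
      ring)
    let β : ℝ := (α - inner ℝ e f) / inner ℝ e e
    refine ⟨f + β • e, ?_⟩
    have h1 := hf.add (singGraph_groundState hν hν1 β)
    rw [add_zero] at h1
    have e2 : kernelProj hν hν1 (f + β • e) = α • e := by
      rw [kernelProj_apply]
      change (inner ℝ e (f + β • e) : ℝ) • e = α • e
      congr 1
      rw [inner_add_right, inner_smul_right]
      simp only [β]
      field_simp
      ring
    rwa [e2]

theorem kernelProj_symm (hν : 0 < ν) (hν1 : ν < 1) (u v : L2) :
    inner ℝ (kernelProj hν hν1 u) v = inner ℝ u (kernelProj hν hν1 v) := by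
  simp only [kernelProj_apply, inner_smul_left, inner_smul_right, conj_trivial]
  rw [real_inner_comm u]; ring

theorem kernelProj_nonneg (hν : 0 < ν) (hν1 : ν < 1) (u : L2) :
    0 ≤ inner ℝ (kernelProj hν hν1 u) u := by
  simp only [kernelProj_apply, inner_smul_left, conj_trivial]
  exact mul_self_nonneg _

end SingGraph

/-! ### Multiplication by the bounded potential -/

section Potential

theorem memLp_bounded_mul {v : ℝ → ℝ} (hv : Measurable v) {C : ℝ}
    (hC : ∀ x ∈ Ioo (-1 : ℝ) 1, |v x| ≤ C) (f : L2) :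
    MemLp (fun x => v x * f x) 2 (volume.restrict (Ioo (-1 : ℝ) 1)) := by
  refine ((Lp.memLp f).norm.const_mul C).mono' (hv.aestronglyMeasurable.mul (Lp.memLp f).1) ?_
  refine (ae_restrict_iff' measurableSet_Ioo).2 (Eventually.of_forall fun x hx => ?_)
  rw [norm_mul]
  exact mul_le_mul_of_nonneg_right (hC x hx) (norm_nonneg _)

/-- Multiplication by a bounded function is a bounded operator. -/
theorem exists_mulOp {v : ℝ → ℝ} (hv : Measurable v) {C : ℝ}
    (hC : ∀ x ∈ Ioo (-1 : ℝ) 1, |v x| ≤ C) : ∃ V : L2 →L[ℝ] L2, ∀ f : L2,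
      (V f : ℝ → ℝ) =ᵐ[volume.restrict (Ioo (-1 : ℝ) 1)] fun x => v x * f x := by
  let T : L2 → L2 := fun f => (memLp_bounded_mul hv hC f).toLp _
  have hT : ∀ f, (T f : ℝ → ℝ) =ᵐ[volume.restrict (Ioo (-1 : ℝ) 1)] fun x => v x * f x :=
    fun f => MemLp.coeFn_toLp _
  let L : L2 →ₗ[ℝ] L2 :=
    { toFun := T
      map_add' := fun f g => by
        apply Lp.ext
        filter_upwards [hT (f + g), hT f, hT g, Lp.coeFn_add f g, Lp.coeFn_add (T f) (T g)]
          with x h1 h2 h3 h4 h5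
        rw [h1, h5, Pi.add_apply, h2, h3, h4, Pi.add_apply]; ring
      map_smul' := fun c f => by
        apply Lp.ext
        filter_upwards [hT (c • f), hT f, Lp.coeFn_smul c f, Lp.coeFn_smul c (T f)]
          with x h1 h2 h3 h4
        rw [h1, RingHom.id_apply, h4, Pi.smul_apply, h2, h3, Pi.smul_apply, smul_eq_mul,
          smul_eq_mul]
        ring }
  refine ⟨L.mkContinuous C fun f => ?_, hT⟩
  refine Lp.norm_le_mul_norm_of_ae_le_mul ?_
  filter_upwards [hT f, (ae_restrict_iff' measurableSet_Ioo).2 (Eventually.of_forall hC)]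
    with x h1 h2
  change ‖T f x‖ ≤ _
  rw [h1, norm_mul]
  exact mul_le_mul_of_nonneg_right h2 (norm_nonneg _)

/-- The regular part of the potential. -/
noncomputable def potential (γ : ℝ) (n : ℕ) (x : ℝ) : ℝ :=
  ((n : ℝ) * Real.pi) ^ 2 * |x| ^ (2 * γ)

theorem potential_nonneg (γ : ℝ) (n : ℕ) (x : ℝ) : 0 ≤ potential γ n x := by
  unfold potential; positivity

theorem exists_potentialOp {γ : ℝ} (hγ : 0 < γ) (n : ℕ) : ∃ V : L2 →L[ℝ] L2, ∀ f : L2,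
    (V f : ℝ → ℝ) =ᵐ[volume.restrict (Ioo (-1 : ℝ) 1)] fun x => potential γ n x * f x := by
  refine exists_mulOp (C := ((n : ℝ) * Real.pi) ^ 2) ?_ fun x hx => ?_
  · unfold potential; fun_prop
  · rw [abs_of_nonneg (potential_nonneg _ _ _), potential]
    refine mul_le_of_le_one_right (by positivity) ?_
    exact Real.rpow_le_one (abs_nonneg _) (abs_lt.2 hx).le (by positivity)

variable {γ : ℝ} {n : ℕ} {V : L2 →L[ℝ] L2}

theorem potentialOp_symm (hV : ∀ f : L2,
    (V f : ℝ → ℝ) =ᵐ[volume.restrict (Ioo (-1 : ℝ) 1)] fun x => potential γ n x * f x)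
    (f g : L2) : inner ℝ (V f) g = inner ℝ f (V g) := by
  rw [inner_L2, inner_L2]
  refine integral_congr_ae ?_
  filter_upwards [hV f, hV g] with x h1 h2
  rw [h1, h2]; ring

theorem potentialOp_nonneg (hV : ∀ f : L2,
    (V f : ℝ → ℝ) =ᵐ[volume.restrict (Ioo (-1 : ℝ) 1)] fun x => potential γ n x * f x)
    (f : L2) : 0 ≤ inner ℝ (V f) f := by
  rw [inner_L2]
  refine integral_nonneg_of_ae ?_
  filter_upwards [hV f] with x h1
  rw [h1, mul_assoc]
  exact mul_nonneg (potential_nonneg _ _ _) (mul_self_nonneg _)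

end Potential

/-! ### Identification of the operator with its decomposition -/

section OpGraph

variable {ν γ : ℝ} {n : ℕ} {V : L2 →L[ℝ] L2}

theorem TransmissionSol.hasWeakDerivOn {F F' g : ℝ → ℝ} {a b c d : ℝ}
    (h : TransmissionSol ν F F' g a b c d) : HasWeakDerivOn punctured F F' ∧
      HasWeakDerivOn punctured F' (fun x => (ν ^ 2 - 1 / 4) / x ^ 2 * F x - g x) := by
  refine ⟨hasWeakDerivOn_punctured h.right.prim fun ε h0 h1 => ?_,
    hasWeakDerivOn_punctured h.right.prim' fun ε h0 h1 => ?_⟩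
  · simpa only [neg_neg] using (h.left.prim ε h0 h1).comp_neg h1.le
  · simpa only [neg_neg, neg_sq] using ((h.left.prim' ε h0 h1).comp_neg h1.le).neg

theorem HasWeakDerivOn.congr_left {Ω : Set ℝ} {u₁ u₂ v : ℝ → ℝ}
    (h : HasWeakDerivOn Ω u₁ v) (e : u₁ =ᵐ[volume.restrict Ω] u₂)
    (hu : LocallyIntegrableOn u₂ Ω) : HasWeakDerivOn Ω u₂ v := by
  refine ⟨hu, h.2.1, fun φ hφ hc hs => ?_⟩
  rw [← h.2.2 φ hφ hc hs]
  refine integral_congr_ae ?_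
  filter_upwards [e] with x hx
  rw [hx]

theorem punctured_subset : punctured ⊆ Ioo (-1) 1 :=
  union_subset (Ioo_subset_Ioo_right zero_le_one) (Ioo_subset_Ioo_left (by norm_num))

theorem ae_punctured_iff {p : ℝ → Prop} : (∀ᵐ x ∂(volume.restrict punctured), p x) ↔
    ∀ᵐ x ∂(volume.restrict (Ioo (-1 : ℝ) 1)), p x := by
  rw [restrict_Ioo_eq, Measure.restrict_union (by
    rw [Set.disjoint_left]; rintro x hx hx'; exact lt_asymm hx.2 hx'.1) measurableSet_Ioo]

theorem isOpen_punctured : IsOpen punctured := isOpen_Ioo.union isOpen_Ioo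

theorem singularFun_of_pos {a b c d x : ℝ} (hx : 0 < x) :
    singularFun ν a b c d x = sing ν c d x := by
  simp [singularFun, sing, hx, abs_of_pos hx]

theorem singularFun_neg_of_pos {a b c d x : ℝ} (hx : 0 < x) :
    singularFun ν a b c d (-x) = sing ν a b x := by
  have : ¬ 0 < -x := by linarith
  rw [singularFun, if_neg this, abs_neg, abs_of_pos hx, sing]

/-- The derivative of `singularFun` away from the origin. -/
noncomputable def singularFun' (ν a b c d x : ℝ) : ℝ :=
  if 0 < x then sing' ν c d x else -sing' ν a b (-x)

theorem singularFun'_of_pos {a b c d x : ℝ} (hx : 0 < x) :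
    singularFun' ν a b c d x = sing' ν c d x := if_pos hx

theorem singularFun'_neg_of_pos {a b c d x : ℝ} (hx : 0 < x) :
    singularFun' ν a b c d (-x) = -sing' ν a b x := by
  rw [singularFun', if_neg (by linarith), neg_neg]

/-- The regular part is the difference with the singular function, glued from two `H²` pieces which
vanish to first order at `0`. -/
theorem SingGraph.opGraph (hV : ∀ f : L2,
    (V f : ℝ → ℝ) =ᵐ[volume.restrict (Ioo (-1 : ℝ) 1)] fun x => potential γ n x * f x)
    {f g : L2} (h : SingGraph ν f (g - V f)) : OpGraph ν γ n f g := by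
  obtain ⟨F, F', a, b, c, d, hF, hf⟩ := h
  obtain ⟨w1, w2⟩ := hF.hasWeakDerivOn
  -- The value at `0` is imposed because the representative `F` carries no information there.
  let u : ℝ → ℝ := fun x => if x = 0 then 0 else F x - singularFun ν a b c d x
  let u' : ℝ → ℝ := fun x => if x = 0 then 0 else F' x - singularFun' ν a b c d x
  let u'' : ℝ → ℝ := fun x =>
    (ν ^ 2 - 1 / 4) / x ^ 2 * (F x - singularFun ν a b c d x) - (g - V f : L2) x
  have u0 : u 0 = 0 := if_pos rfl
  have u0' : u' 0 = 0 := if_pos rfl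
  have hu : ∀ x, x ≠ 0 → u x = F x - singularFun ν a b c d x := fun x hx => if_neg hx
  have hu' : ∀ x, x ≠ 0 → u' x = F' x - singularFun' ν a b c d x := fun x hx => if_neg hx
  obtain ⟨p1, p2, p3⟩ := hF.right.isPrim_regular (u := u) (u' := u') (u'' := u'') u0 u0'
    (fun x hx => by rw [hu x hx.ne', singularFun_of_pos hx])
    (fun x hx => by rw [hu' x hx.ne', singularFun'_of_pos hx])
    (fun x hx => by simp only [u'']; rw [singularFun_of_pos hx])
  obtain ⟨q1, q2, q3⟩ := hF.left.isPrim_regular (u := fun x => u (-x)) (u' := fun x => -u' (-x))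
    (u'' := fun x => u'' (-x)) (by simp [u0]) (by simp [u0'])
    (fun x hx => by rw [hu _ (by linarith), singularFun_neg_of_pos hx])
    (fun x hx => by rw [hu' _ (by linarith), singularFun'_neg_of_pos hx]; ring)
    (fun x hx => by simp only [u'']; rw [singularFun_neg_of_pos hx, neg_sq])
  have r1 : IsPrim (-1) 1 u u' := by
    refine IsPrim.trans (b := 0) (by norm_num) zero_le_one ?_ p1
    simpa only [neg_neg, neg_zero] using q1.comp_neg zero_le_one
  have r2 : IsPrim (-1) 1 u' u'' := by
    refine IsPrim.trans (b := 0) (by norm_num) zero_le_one ?_ p2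
    simpa only [neg_neg, neg_zero] using (q2.comp_neg zero_le_one).neg
  have h0 : ∀ᵐ x ∂(volume.restrict (Ioo (-1 : ℝ) 1)), x ≠ 0 :=
    ae_restrict_of_ae (by simp [ae_iff])
  refine ⟨⟨u, a, b, c, d, ⟨u', u'', ⟨memLp_of_continuousOn_Icc r1.continuousOn,
    memLp_of_continuousOn_Icc r2.continuousOn, memLp_Ioo_iff.2 ⟨p3, q3⟩, r1.hasWeakDerivOn,
    r2.hasWeakDerivOn⟩, r1.continuousOn, r2.continuousOn, u0, u0'⟩, ?_, ?_, ?_, hF.sum_eq,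
    hF.flux_eq⟩, F', fun x => (ν ^ 2 - 1 / 4) / x ^ 2 * F x - (g - V f : L2) x, ?_, w2, ?_⟩
  · filter_upwards [hf, h0] with x h1 h2
    rw [h1, hu x h2, sub_add_cancel]
  · rw [hu _ (by norm_num), sub_add_cancel]
    exact hF.left.one
  · rw [hu _ one_ne_zero, sub_add_cancel]
    exact hF.right.one
  · refine w1.congr_left (ae_punctured_iff.2 ?_) ?_
    · filter_upwards [hf] with x hx using hx.symm
    · have hfi : IntegrableOn f (Ioo (-1 : ℝ) 1) := (Lp.memLp f).integrable one_le_two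
      exact (hfi.mono_set punctured_subset).locallyIntegrableOn
  · filter_upwards [hf, hV f, Lp.coeFn_sub g (V f)] with x h1 h2 h3
    rw [h3, Pi.sub_apply, h2, h1, potential]
    ring

/-- The decomposition gives explicit absolutely continuous derivatives away from `0`; uniqueness of
weak derivatives identifies them with those in the graph, and hence the right-hand side. -/
theorem OpGraph.singGraph (hν : 0 < ν) (hν1 : ν < 1) (hV : ∀ f : L2,
    (V f : ℝ → ℝ) =ᵐ[volume.restrict (Ioo (-1 : ℝ) 1)] fun x => potential γ n x * f x)
    {f g : L2} (h : OpGraph ν γ n f g) : SingGraph ν f (g - V f) := by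
  obtain ⟨⟨u, a, b, c, d, ⟨u', u'', hH, hc, hc', u0, u0'⟩, hf, hm1, h1, hs, hfl⟩,
    f', f'', w1, w2, hg⟩ := h
  have r1 : IsPrim (-1) 1 u u' := hH.weakDeriv.isPrim hc (hH.memLp'.integrable one_le_two)
  have r2 : IsPrim (-1) 1 u' u'' := hH.weakDeriv'.isPrim hc' (hH.memLp''.integrable one_le_two)
  have p1 := r1.mono (a' := 0) (b' := 1) (by norm_num) zero_le_one le_rfl
  have p2 := r2.mono (a' := 0) (b' := 1) (by norm_num) zero_le_one le_rfl
  have q1 := (r1.mono (a' := -1) (b' := 0) le_rfl (by norm_num) zero_le_one).comp_neg (by norm_num)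
  have q2 := ((r2.mono (a' := -1) (b' := 0) le_rfl (by norm_num) zero_le_one).comp_neg
    (by norm_num)).neg
  simp only [neg_neg, neg_zero] at q1 q2
  obtain ⟨m1, m2⟩ := memLp_Ioo_iff.1 hH.memLp''
  let G : ℝ → ℝ := fun x => -u'' x + (ν ^ 2 - 1 / 4) / x ^ 2 * u x
  let F : ℝ → ℝ := fun x => u x + singularFun ν a b c d x
  let F' : ℝ → ℝ := fun x => u' x + singularFun' ν a b c d x
  have prim : ∀ ε, 0 < ε → ε < 1 → IsPrim ε 1 F F' ∧
      IsPrim ε 1 F' (fun x => u'' x + (ν ^ 2 - 1 / 4) / x ^ 2 * singularFun ν a b c d x) := by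
    intro ε e0 e1
    constructor
    · refine ((p1.mono e0.le e1.le le_rfl).add (isPrim_sing ν c d e0 e1)).congr
        (fun x hx => ?_) (Eventually.of_forall fun x hx => ?_) e1.le
      · simp only [F]; rw [singularFun_of_pos (e0.trans_le hx.1)]
      · simp only [F']; rw [singularFun'_of_pos (e0.trans hx.1)]
    · refine ((p2.mono e0.le e1.le le_rfl).add (isPrim_sing' ν c d e0 e1)).congr
        (fun x hx => ?_) (Eventually.of_forall fun x hx => ?_) e1.le
      · simp only [F']; rw [singularFun'_of_pos (e0.trans_le hx.1)]
      · rw [singularFun_of_pos (e0.trans hx.1)]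
  have primL : ∀ ε, 0 < ε → ε < 1 → IsPrim (-1) (-ε) F F' ∧
      IsPrim (-1) (-ε) F' (fun x => u'' x + (ν ^ 2 - 1 / 4) / x ^ 2 * singularFun ν a b c d x) := by
    intro ε e0 e1
    have l1 := ((q1.mono e0.le e1.le le_rfl).add (isPrim_sing ν a b e0 e1)).comp_neg e1.le
    have l2 := (((q2.mono e0.le e1.le le_rfl).add (isPrim_sing' ν a b e0 e1)).comp_neg e1.le).neg
    constructor
    · refine l1.congr (fun x hx => ?_) (Eventually.of_forall fun x hx => ?_) (by linarith)
      · have := singularFun_neg_of_pos (ν := ν) (a := a) (b := b) (c := c) (d := d)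
          (x := -x) (by linarith [hx.2])
        simp only [F, neg_neg] at this ⊢
        rw [this]
      · have := singularFun'_neg_of_pos (ν := ν) (a := a) (b := b) (c := c) (d := d)
          (x := -x) (by linarith [hx.2])
        simp only [F', neg_neg] at this ⊢
        rw [this]; ring
    · refine l2.congr (fun x hx => ?_) (Eventually.of_forall fun x hx => ?_) (by linarith)
      · have := singularFun'_neg_of_pos (ν := ν) (a := a) (b := b) (c := c) (d := d)
          (x := -x) (by linarith [hx.2])
        simp only [F', neg_neg] at this ⊢
        rw [this]; ring
      · have := singularFun_neg_of_pos (ν := ν) (a := a) (b := b) (c := c) (d := d)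
          (x := -x) (by linarith [hx.2])
        simp only [neg_neg, neg_sq] at this ⊢
        rw [this]
  have W1 := hasWeakDerivOn_punctured (fun ε e0 e1 => (prim ε e0 e1).1)
    (fun ε e0 e1 => (primL ε e0 e1).1)
  have W2 := hasWeakDerivOn_punctured (fun ε e0 e1 => (prim ε e0 e1).2)
    (fun ε e0 e1 => (primL ε e0 e1).2)
  have e1 := w1.ae_unique isOpen_punctured (ae_punctured_iff.2 hf) W1
  have e2 := ae_punctured_iff.1 (w2.ae_unique isOpen_punctured e1 W2)
  have hG : ∀ᵐ x ∂(volume.restrict (Ioo (-1 : ℝ) 1)), (g - V f : L2) x = G x := by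
    filter_upwards [hg, hf, e2, hV f, Lp.coeFn_sub g (V f)] with x k1 k2 k3 k4 k5
    rw [k5, Pi.sub_apply, k4, k1, k3, k2, potential]
    simp only [G]
    ring
  obtain ⟨n1, n2⟩ := memLp_Ioo_iff.1 (Lp.memLp (g - V f))
  obtain ⟨g1, g2⟩ := ae_Ioo_iff.1 hG
  refine ⟨F, F', a, b, c, d, ⟨?_, ?_, hs, hfl⟩, hf⟩
  · refine (halfSol_of_regular hν hν1 p1 p2 u0 u0' m1 n1 g1 ?_).congr (fun x hx => ?_)
      fun x hx => ?_
    · rw [← singularFun_of_pos (a := a) (b := b) one_pos]; exact h1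
    · simp only [F]; rw [singularFun_of_pos hx]
    · simp only [F']; rw [singularFun'_of_pos hx]
  · refine (halfSol_of_regular (u := fun x => u (-x)) (u' := fun x => -u' (-x))
      (u'' := fun x => u'' (-x)) hν hν1 q1 q2 (by simp [u0]) (by simp [u0']) m2 n2 ?_ ?_).congr
      (fun x hx => ?_) fun x hx => ?_
    · simpa only [G, neg_sq] using g2
    · rw [← singularFun_neg_of_pos (c := c) (d := d) one_pos]; exact hm1
    · simp only [F]; rw [singularFun_neg_of_pos hx]
    · simp only [F']; rw [singularFun'_neg_of_pos hx]; ring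

end OpGraph

/-! ### Uniqueness and conclusion -/

/-- Two solutions with the same initial value agree. -/
theorem IsSolution.unique {ν γ : ℝ} {n : ℕ} {f₀ : L2} {f g : ℝ → L2}
    (hmono : ∀ u v k l : L2, OpGraph ν γ n u k → OpGraph ν γ n v l →
      0 ≤ inner ℝ (k - l) (u - v))
    (hf : IsSolution ν γ n f₀ f) (hg : IsSolution ν γ n f₀ g) {t : ℝ} (ht : 0 ≤ t) :
    g t = f t := by
  have hd : ∀ {k : ℝ → L2}, IsSolution ν γ n f₀ k → ∀ t, 0 < t → HasDerivAt k (deriv k t) t :=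
    fun hk t ht => ((hk.contDiffOn.differentiableOn one_ne_zero).differentiableAt
      (Ioi_mem_nhds ht)).hasDerivAt
  have hw : ∀ t, 0 < t → HasDerivAt (fun t => ‖g t - f t‖ ^ 2)
      (2 * inner ℝ (g t - f t) (deriv g t - deriv f t)) t := fun t ht =>
    ((hd hg t ht).sub (hd hf t ht)).norm_sq
  -- Energy estimate: by monotonicity of the operator the squared distance of two solutions has
  -- nonpositive derivative. Continuity at `0` lets the comparison start from the common initial
  -- value.
  have hanti : AntitoneOn (fun t => ‖g t - f t‖ ^ 2) (Ici 0) := by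
    refine antitoneOn_of_deriv_nonpos (convex_Ici 0)
      ((hg.continuousOn.sub hf.continuousOn).norm.pow 2) ?_ ?_
    · rw [interior_Ici]
      exact fun t ht => (hw t ht).differentiableAt.differentiableWithinAt
    · rw [interior_Ici]
      intro t ht
      rw [(hw t ht).deriv]
      obtain ⟨k, hk, ek⟩ := hg.equation t ht
      obtain ⟨l, hl, el⟩ := hf.equation t ht
      have := hmono _ _ _ _ hk hl
      rw [eq_neg_of_add_eq_zero_left ek, eq_neg_of_add_eq_zero_left el,
        show -k - -l = -(k - l) by abel, inner_neg_right, real_inner_comm]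
      linarith
  have h0 := hanti self_mem_Ici ht ht
  simp only [hf.init, hg.init, sub_self, norm_zero] at h0
  have h1 : ‖g t - f t‖ = 0 := by
    have : ‖g t - f t‖ ^ 2 = 0 := le_antisymm (by simpa using h0) (sq_nonneg _)
    simpa using this
  exact sub_eq_zero.1 (norm_eq_zero.1 h1)

theorem exists_solution {ν γ : ℝ} (hν : 0 < ν) (hν1 : ν < 1) (hγ : 0 < γ) (n : ℕ)
    (f₀ : L2) : ∃ f : ℝ → L2, IsSolution ν γ n f₀ f ∧
      (∀ g : ℝ → L2, IsSolution ν γ n f₀ g → ∀ t, 0 ≤ t → g t = f t) ∧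
      ∀ t, 0 ≤ t → ‖f t‖ ≤ ‖f₀‖ := by
  obtain ⟨V, hV⟩ := exists_potentialOp hγ n
  have hiff : ∀ {f g : L2}, OpGraph ν γ n f g ↔ SingGraph ν f (g - V f) := fun {f g} =>
    ⟨fun h => h.singGraph hν hν1 hV, fun h => h.opGraph hV⟩
  obtain ⟨κ, hκ, hsurj⟩ := exists_surjective_shift (V := V) (SingGraph.symm hν hν1)
    (SingGraph.nonneg hν hν1) (kernelProj_symm hν hν1) (kernelProj_nonneg hν hν1)
    (potentialOp_nonneg hV) (exists_singGraph_add_kernelProj hν hν1)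
  obtain ⟨R, hR, hsym, hpos, hnorm, hinv⟩ := exists_resolvent (A := OpGraph ν γ n) hκ
    (fun f g k l h1 h2 => by
      have := SingGraph.symm hν hν1 _ _ _ _ (hiff.1 h1) (hiff.1 h2)
      rw [inner_sub_left, inner_sub_right, potentialOp_symm hV] at this
      linarith)
    (fun f g h => by
      have h1 := SingGraph.nonneg hν hν1 _ _ (hiff.1 h)
      have h2 := potentialOp_nonneg hV f
      rw [inner_sub_left] at h1
      linarith)
    (fun h => by
      obtain ⟨f, hf⟩ := hsurj h
      exact ⟨f, hiff.2 hf⟩)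
  -- Single-valuedness of the operator at `0` makes the resolvent injective; by symmetry its range,
  -- and so the domain, is dense.
  have hinj : ∀ h, R h = 0 → h = 0 := fun h hh => by
    have h1 := hR h
    have h2 := hR 0
    rw [hh, smul_zero, sub_zero] at h1
    rw [map_zero, smul_zero, sub_zero] at h2
    exact h1.unique h2
  have hmono : ∀ u v k l : L2, OpGraph ν γ n u k → OpGraph ν γ n v l →
      0 ≤ inner ℝ (k - l) (u - v) := by
    intro u v k l hu hv
    -- Linearity of the graph is read off from linearity of the resolvent, so positivity can be
    -- applied to the difference `u - v`.
    have e : R ((k - l) + κ • (u - v)) = u - v := by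
      rw [show (k - l) + κ • (u - v) = (k + κ • u) - (l + κ • v) by rw [smul_sub]; abel, map_sub,
        hinv _ _ hu, hinv _ _ hv]
    have h1 := hiff.1 (hR ((k - l) + κ • (u - v)))
    rw [e, add_sub_cancel_right] at h1
    have h2 := SingGraph.nonneg hν hν1 _ _ h1
    have h3 := potentialOp_nonneg hV (u - v)
    rw [inner_sub_left] at h2
    linarith
  obtain ⟨Φ, hΦ⟩ := exists_functionalCalculus hsym hpos hnorm
  obtain ⟨f, g, hf0, hfc, hfg, hfd, hgc, hle⟩ := hΦ.exists_heat_flow hκ hR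
    (denseRange_of_symmetric_injective hsym hinj) f₀
  have hsol : IsSolution ν γ n f₀ f := by
    refine ⟨hf0, hfc, ⟨g, hfg, (hfc.mono Ioi_subset_Ici_self).prodMk hgc⟩, ?_, fun t ht =>
      ⟨g t, hfg t ht, by rw [(hfd t ht).deriv, neg_add_cancel]⟩⟩
    rw [show (1 : WithTop ℕ∞) = 0 + 1 by simp, contDiffOn_succ_iff_deriv_of_isOpen isOpen_Ioi]
    refine ⟨fun t ht => (hfd t ht).differentiableAt.differentiableWithinAt, by simp, ?_⟩
    rw [contDiffOn_zero]
    exact hgc.neg.congr fun t ht => (hfd t ht).deriv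
  exact ⟨f, hsol, fun k hk t ht => hsol.unique hmono hk ht, hle⟩

end SingularHeat

theorem proposition2p2 (ν γ : ℝ) (hν : ν ∈ Set.Ioo (0 : ℝ) 1) (hγ : 0 < γ)
    (n : ℕ) (hn : 1 ≤ n) (f₀ : SingularHeat.L2) :
    ∃ f : ℝ → SingularHeat.L2,
      SingularHeat.IsSolution ν γ n f₀ f ∧
      (∀ g : ℝ → SingularHeat.L2, SingularHeat.IsSolution ν γ n f₀ g →
        ∀ t, 0 ≤ t → g t = f t) ∧
      ∀ t, 0 ≤ t → ‖f t‖ ≤ ‖f₀‖ :=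
  SingularHeat.exists_solution hν.1 hν.2 hγ n f₀
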